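/- Let $N\ge 0$ be an integer, let $q$ be a formal variable and $\mathcal A=\mathbb C[q,q^{-1}]$. Let $\widehat{\mathfrak{gl}}_N=\mathfrak{gl}_N[\lambda,\lambda^{-1}]$ be the loop Lie algebra over $\mathbb C$, and let $\widehat{\mathfrak{gl}}_N^{\,\theta}$ be the fixed point subalgebra of its automorphism $\theta: E_{ij}\lambda^p\mapsto -E_{ji}\lambda^{-p}$. Let $\mathrm U_q(\widehat{\mathfrak{gl}}_N)$ be the associative $\mathbb C(q)$-algebra with generators $t_{ij}^{(r)},\bar t_{ij}^{\,(r)}$ ($1\le i,j\le N$, $r\ge 0$), collected in the matrices $T(u)=(t_{ij}(u))$, $\overline T(u)=(\bar t_{ij}(u))$ with $t_{ij}(u)=\sum_{r\ge0}t_{ij}^{(r)}u^{-r}$ and $\bar t_{ij}(u)=\sum_{r\ge0}\bar t_{ij}^{\,(r)}u^{r}$, and with defining relations $$t_{ij}^{(0)}=\bar t_{ji}^{\,(0)}=0\ (i<j),\qquad t_{ii}^{(0)}\bar t_{ii}^{\,(0)}=\bar t_{ii}^{\,(0)}t_{ii}^{(0)}=1,$$ $$R(u,v)T_1(u)T_2(v)=T_2(v)T_1(u)R(u,v),\quad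 R(u,v)\overline T_1(u)\overline T_2(v)=\overline T_2(v)\overline T_1(u)R(u,v),\quad R(u,v)\overline T_1(u)T_2(v)=T_2(v)\overline T_1(u)R(u,v),$$ where the subscripts $1,2$ indicate the tensor factor of $\mathrm{End}\,\mathbb C^N\otimes\mathrm{End}\,\mathbb C^N$ in which a matrix acts and $$R(u,v)=(u-v)\sum_{i\ne j}E_{ii}\otimes E_{jj}+(q^{-1}u-qv)\sum_iE_{ii}\otimes E_{ii}+(q^{-1}-q)u\sum_{i>j}E_{ij}\otimes E_{ji}+(q^{-1}-q)v\sum_{i<j}E_{ij}\otimes E_{ji}.$$ Let $\mathrm U_{\mathcal A}$ be the $\mathcal A$-subalgebra of $\mathrm U_q(\widehat{\mathfrak{gl}}_N)$ generated by $\tau_{ij}^{(r)}=t_{ij}^{(r)}/(q-q^{-1})$ and $\bar\tau_{ij}^{(r)}=\bar t_{ij}^{\,(r)}/(q-q^{-1})$ for $(r,i,j)$ not of the form $(0,i,i)$, together with $\tau_{ii}^{(0)}=(t_{ii}^{(0)}-1)/(q-1)$ and $\bar\tau_{ii}^{(0)}=(\bar t_{ii}^{\,(0)}-1)/(q-1)$.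 Regard $\mathbb C$ as an $\mathcal A$-algebra via $q\mapsto1$. Let the twisted $q$-Yangian $\mathrm Y^{\rm tw}_q(\mathfrak o_N)$ be the $\mathbb C(q)$-subalgebra of $\mathrm U_q(\widehat{\mathfrak{gl}}_N)$ generated by the coefficients $s_{ij}^{(r)}$ of the series $s_{ij}(u)=\sum_{a=1}^N t_{ia}(u)\,\bar t_{ja}(u^{-1})=\sum_{r\ge0}s_{ij}^{(r)}u^{-r}$. Then $\mathrm Y^{\rm tw}_q(\mathfrak o_N)$ specializes to $\mathrm U(\widehat{\mathfrak{gl}}_N^{\,\theta})$ as $q\to1$. That is: there is an isomorphism of $\mathbb C$-algebras $\Phi:\mathrm U_{\mathcal A}\otimes_{\mathcal A}\mathbb C\to\mathrm U(\widehat{\mathfrak{gl}}_N)$ with $\tau_{ij}^{(r)}\mapsto E_{ij}\lambda^r$ (unless $r=0$ and $i<j$) and $\bar\tau_{ij}^{(r)}\mapsto -E_{ij}\lambda^{-r}$ (unless $r=0$ and $i>j$); the natural map $\mathrm U(\widehat{\mathfrak{gl}}_N^{\,\theta})\to\mathrm U(\widehat{\mathfrak{gl}}_N)$ is injective; and, for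 $V=\mathrm Y^{\rm tw}_q(\mathfrak o_N)$ and $V_{\mathcal A}=V\cap\mathrm U_{\mathcal A}$, the composition of the natural map $V_{\mathcal A}\otimes_{\mathcal A}\mathbb C\to\mathrm U_{\mathcal A}\otimes_{\mathcal A}\mathbb C$ with $\Phi$ is an isomorphism of $V_{\mathcal A}\otimes_{\mathcal A}\mathbb C$ onto the subalgebra $\mathrm U(\widehat{\mathfrak{gl}}_N^{\,\theta})$ of $\mathrm U(\widehat{\mathfrak{gl}}_N)$. -/

import Mathlib

open scoped TensorProduct LaurentPolynomial Kronecker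

noncomputable section

namespace TwistedQYangian

/-! ### Ground rings -/

/-- The ring `𝒜 = ℂ[q, q⁻¹]`; the variable `q` is `LaurentPolynomial.T 1`. -/
abbrev A : Type := ℂ[T;T⁻¹]

/-- The field `ℂ(q)` of rational functions, realized as the field of fractions of `ℂ[q, q⁻¹]`. -/
abbrev K : Type := FractionRing A

/-- The formal variable `q` as an element of `ℂ(q)`. -/
def q : K := algebraMap A K (LaurentPolynomial.T 1)

/-- Evaluation `ℂ[q, q⁻¹] → ℂ` at `q = 1`. -/
def evalOne : A →+* ℂ := LaurentPolynomial.eval₂ (RingHom.id ℂ) 1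

/-- `ℂ` as an algebra over `ℂ[q, q⁻¹]`, with `q` acting as `1`. -/
instance algebraAtOne : Algebra A ℂ := evalOne.toAlgebra

/-! ### The quantum affine algebra in its `R`-matrix presentation -/

/-- The generators: `t r i j` is `t_{ij}^{(r)}` and `tbar r i j` is `t̄_{ij}^{(r)}`. -/
inductive Gen (N : ℕ) : Type
  | t (r : ℕ) (i j : Fin N) : Gen N
  | tbar (r : ℕ) (i j : Fin N) : Gen N

/-- The free associative algebra over `ℂ(q)` on the generators. -/
abbrev Free (N : ℕ) : Type := FreeAlgebra K (Gen N)

/-- The matrix unit `E_{ij}` over `ℂ(q)`. -/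
def E {N : ℕ} (i j : Fin N) : Matrix (Fin N) (Fin N) K := Matrix.single i j 1

/-- The coefficient of `u` in the trigonometric `R`-matrix
`R(u,v) = (u - v) ∑_{i ≠ j} E_{ii} ⊗ E_{jj} + (q⁻¹ u - q v) ∑_i E_{ii} ⊗ E_{ii}
  + (q⁻¹ - q) u ∑_{i > j} E_{ij} ⊗ E_{ji} + (q⁻¹ - q) v ∑_{i < j} E_{ij} ⊗ E_{ji}`. -/
def Ru (N : ℕ) : Matrix (Fin N × Fin N) (Fin N × Fin N) K :=
  (∑ i, ∑ j, if i ≠ j then E i i ⊗ₖ E j j else 0) + q⁻¹ • (∑ i, E i i ⊗ₖ E i i)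
    + (q⁻¹ - q) • (∑ i, ∑ j, if j < i then E i j ⊗ₖ E j i else 0)

/-- The coefficient of `v` in the trigonometric `R`-matrix `R(u,v)`. -/
def Rv (N : ℕ) : Matrix (Fin N × Fin N) (Fin N × Fin N) K :=
  -(∑ i, ∑ j, if i ≠ j then E i i ⊗ₖ E j j else 0) - q • (∑ i, E i i ⊗ₖ E i i)
    + (q⁻¹ - q) • (∑ i, ∑ j, if i < j then E i j ⊗ₖ E j i else 0)

/-- The coefficient of `u ^ m` (`m ∈ ℤ`) in the matrix `T(u)`, where
`t_{ij}(u) = ∑_{r ≥ 0} t_{ij}^{(r)} u^{-r}`. -/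
def tCoeff (N : ℕ) (m : ℤ) : Matrix (Fin N) (Fin N) (Free N) :=
  fun i j => if m ≤ 0 then FreeAlgebra.ι K (Gen.t m.natAbs i j) else 0

/-- The coefficient of `u ^ m` (`m ∈ ℤ`) in the matrix `T̄(u)`, where
`t̄_{ij}(u) = ∑_{r ≥ 0} t̄_{ij}^{(r)} u^r`. -/
def tbarCoeff (N : ℕ) (m : ℤ) : Matrix (Fin N) (Fin N) (Free N) :=
  fun i j => if 0 ≤ m then FreeAlgebra.ι K (Gen.tbar m.natAbs i j) else 0

/-- For formal series of matrices `X(u)` and `Y(v)` (given by their coefficients), the coefficient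
of `u ^ m v ^ n` in `R(u,v) X₁(u) Y₂(v)`, where `X₁ = X ⊗ 1` and `Y₂ = 1 ⊗ Y`. -/
def rttLeft (N : ℕ) (X Y : ℤ → Matrix (Fin N) (Fin N) (Free N)) (m n : ℤ) :
    Matrix (Fin N × Fin N) (Fin N × Fin N) (Free N) :=
  (Ru N).map (algebraMap K (Free N)) * ((X (m - 1) ⊗ₖ 1) * (1 ⊗ₖ Y n))
    + (Rv N).map (algebraMap K (Free N)) * ((X m ⊗ₖ 1) * (1 ⊗ₖ Y (n - 1)))

/-- The coefficient of `u ^ m v ^ n` in `Y₂(v) X₁(u) R(u,v)`. -/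
def rttRight (N : ℕ) (X Y : ℤ → Matrix (Fin N) (Fin N) (Free N)) (m n : ℤ) :
    Matrix (Fin N × Fin N) (Fin N × Fin N) (Free N) :=
  ((1 ⊗ₖ Y n) * (X (m - 1) ⊗ₖ 1)) * (Ru N).map (algebraMap K (Free N))
    + ((1 ⊗ₖ Y (n - 1)) * (X m ⊗ₖ 1)) * (Rv N).map (algebraMap K (Free N))

/-- The defining relations of the quantum affine algebra. -/
inductive Rel (N : ℕ) : Free N → Free N → Prop
  | t_zero (i j : Fin N) (h : i < j) : Rel N (FreeAlgebra.ι K (Gen.t 0 i j)) 0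
  | tbar_zero (i j : Fin N) (h : i < j) : Rel N (FreeAlgebra.ι K (Gen.tbar 0 j i)) 0
  | t_mul_tbar (i : Fin N) :
      Rel N (FreeAlgebra.ι K (Gen.t 0 i i) * FreeAlgebra.ι K (Gen.tbar 0 i i)) 1
  | tbar_mul_t (i : Fin N) :
      Rel N (FreeAlgebra.ι K (Gen.tbar 0 i i) * FreeAlgebra.ι K (Gen.t 0 i i)) 1
  | rtt (m n : ℤ) (x y : Fin N × Fin N) :
      Rel N (rttLeft N (tCoeff N) (tCoeff N) m n x y) (rttRight N (tCoeff N) (tCoeff N) m n x y)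
  | rtbartbar (m n : ℤ) (x y : Fin N × Fin N) :
      Rel N (rttLeft N (tbarCoeff N) (tbarCoeff N) m n x y)
        (rttRight N (tbarCoeff N) (tbarCoeff N) m n x y)
  | rtbart (m n : ℤ) (x y : Fin N × Fin N) :
      Rel N (rttLeft N (tbarCoeff N) (tCoeff N) m n x y)
        (rttRight N (tbarCoeff N) (tCoeff N) m n x y)

/-- The quantum affine algebra `U_q(ĝl_N)` over `ℂ(q)`. -/
abbrev Uq (N : ℕ) : Type := RingQuot (Rel N)

/-- The generator `t_{ij}^{(r)}` of `U_q(ĝl_N)`. -/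
def t {N : ℕ} (r : ℕ) (i j : Fin N) : Uq N :=
  RingQuot.mkAlgHom K (Rel N) (FreeAlgebra.ι K (Gen.t r i j))

/-- The generator `t̄_{ij}^{(r)}` of `U_q(ĝl_N)`. -/
def tbar {N : ℕ} (r : ℕ) (i j : Fin N) : Uq N :=
  RingQuot.mkAlgHom K (Rel N) (FreeAlgebra.ι K (Gen.tbar r i j))

/-! ### The orthogonal twisted `q`-Yangian -/

/-- The coefficient `s_{ij}^{(r)}` of `u^{-r}` in `s_{ij}(u) = ∑_a t_{ia}(u) t̄_{ja}(u⁻¹)`. -/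
def s {N : ℕ} (r : ℕ) (i j : Fin N) : Uq N :=
  ∑ a, ∑ p ∈ Finset.HasAntidiagonal.antidiagonal r, t p.1 i a * tbar p.2 j a

/-- The twisted `q`-Yangian `Y_q^tw(o_N)`: the `ℂ(q)`-subalgebra of `U_q(ĝl_N)` generated by all
the `s_{ij}^{(r)}`. -/
def Ytw (N : ℕ) : Subalgebra K (Uq N) :=
  Algebra.adjoin K {x | ∃ (r : ℕ) (i j : Fin N), x = s r i j}

/-! ### The integral form -/

/-- `τ_{ij}^{(r)}`. -/
def tau {N : ℕ} (r : ℕ) (i j : Fin N) : Uq N :=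
  if r = 0 ∧ i = j then (q - 1)⁻¹ • (t r i j - 1) else (q - q⁻¹)⁻¹ • t r i j

/-- `τ̄_{ij}^{(r)}`. -/
def taubar {N : ℕ} (r : ℕ) (i j : Fin N) : Uq N :=
  if r = 0 ∧ i = j then (q - 1)⁻¹ • (tbar r i j - 1) else (q - q⁻¹)⁻¹ • tbar r i j

/-- The `𝒜`-subalgebra `U_𝒜` of `U_q(ĝl_N)` generated by all `τ_{ij}^{(r)}`, `τ̄_{ij}^{(r)}`. -/
def UA (N : ℕ) : Subalgebra A (Uq N) :=
  Algebra.adjoin A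
    ({x | ∃ (r : ℕ) (i j : Fin N), x = tau r i j} ∪
      {x | ∃ (r : ℕ) (i j : Fin N), x = taubar r i j})

/-- `τ_{ij}^{(r)}` as an element of `U_𝒜`. -/
def tauA {N : ℕ} (r : ℕ) (i j : Fin N) : UA N :=
  ⟨tau r i j, Algebra.subset_adjoin (Or.inl ⟨r, i, j, rfl⟩)⟩

/-- `τ̄_{ij}^{(r)}` as an element of `U_𝒜`. -/
def taubarA {N : ℕ} (r : ℕ) (i j : Fin N) : UA N :=
  ⟨taubar r i j, Algebra.subset_adjoin (Or.inr ⟨r, i, j, rfl⟩)⟩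

/-- `V_𝒜 = V ∩ U_𝒜` for a subalgebra `V` of `U_q(ĝl_N)`. -/
def integralPart {N : ℕ} (V : Subalgebra K (Uq N)) : Subalgebra A (Uq N) :=
  V.restrictScalars A ⊓ UA N

/-- The map `V_𝒜 ⊗_𝒜 ℂ → U_𝒜 ⊗_𝒜 ℂ` induced by the inclusion (the factor `ℂ` is written first). -/
def specializedInclusion {N : ℕ} (V : Subalgebra K (Uq N)) :
    ℂ ⊗[A] integralPart V →ₐ[ℂ] ℂ ⊗[A] UA N :=
  Algebra.TensorProduct.map (AlgHom.id ℂ ℂ)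
    (Subalgebra.inclusion (inf_le_right : integralPart V ≤ UA N))

/-! ### The loop algebra and its fixed point subalgebra -/

/-- The Lie algebra `ĝl_N = gl_N[λ, λ⁻¹]` over `ℂ`: matrices over the Laurent polynomials in `λ`
(with `λ = LaurentPolynomial.T 1`) under the commutator bracket. -/
abbrev LoopGL (N : ℕ) : Type := Matrix (Fin N) (Fin N) ℂ[T;T⁻¹]

instance loopGLLieRing (N : ℕ) : LieRing (LoopGL N) := LieRing.ofAssociativeRing

instance loopGLLieAlgebra (N : ℕ) : LieAlgebra ℂ (LoopGL N) := LieAlgebra.ofAssociativeAlgebra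

/-- The element `E_{ij} λ^p` of `ĝl_N`. -/
def Eloop {N : ℕ} (i j : Fin N) (p : ℤ) : LoopGL N :=
  Matrix.single i j (LaurentPolynomial.T p)

/-- The automorphism `θ` of the Lie algebra `ĝl_N` given by `X(λ) ↦ -X(λ⁻¹)ᵗ`. -/
def theta (N : ℕ) : LoopGL N →ₗ⁅ℂ⁆ LoopGL N where
  toFun X := -(X.transpose.map (LaurentPolynomial.invert (R := ℂ)))
  map_add' X Y := by
    ext i j : 2
    simp [add_comm]
  map_smul' c X := by
    ext i j : 2
    simp
  map_lie' {X Y} := by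
    ext i j : 2
    simp [LieRing.of_associative_ring_bracket, Matrix.mul_apply, mul_comm]

theorem theta_Eloop {N : ℕ} (i j : Fin N) (p : ℤ) :
    theta N (Eloop i j p) = -Eloop j i (-p) := by
  simp [theta, Eloop, Matrix.transpose_single, Matrix.map_single]

/-- The fixed point subalgebra `ĝl_N^θ`. -/
def fixedLoopGL (N : ℕ) : LieSubalgebra ℂ (LoopGL N) where
  carrier := {x | theta N x = x}
  add_mem' := fun {x y} hx hy => by
    have hx : theta N x = x := hx
    have hy : theta N y = y := hy
    change theta N (x + y) = x + y
    rw [map_add, hx, hy]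
  zero_mem' := map_zero _
  smul_mem' := fun c x hx => by
    have hx : theta N x = x := hx
    change theta N (c • x) = c • x
    rw [map_smul, hx]
  lie_mem' := fun {x y} hx hy => by
    have hx : theta N x = x := hx
    have hy : theta N y = y := hy
    change theta N ⁅x, y⁆ = ⁅x, y⁆
    rw [LieHom.map_lie, hx, hy]

/-- The universal enveloping algebra `U(ĝl_N)`. -/
abbrev ULoopGL (N : ℕ) : Type := UniversalEnvelopingAlgebra ℂ (LoopGL N)

/-- The element `E_{ij} λ^p` of `U(ĝl_N)`. -/
def EU {N : ℕ} (i j : Fin N) (p : ℤ) : ULoopGL N :=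
  UniversalEnvelopingAlgebra.ι ℂ (Eloop i j p)

/-- The natural homomorphism `U(ĝl_N^θ) → U(ĝl_N)` induced by the inclusion. -/
def fixedEnvelopingMap (N : ℕ) :
    UniversalEnvelopingAlgebra ℂ (fixedLoopGL N) →ₐ[ℂ] ULoopGL N :=
  letI : LieRing (ULoopGL N) := LieRing.ofAssociativeRing
  UniversalEnvelopingAlgebra.lift ℂ
    ((UniversalEnvelopingAlgebra.ι ℂ).comp (fixedLoopGL N).incl)

/-! ### Specialization as `q → 1` -/

/-- `Φ` is the identification `U_𝒜 ⊗_𝒜 ℂ ≅ U(ĝl_N)` with `τ_{ij}^{(r)} ↦ E_{ij} λ^r` and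
`τ̄_{ij}^{(r)} ↦ -E_{ij} λ^{-r}`, except that `τ_{ij}^{(0)} = τ̄_{ji}^{(0)} = 0` for `i < j`. -/
def IsClassicalLimit {N : ℕ} (Φ : ℂ ⊗[A] UA N ≃ₐ[ℂ] ULoopGL N) : Prop :=
  (∀ (r : ℕ) (i j : Fin N), ¬(r = 0 ∧ i < j) → Φ (1 ⊗ₜ[A] tauA r i j) = EU i j r) ∧
  (∀ (r : ℕ) (i j : Fin N), ¬(r = 0 ∧ j < i) → Φ (1 ⊗ₜ[A] taubarA r i j) = -EU i j (-r))

/-- The subalgebra `V` of `U_q(ĝl_N)` specializes to the subalgebra `V₀` of `U(ĝl_N)` as `q → 1`: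
the map `V_𝒜 ⊗_𝒜 ℂ → U_𝒜 ⊗_𝒜 ℂ ≅ U(ĝl_N)` is an isomorphism of `V_𝒜 ⊗_𝒜 ℂ` onto `V₀`. -/
def Specializes {N : ℕ} (Φ : ℂ ⊗[A] UA N ≃ₐ[ℂ] ULoopGL N) (V : Subalgebra K (Uq N))
    (V₀ : Subalgebra ℂ (ULoopGL N)) : Prop :=
  ∃ Ψ : ℂ ⊗[A] integralPart V ≃ₐ[ℂ] V₀, ∀ x, (Ψ x : ULoopGL N) = Φ (specializedInclusion V x)

end TwistedQYangian

end

/-! Two bounds carry the theorem: the specialization of `UA` is no smaller than the enveloping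
algebra of the loop algebra, and the limit of `Ytw` is no larger than that of the fixed point
subalgebra. Both come from coactions; no Poincaré–Birkhoff–Witt theorem is used, classical or
quantum.

For a Lie homomorphism f from L to an associative algebra G, the rule x ↦ x ⊗ 1 + 1 ⊗ f(x) extends
to δ_f : U(L) → U(L) ⊗ G. The difference δ_f(u) - u ⊗ 1 lowers the standard filtration by one. If κ
is a linear left inverse of f, multiplying back through κ acts on degree d as the scalar d, modulo
lower degree. In characteristic zero, induction on the degree shows that a linear map compatible
with coactions and not killing 1 is injective (`injective_of_coaction`). It also shows that, for an
involution σ of G, an element with δ_id(u) = δ_σ(u) is generated by fixed points of σ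
(`mem_adjoin_of_coaction_eq`).

Quantum lifts of δ_id and δ_θ come from the R-matrix. By the Yang–Baxter equation it is a linear
solution u A + B of the ternary relation with matrix entries. Multiplying T(u) and T̄(u) by such a
solution and dividing by a scalar linear in u gives homomorphisms from `Uq` to `Uq` ⊗ gl_N[λ, λ⁻¹]
(`LoopTwist.delta`). The R-matrix itself lifts θ and its transpose lifts the identity. Both
homomorphisms preserve the integral form and become δ_θ and δ_id at q = 1.

The leading terms of the ternary relations at q = 1 are the loop algebra relations
(`bracketDefect_eq_zero`), which gives a surjection `loopHom` from U(ĝl_N) onto the specialization.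
It is injective by the coaction criterion, since the counit shows that 1 survives; its inverse is Φ.

The two quantum homomorphisms agree on every s_{ij}^{(r)} (`delta_s_eq`), because R commutes with
its partial transpose in the required sense. Hence δ_id = δ_θ on the limit of `Ytw`, which therefore
lies in the enveloping algebra of the fixed points. Conversely s_{ij}^{(r)}/(q - 1) tends to twice
E_{ij}λ^r - E_{ji}λ^{-r} when r > 0 or i > j, and these elements span the fixed points. Finally,
intersecting a ℂ(q)-subspace with `UA` gives a submodule saturated for q - 1, so specialization of
the inclusion is injective. -/

noncomputable section

namespace TwistedQYangian

/-! ### Coactions on enveloping algebras -/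

section Enveloping

attribute [local instance] LieRing.ofAssociativeRing

open UniversalEnvelopingAlgebra

section TensorSubmodule

variable {k U G X : Type*} [Field k] [AddCommGroup U] [Module k U] [AddCommGroup G] [Module k G]
  [AddCommGroup X] [Module k X]

/-- The image of `W ⊗ G` in `U ⊗ G` for a subspace `W` of `U`. -/
def tensorSubmodule (G : Type*) [AddCommGroup G] [Module k G] (W : Submodule k U) :
    Submodule k (U ⊗[k] G) :=
  LinearMap.range (W.subtype.rTensor G)

theorem tmul_mem_tensorSubmodule {W : Submodule k U} {u : U} (hu : u ∈ W) (g : G) :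
    u ⊗ₜ[k] g ∈ tensorSubmodule G W :=
  ⟨(⟨u, hu⟩ : W) ⊗ₜ g, by simp⟩

theorem tensorSubmodule_le {W : Submodule k U} {Z : Submodule k (U ⊗[k] G)}
    (h : ∀ u ∈ W, ∀ g : G, u ⊗ₜ[k] g ∈ Z) : tensorSubmodule G W ≤ Z := by
  rintro _ ⟨t, rfl⟩
  induction t with
  | zero => simp
  | tmul u g => simpa using h u u.2 g
  | add a b ha hb => rw [map_add]; exact Z.add_mem ha hb

theorem tensorSubmodule_mono {W W' : Submodule k U} (h : W ≤ W') :
    tensorSubmodule G W ≤ tensorSubmodule G W' :=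
  tensorSubmodule_le fun _ hu g => tmul_mem_tensorSubmodule (h hu) g

theorem tensorSubmodule_bot : tensorSubmodule G (⊥ : Submodule k U) = ⊥ := by
  rw [eq_bot_iff]
  refine tensorSubmodule_le fun u hu g => ?_
  rw [(Submodule.mem_bot k).1 hu]
  simp

/-- A linear map out of `U` restricted to `W` has kernel `ker f ⊓ W`, also after tensoring. -/
theorem mem_tensorSubmodule_of_rTensor_eq_zero (W : Submodule k U) (f : U →ₗ[k] X)
    {t : U ⊗[k] G} (ht : t ∈ tensorSubmodule G W) (h : f.rTensor G t = 0) :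
    t ∈ tensorSubmodule G (LinearMap.ker f ⊓ W) := by
  obtain ⟨t, rfl⟩ := ht
  -- Every module over a field is flat, so tensoring with `G` preserves the exactness of ker → W →
  -- X.
  have hex := Module.Flat.rTensor_exact G (LinearMap.exact_subtype_ker_map (f.domRestrict W))
  have h0 : (f.domRestrict W).rTensor G t = 0 := by
    rw [← h, ← LinearMap.comp_apply, ← LinearMap.rTensor_comp]
    rfl
  obtain ⟨s, rfl⟩ := (hex t).1 h0
  rw [← LinearMap.comp_apply, ← LinearMap.rTensor_comp]
  clear h h0
  induction s with
  | zero => simp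
  | tmul u g =>
    rw [LinearMap.rTensor_tmul]
    exact tmul_mem_tensorSubmodule (W := LinearMap.ker f ⊓ W) (u := ((u : W) : U))
      ⟨u.2, u.1.2⟩ g
  | add a b ha hb => rw [map_add]; exact Submodule.add_mem _ ha hb

end TensorSubmodule

variable {k L G : Type*} [Field k] [LieRing L] [LieAlgebra k L] [Ring G] [Algebra k G]

/-- The homomorphism `U(L) → U(L) ⊗ G` with `x ↦ x ⊗ 1 + 1 ⊗ f x` for `x ∈ L`. -/
def coaction (f : L →ₗ⁅k⁆ G) :
    UniversalEnvelopingAlgebra k L →ₐ[k] UniversalEnvelopingAlgebra k L ⊗[k] G :=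
  lift k
    { toFun := fun x => ι k x ⊗ₜ[k] (1 : G) + 1 ⊗ₜ[k] f x
      map_add' := fun x y => by
        simp only [map_add, TensorProduct.add_tmul, TensorProduct.tmul_add]; abel
      map_smul' := fun c x => by
        simp only [map_smul, TensorProduct.smul_tmul', TensorProduct.tmul_smul, smul_add,
          RingHom.id_apply]
      map_lie' := fun {x y} => by
        simp only [LieHom.map_lie, LieRing.of_associative_ring_bracket, mul_add, add_mul,
          Algebra.TensorProduct.tmul_mul_tmul, one_mul, mul_one, TensorProduct.sub_tmul,
          TensorProduct.tmul_sub]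
        abel }

theorem coaction_ι (f : L →ₗ⁅k⁆ G) (x : L) :
    coaction f (ι k x) = ι k x ⊗ₜ[k] (1 : G) + 1 ⊗ₜ[k] f x :=
  lift_ι_apply k _ x

/-- The reduced coaction `u ↦ δ(u) - u ⊗ 1`. -/
def redCoaction (f : L →ₗ⁅k⁆ G) :
    UniversalEnvelopingAlgebra k L →ₗ[k] UniversalEnvelopingAlgebra k L ⊗[k] G :=
  (coaction f).toLinearMap - (TensorProduct.mk k _ G).flip 1

theorem redCoaction_apply (f : L →ₗ⁅k⁆ G) (u : UniversalEnvelopingAlgebra k L) :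
    redCoaction f u = coaction f u - u ⊗ₜ[k] (1 : G) := rfl

theorem redCoaction_one (f : L →ₗ⁅k⁆ G) : redCoaction f 1 = 0 := by
  rw [redCoaction_apply, map_one, Algebra.TensorProduct.one_def, sub_self]

/-- A Leibniz rule with a correction: the last term has one degree less in the left factor than the
other two are allowed to have, so up to lower degree the reduced coaction is a derivation. -/
theorem redCoaction_ι_mul (f : L →ₗ⁅k⁆ G) (x : L) (u : UniversalEnvelopingAlgebra k L) :
    redCoaction f (ι k x * u) = (ι k x ⊗ₜ[k] (1 : G)) * redCoaction f u + u ⊗ₜ[k] f x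
      + (1 ⊗ₜ[k] f x) * redCoaction f u := by
  simp only [redCoaction_apply, map_mul, coaction_ι, mul_sub, add_mul,
    Algebra.TensorProduct.tmul_mul_tmul, one_mul, mul_one]
  abel

/-- The span of `1` and `L` in `U(L)`. -/
def lowDegree (k L : Type*) [Field k] [LieRing L] [LieAlgebra k L] :
    Submodule k (UniversalEnvelopingAlgebra k L) :=
  1 ⊔ LinearMap.range (ι k : L →ₗ⁅k⁆ _).toLinearMap

/-- The standard filtration of `U(L)`, shifted by one: `stdFiltration (d + 1)` is spanned by the
products of at most `d` elements of `L`, and `stdFiltration 0 = ⊥`. -/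
def stdFiltration (k L : Type*) [Field k] [LieRing L] [LieAlgebra k L] :
    ℕ → Submodule k (UniversalEnvelopingAlgebra k L)
  | 0 => ⊥
  | d + 1 => lowDegree k L ^ d

theorem ι_mem_lowDegree (x : L) : ι k x ∈ lowDegree k L :=
  Submodule.mem_sup_right ⟨x, rfl⟩

theorem one_mem_lowDegree : (1 : UniversalEnvelopingAlgebra k L) ∈ lowDegree k L :=
  Submodule.mem_sup_left (Submodule.mem_one.2 ⟨1, map_one _⟩)

theorem ι_mul_mem_stdFiltration {d : ℕ} (x : L) {u : UniversalEnvelopingAlgebra k L}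
    (hu : u ∈ stdFiltration k L d) : ι k x * u ∈ stdFiltration k L (d + 1) := by
  cases d with
  | zero => rw [(Submodule.mem_bot k).1 hu, mul_zero]; exact zero_mem _
  | succ d =>
    rw [stdFiltration, pow_succ']
    exact Submodule.mul_mem_mul (ι_mem_lowDegree x) hu

theorem stdFiltration_le_succ (d : ℕ) : stdFiltration k L d ≤ stdFiltration k L (d + 1) := by
  cases d with
  | zero => exact bot_le
  | succ d =>
    intro u hu
    rw [stdFiltration, pow_succ', ← one_mul u]
    exact Submodule.mul_mem_mul one_mem_lowDegree hu

theorem stdFiltration_mono : Monotone (stdFiltration k L) :=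
  monotone_nat_of_le_succ stdFiltration_le_succ

/-- An induction principle for the members of the filtration. -/
theorem stdFiltration_induction {d : ℕ} {C : UniversalEnvelopingAlgebra k L → Prop}
    (hadd : ∀ u v, C u → C v → C (u + v)) (hlow : ∀ u ∈ stdFiltration k L (d + 1), C u)
    (hι : ∀ x : L, ∀ u ∈ stdFiltration k L (d + 1), C (ι k x * u))
    {u : UniversalEnvelopingAlgebra k L} (hu : u ∈ stdFiltration k L (d + 2)) : C u := by
  rw [stdFiltration, pow_succ'] at hu
  induction hu using Submodule.mul_induction_on' with
  | mem_mul_mem w hw v hv =>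
    obtain ⟨a, ha, b, ⟨x, rfl⟩, rfl⟩ := Submodule.mem_sup.1 hw
    obtain ⟨c, rfl⟩ := Submodule.mem_one.1 ha
    rw [add_mul]
    refine hadd _ _ (hlow _ ?_) (hι x v hv)
    rw [← Algebra.smul_def]
    exact Submodule.smul_mem _ _ hv
  | add a _ b _ ha hb => exact hadd _ _ ha hb

/-- By the universal property, the inclusion of L into the generated subalgebra extends to U(L);
followed by the inclusion into U(L) it is the identity. -/
theorem adjoin_range_ι :
    Algebra.adjoin k (Set.range (ι k : L → UniversalEnvelopingAlgebra k L)) = ⊤ := by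
  set S := Algebra.adjoin k (Set.range (ι k : L → UniversalEnvelopingAlgebra k L))
  let g : L →ₗ⁅k⁆ S :=
    { toFun := fun x => ⟨ι k x, Algebra.subset_adjoin ⟨x, rfl⟩⟩
      map_add' := fun x y => Subtype.ext (map_add (ι k) x y)
      map_smul' := fun c x => Subtype.ext (map_smul (ι k) c x)
      map_lie' := fun {x y} => Subtype.ext (LieHom.map_lie (ι k) x y) }
  have h : S.val.comp (lift k g) = AlgHom.id k _ := by
    ext x
    change S.val (lift k g (ι k x)) = ι k x
    rw [lift_ι_apply]
    rfl
  rw [eq_top_iff]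
  intro u _
  rw [← AlgHom.id_apply (R := k) u, ← h]
  exact (lift k g u).2

theorem exists_mem_stdFiltration (u : UniversalEnvelopingAlgebra k L) :
    ∃ d, u ∈ stdFiltration k L d := by
  -- A claim stable under products: left multiplication by `a` raises the filtration by a bounded
  -- amount. Applying it to 1 gives the result.
  have key : ∀ a : UniversalEnvelopingAlgebra k L,
      (∃ d, ∀ e, ∀ u ∈ stdFiltration k L e, a * u ∈ stdFiltration k L (d + e)) := by
    intro a
    induction (adjoin_range_ι (k := k) (L := L) ▸ Algebra.mem_top :
      a ∈ Algebra.adjoin k (Set.range (ι k : L → UniversalEnvelopingAlgebra k L)))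
      using Algebra.adjoin_induction with
    | mem a ha =>
      obtain ⟨x, rfl⟩ := ha
      exact ⟨1, fun e u hu => add_comm e 1 ▸ ι_mul_mem_stdFiltration x hu⟩
    | algebraMap c =>
      refine ⟨0, fun e u hu => ?_⟩
      rw [zero_add, ← Algebra.smul_def]
      exact Submodule.smul_mem _ _ hu
    | add a b _ _ ha hb =>
      obtain ⟨d, hd⟩ := ha
      obtain ⟨d', hd'⟩ := hb
      refine ⟨d + d', fun e u hu => ?_⟩
      rw [add_mul]
      exact add_mem (stdFiltration_mono (by lia) (hd e u hu))
        (stdFiltration_mono (by lia) (hd' e u hu))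
    | mul a b _ _ ha hb =>
      obtain ⟨d, hd⟩ := ha
      obtain ⟨d', hd'⟩ := hb
      refine ⟨d + d', fun e u hu => ?_⟩
      rw [mul_assoc, add_assoc]
      exact hd _ _ (hd' _ _ hu)
  obtain ⟨d, hd⟩ := key u
  refine ⟨d + 1, ?_⟩
  simpa using hd 1 1 (Submodule.mem_one.2 ⟨1, map_one _⟩)

/-- Subtracting u ⊗ 1 removes the only term in which no factor from L has moved to the right. -/
theorem redCoaction_mem (f : L →ₗ⁅k⁆ G) {d : ℕ} {u : UniversalEnvelopingAlgebra k L}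
    (hu : u ∈ stdFiltration k L (d + 1)) :
    redCoaction f u ∈ tensorSubmodule G (stdFiltration k L d) := by
  induction d generalizing u with
  | zero =>
    obtain ⟨c, rfl⟩ := Submodule.mem_one.1 (by simpa [stdFiltration] using hu)
    rw [Algebra.algebraMap_eq_smul_one, map_smul, redCoaction_one, smul_zero]
    exact zero_mem _
  | succ d ih =>
    refine stdFiltration_induction (C := fun u => redCoaction f u ∈ _) (fun u v h1 h2 => ?_)
      (fun u h => tensorSubmodule_mono (stdFiltration_le_succ d) (ih h)) (fun x u h => ?_) hu
    · rw [map_add]; exact add_mem h1 h2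
    · rw [redCoaction_ι_mul]
      refine add_mem (add_mem ?_ (tmul_mem_tensorSubmodule h _)) ?_
      · refine tensorSubmodule_le (Z := (tensorSubmodule G (stdFiltration k L (d + 1))).comap
          (LinearMap.mulLeft k (ι k x ⊗ₜ[k] (1 : G)))) (fun v hv g => ?_) (ih h)
        simpa using tmul_mem_tensorSubmodule (ι_mul_mem_stdFiltration x hv) g
      · refine tensorSubmodule_le (Z := (tensorSubmodule G (stdFiltration k L (d + 1))).comap
          (LinearMap.mulLeft k (1 ⊗ₜ[k] f x))) (fun v hv g => ?_) (ih h)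
        simpa using tmul_mem_tensorSubmodule (stdFiltration_le_succ d hv) (f x * g)

/-- The linear map `U(L) ⊗ G → U(L)` with `u ⊗ g ↦ κ(g) u`. -/
def contraction (κ : G →ₗ[k] L) :
    UniversalEnvelopingAlgebra k L ⊗[k] G →ₗ[k] UniversalEnvelopingAlgebra k L :=
  TensorProduct.lift ((LinearMap.mul k (UniversalEnvelopingAlgebra k L)).flip.compl₂
    ((ι k : L →ₗ⁅k⁆ _).toLinearMap ∘ₗ κ))

@[simp]
theorem contraction_tmul (κ : G →ₗ[k] L) (u : UniversalEnvelopingAlgebra k L) (g : G) :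
    contraction κ (u ⊗ₜ g) = ι k (κ g) * u := rfl

theorem contraction_mem (κ : G →ₗ[k] L) {d : ℕ} {t : UniversalEnvelopingAlgebra k L ⊗[k] G}
    (ht : t ∈ tensorSubmodule G (stdFiltration k L d)) :
    contraction κ t ∈ stdFiltration k L (d + 1) := by
  refine tensorSubmodule_le (Z := (stdFiltration k L (d + 1)).comap (contraction κ))
    (fun v hv g => ?_) ht
  simpa using ι_mul_mem_stdFiltration (κ g) hv

/-- The Euler operator acts on the degree `d` part of the associated graded algebra as `d`. -/
theorem contraction_redCoaction (f : L →ₗ⁅k⁆ G) (κ : G →ₗ[k] L) (hκ : ∀ x, κ (f x) = x) {d : ℕ}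
    {u : UniversalEnvelopingAlgebra k L} (hu : u ∈ stdFiltration k L (d + 1)) :
    contraction κ (redCoaction f u) - d • u ∈ stdFiltration k L d := by
  induction d generalizing u with
  | zero =>
    obtain ⟨c, rfl⟩ := Submodule.mem_one.1 (by simpa [stdFiltration] using hu)
    rw [Algebra.algebraMap_eq_smul_one, map_smul, redCoaction_one, smul_zero, map_zero, zero_smul,
      sub_zero]
    exact zero_mem _
  | succ d ih =>
    refine stdFiltration_induction
      (C := fun u => contraction κ (redCoaction f u) - (d + 1) • u ∈ _) (fun u v h1 h2 => ?_)
      (fun u h => ?_) (fun x u h => ?_) hu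
    · rw [map_add, map_add, smul_add, add_sub_add_comm]; exact add_mem h1 h2
    · exact sub_mem (contraction_mem κ (redCoaction_mem f h)) (nsmul_mem h _)
    -- Moving κ(g) past x costs only the bracket [κ(g), x], a single element of L, hence a term of
    -- lower degree.
    · have h1 : contraction κ ((ι k x ⊗ₜ[k] (1 : G)) * redCoaction f u)
          - ι k x * contraction κ (redCoaction f u) ∈ stdFiltration k L (d + 1) := by
        refine tensorSubmodule_le (Z := (stdFiltration k L (d + 1)).comap
          (contraction κ ∘ₗ LinearMap.mulLeft k (ι k x ⊗ₜ[k] (1 : G))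
            - LinearMap.mulLeft k (ι k x) ∘ₗ contraction κ)) (fun v hv g => ?_)
            (redCoaction_mem f h)
        have : ι k (κ g) * (ι k x * v) - ι k x * (ι k (κ g) * v) = ι k ⁅κ g, x⁆ * v := by
          rw [LieHom.map_lie, LieRing.of_associative_ring_bracket]; noncomm_ring
        simpa [this, -ι_apply, -LieHom.map_lie] using ι_mul_mem_stdFiltration (⁅κ g, x⁆) hv
      have h2 : contraction κ ((1 ⊗ₜ[k] f x) * redCoaction f u) ∈ stdFiltration k L (d + 1) := by
        refine tensorSubmodule_le (Z := (stdFiltration k L (d + 1)).comap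
          (contraction κ ∘ₗ LinearMap.mulLeft k (1 ⊗ₜ[k] f x))) (fun v hv g => ?_)
            (redCoaction_mem f h)
        simpa using ι_mul_mem_stdFiltration (κ (f x * g)) hv
      have h3 := ι_mul_mem_stdFiltration x (ih h)
      -- The term u ⊗ f(x) contracts to κ(f(x)) u = x u; this is the extra copy that turns d into d
      -- + 1.
      have h4 : contraction κ (redCoaction f (ι k x * u)) - (d + 1) • (ι k x * u) =
          (contraction κ ((ι k x ⊗ₜ[k] (1 : G)) * redCoaction f u)
            - ι k x * contraction κ (redCoaction f u))
          + contraction κ ((1 ⊗ₜ[k] f x) * redCoaction f u)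
          + ι k x * (contraction κ (redCoaction f u) - d • u) := by
        rw [redCoaction_ι_mul, map_add, map_add, contraction_tmul, hκ, mul_sub, mul_smul_comm,
          add_smul, one_smul]
        abel
      rw [h4]
      exact add_mem (add_mem h1 h2) h3

/-- A linear map out of `U(L)` that is compatible with the coactions and does not kill `1` is
injective. -/
theorem injective_of_coaction [CharZero k] {X : Type*} [AddCommGroup X] [Module k X]
    (f : L →ₗ⁅k⁆ G) (κ : G →ₗ[k] L) (hκ : ∀ x, κ (f x) = x)
    (φ : UniversalEnvelopingAlgebra k L →ₗ[k] X) (δ : X →ₗ[k] X ⊗[k] G)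
    (hδ : ∀ u, δ (φ u) = φ.rTensor G (coaction f u)) (h1 : φ 1 ≠ 0) : Function.Injective φ := by
  have key : ∀ d, ∀ u ∈ stdFiltration k L d, φ u = 0 → u = 0 := by
    intro d
    induction d with
    | zero => intro u hu _; exact (Submodule.mem_bot k).1 hu
    | succ d ih =>
      intro u hu h0
      have hD : φ.rTensor G (redCoaction f u) = 0 := by
        rw [redCoaction_apply, map_sub, ← hδ, h0, map_zero, LinearMap.rTensor_tmul, h0,
          TensorProduct.zero_tmul, sub_zero]
      -- The left factors now lie in the kernel and in a smaller filtration step, where the kernel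
      -- vanishes by induction; so the reduced coaction of u is 0.
      have hmem := mem_tensorSubmodule_of_rTensor_eq_zero _ φ (redCoaction_mem f hu) hD
      have hbot : LinearMap.ker φ ⊓ stdFiltration k L d = ⊥ := by
        rw [eq_bot_iff]; rintro v ⟨hv, hv'⟩; exact (Submodule.mem_bot k).2 (ih v hv' hv)
      rw [hbot, tensorSubmodule_bot, Submodule.mem_bot] at hmem
      -- The Euler operator now kills u, so d • u has lower degree. Division by d finishes the step
      -- unless d = 0, when u is a scalar.
      have hE := contraction_redCoaction f κ hκ hu
      rw [hmem, map_zero, zero_sub, neg_mem_iff] at hE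
      cases d with
      | zero =>
        obtain ⟨c, rfl⟩ := Submodule.mem_one.1 (by simpa [stdFiltration] using hu)
        rw [Algebra.algebraMap_eq_smul_one, map_smul, smul_eq_zero] at h0
        rcases h0 with h0 | h0
        · simp [h0]
        · exact absurd h0 h1
      | succ d =>
        refine ih u ?_ h0
        rw [← Nat.cast_smul_eq_nsmul k] at hE
        exact (Submodule.smul_mem_iff _ (Nat.cast_ne_zero.2 d.succ_ne_zero)).1 hE
  rw [← LinearMap.ker_eq_bot, LinearMap.ker_eq_bot']
  intro u hu
  obtain ⟨d, hd⟩ := exists_mem_stdFiltration u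
  exact key d u hd hu

theorem contraction_mem_of_subalgebra (κ : G →ₗ[k] L)
    (S : Subalgebra k (UniversalEnvelopingAlgebra k L)) (hS : ∀ g, ι k (κ g) ∈ S)
    {t : UniversalEnvelopingAlgebra k L ⊗[k] G}
    (ht : t ∈ tensorSubmodule G (Subalgebra.toSubmodule S)) : contraction κ t ∈ S := by
  refine tensorSubmodule_le (Z := (Subalgebra.toSubmodule S).comap (contraction κ))
    (fun v hv g => ?_) ht
  exact S.mul_mem (hS g) hv

/-! ### Elements on which the coactions along the identity and an involution agree -/

section Involution

/-- Up to terms of lower degree, the reduced coaction along `σ ∘ f` is obtained from the one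
along `f` by applying `σ` to the second factor. -/
theorem redCoaction_comp_sub_mem (f g : L →ₗ⁅k⁆ G) (σ : G →ₗ[k] G) (hg : ∀ x, g x = σ (f x))
    {d : ℕ} {u : UniversalEnvelopingAlgebra k L} (hu : u ∈ stdFiltration k L (d + 1)) :
    redCoaction g u - σ.lTensor _ (redCoaction f u) ∈
      tensorSubmodule G (stdFiltration k L (d - 1)) := by
  induction d generalizing u with
  | zero =>
    obtain ⟨c, rfl⟩ := Submodule.mem_one.1 (by simpa [stdFiltration] using hu)
    simp only [Algebra.algebraMap_eq_smul_one, map_smul, redCoaction_one, smul_zero, map_zero,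
      sub_zero]
    exact zero_mem _
  | succ d ih =>
    rw [Nat.add_sub_cancel]
    refine stdFiltration_induction
      (C := fun u => redCoaction g u - σ.lTensor _ (redCoaction f u) ∈ _) (fun u v h1 h2 => ?_)
      (fun u h => tensorSubmodule_mono (stdFiltration_mono (Nat.sub_le d 1)) (ih h))
      (fun x u h => ?_) hu
    · rw [map_add, map_add, map_add, add_sub_add_comm]; exact add_mem h1 h2
    · have h1 : (ι k x ⊗ₜ[k] (1 : G)) * (redCoaction g u - σ.lTensor _ (redCoaction f u)) ∈
          tensorSubmodule G (stdFiltration k L d) := by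
        refine tensorSubmodule_le (Z := (tensorSubmodule G (stdFiltration k L d)).comap
          (LinearMap.mulLeft k (ι k x ⊗ₜ[k] (1 : G)))) (fun v hv g => ?_) (ih h)
        -- For d = 0 the truncated index d - 1 is 0, where the filtration is zero, so nothing is
        -- lost.
        have hv' : ι k x * v ∈ stdFiltration k L d := by
          cases d with
          | zero => rw [(Submodule.mem_bot k).1 hv, mul_zero]; exact zero_mem _
          | succ d => exact ι_mul_mem_stdFiltration x hv
        simpa [-ι_apply] using tmul_mem_tensorSubmodule hv' g
      have h2 : (1 ⊗ₜ[k] g x) * redCoaction g u ∈ tensorSubmodule G (stdFiltration k L d) := by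
        refine tensorSubmodule_le (Z := (tensorSubmodule G (stdFiltration k L d)).comap
          (LinearMap.mulLeft k (1 ⊗ₜ[k] g x))) (fun v hv g' => ?_) (redCoaction_mem g h)
        simpa using tmul_mem_tensorSubmodule hv (g x * g')
      have h3 : σ.lTensor _ ((1 ⊗ₜ[k] f x) * redCoaction f u) ∈
          tensorSubmodule G (stdFiltration k L d) := by
        refine tensorSubmodule_le (Z := (tensorSubmodule G (stdFiltration k L d)).comap
          (σ.lTensor _ ∘ₗ LinearMap.mulLeft k (1 ⊗ₜ[k] f x))) (fun v hv g' => ?_)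
          (redCoaction_mem f h)
        simpa using tmul_mem_tensorSubmodule hv (σ (f x * g'))
      have h4 : ∀ t : UniversalEnvelopingAlgebra k L ⊗[k] G,
          σ.lTensor _ ((ι k x ⊗ₜ[k] (1 : G)) * t) = (ι k x ⊗ₜ[k] (1 : G)) * σ.lTensor _ t := by
        intro t
        induction t with
        | zero => simp
        | tmul v g => simp
        | add a b ha hb => rw [mul_add, map_add, map_add, mul_add, ha, hb]
      have h5 : redCoaction g (ι k x * u) - σ.lTensor _ (redCoaction f (ι k x * u)) =
          (ι k x ⊗ₜ[k] (1 : G)) * (redCoaction g u - σ.lTensor _ (redCoaction f u))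
          + (1 ⊗ₜ[k] g x) * redCoaction g u - σ.lTensor _ ((1 ⊗ₜ[k] f x) * redCoaction f u) := by
        rw [redCoaction_ι_mul, redCoaction_ι_mul, map_add, map_add, h4, LinearMap.lTensor_tmul,
          mul_sub, hg]
        abel
      rw [h5]
      exact sub_mem (add_mem h1 h2) h3

/-- The flip of the last two factors of `U ⊗ G ⊗ G`. -/
def flipLast (k U G : Type*) [Field k] [Ring U] [Algebra k U] [Ring G] [Algebra k G] :
    (U ⊗[k] G) ⊗[k] G ≃ₐ[k] (U ⊗[k] G) ⊗[k] G :=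
  ((Algebra.TensorProduct.assoc k k k U G G).trans
    (Algebra.TensorProduct.congr AlgEquiv.refl (Algebra.TensorProduct.comm k G G))).trans
    (Algebra.TensorProduct.assoc k k k U G G).symm

theorem flipLast_tmul {U : Type*} [Ring U] [Algebra k U] (u : U) (g g' : G) :
    flipLast k U G ((u ⊗ₜ g) ⊗ₜ g') = (u ⊗ₜ g') ⊗ₜ g := by
  simp [flipLast]

/-- Coactions commute with each other, up to the flip of the last two factors. -/
theorem coaction_comm (f g : L →ₗ⁅k⁆ G) (u : UniversalEnvelopingAlgebra k L) :
    (coaction g).toLinearMap.rTensor G (coaction f u) =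
      flipLast k _ G ((coaction f).toLinearMap.rTensor G (coaction g u)) := by
  have h : (Algebra.TensorProduct.map (coaction g) (AlgHom.id k G)).comp (coaction f) =
      ((flipLast k (UniversalEnvelopingAlgebra k L) G).toAlgHom.comp
        (Algebra.TensorProduct.map (coaction f) (AlgHom.id k G))).comp (coaction g) := by
    ext x
    change Algebra.TensorProduct.map (coaction g) (AlgHom.id k G) (coaction f (ι k x)) =
      flipLast k (UniversalEnvelopingAlgebra k L) G
        (Algebra.TensorProduct.map (coaction f) (AlgHom.id k G) (coaction g (ι k x)))
    simp only [coaction_ι, map_add, Algebra.TensorProduct.map_tmul, map_one, AlgHom.id_apply,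
      TensorProduct.add_tmul, flipLast_tmul, Algebra.TensorProduct.one_def]
    abel
  exact DFunLike.congr_fun h u

/-- When σ is an involution, g + σ(g) is fixed by σ, so contracting a symmetrized tensor multiplies
only by fixed elements. -/
theorem contraction_id_add_lTensor (σ : G →ₗ[k] G) (D : UniversalEnvelopingAlgebra k G ⊗[k] G) :
    contraction LinearMap.id (D + σ.lTensor _ D) = contraction (LinearMap.id + σ) D := by
  induction D with
  | zero => simp
  | tmul w g =>
    simp only [map_add, LinearMap.lTensor_tmul, contraction_tmul, LinearMap.add_apply,
      LinearMap.id_apply, add_mul]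
  | add a b ha hb => simp only [map_add] at ha hb ⊢; rw [← ha, ← hb]; abel

variable [CharZero k]

/-- For an involution `σ` of the Lie algebra `G`, the elements of `U(G)` on which the coactions along
the identity and along `σ` agree lie in the subalgebra generated by the fixed points of `σ`. -/
theorem mem_adjoin_of_coaction_eq (σ : G →ₗ⁅k⁆ G) (hσ : ∀ x, σ (σ x) = x)
    {u : UniversalEnvelopingAlgebra k G} (hu : coaction (LieHom.id : G →ₗ⁅k⁆ G) u = coaction σ u) :
    u ∈ Algebra.adjoin k {y | ∃ x : G, σ x = x ∧ y = ι k x} := by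
  set S := Algebra.adjoin k {y | ∃ x : G, σ x = x ∧ y = ι k x} with hSdef
  set Λ : UniversalEnvelopingAlgebra k G →ₗ[k] UniversalEnvelopingAlgebra k G ⊗[k] G :=
    (coaction (LieHom.id : G →ₗ⁅k⁆ G)).toLinearMap - (coaction σ).toLinearMap with hΛ
  have hS : ∀ v ∈ S, Λ v = 0 := by
    intro v hv
    have : S ≤ AlgHom.equalizer (coaction (LieHom.id : G →ₗ⁅k⁆ G)) (coaction σ) := by
      refine Algebra.adjoin_le ?_
      rintro _ ⟨x, hx, rfl⟩
      change coaction _ _ = coaction _ _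
      rw [coaction_ι, coaction_ι, hx]
      rfl
    exact sub_eq_zero.2 (this hv)
  have key : ∀ d, ∀ v ∈ stdFiltration k G d, Λ v = 0 → v ∈ S := by
    intro d
    induction d with
    | zero => intro v hv _; rw [(Submodule.mem_bot k).1 hv]; exact zero_mem _
    | succ d ih =>
      intro v hv h0
      have h0' : coaction (LieHom.id : G →ₗ⁅k⁆ G) v = coaction σ v := sub_eq_zero.1 h0
      set D := redCoaction (LieHom.id : G →ₗ⁅k⁆ G) v with hD
      -- Coassociativity is replaced by the commutation of the two coactions: applied to v, all
      -- iterated coactions agree up to a flip that acts trivially on them.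
      have hD1 : Λ.rTensor G D = 0 := by
        rw [hΛ, LinearMap.rTensor_sub, LinearMap.sub_apply, hD, redCoaction_apply, map_sub, map_sub,
          coaction_comm _ σ, ← h0', LinearMap.rTensor_tmul, LinearMap.rTensor_tmul]
        have h6 := coaction_comm (LieHom.id : G →ₗ⁅k⁆ G) (LieHom.id : G →ₗ⁅k⁆ G) v
        rw [← h6]
        simp only [AlgHom.toLinearMap_apply, h0', sub_self]
      have hD2 : D ∈ tensorSubmodule G (Subalgebra.toSubmodule S) :=
        tensorSubmodule_mono (W := LinearMap.ker Λ ⊓ stdFiltration k G d)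
          (fun w hw => ih w hw.2 hw.1)
          (mem_tensorSubmodule_of_rTensor_eq_zero _ Λ (redCoaction_mem _ hv) hD1)
      have hσD : D - (σ : G →ₗ[k] G).lTensor _ D ∈
          tensorSubmodule G (stdFiltration k G (d - 1)) := by
        have := redCoaction_comp_sub_mem (LieHom.id : G →ₗ⁅k⁆ G) σ (σ : G →ₗ[k] G) (fun _ => rfl) hv
        rwa [redCoaction_apply σ, ← h0'] at this
      have hE := contraction_redCoaction (LieHom.id : G →ₗ⁅k⁆ G) LinearMap.id (fun _ => rfl) hv
      have h7 : contraction LinearMap.id (D - (σ : G →ₗ[k] G).lTensor _ D) ∈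
          stdFiltration k G d := by
        cases d with
        | zero =>
          have : D - (σ : G →ₗ[k] G).lTensor _ D = 0 := by
            simpa [stdFiltration, tensorSubmodule_bot] using hσD
          rw [this, map_zero]; exact zero_mem _
        | succ d => exact contraction_mem _ hσD
      have h8 : contraction LinearMap.id (D + (σ : G →ₗ[k] G).lTensor _ D) ∈ S := by
        have := contraction_mem_of_subalgebra (LinearMap.id + (σ : G →ₗ[k] G)) S
          (fun g => Algebra.subset_adjoin ⟨g + σ g, by rw [map_add, hσ, add_comm], rfl⟩) hD2
        rwa [contraction_id_add_lTensor]
      -- D - σ(D) is two degrees below v in its left factor, so D + σ(D) contracts to 2d v modulo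
      -- lower degree. Thus 2d v differs from an element of S by one of lower degree, still killed
      -- by Λ, to which the induction applies.
      have h9 : (2 * d) • v - contraction LinearMap.id (D + (σ : G →ₗ[k] G).lTensor _ D) ∈
          stdFiltration k G d := by
        have : (2 * d) • v - contraction LinearMap.id (D + (σ : G →ₗ[k] G).lTensor _ D) =
          contraction LinearMap.id (D - (σ : G →ₗ[k] G).lTensor _ D)
          - 2 • (contraction LinearMap.id D - d • v) := by
          rw [map_add, map_sub, smul_sub, mul_smul]; abel
        rw [this]
        exact sub_mem h7 (nsmul_mem hE _)
      have h10 := ih _ h9 (by rw [map_sub, map_nsmul, h0, hS _ h8, smul_zero, sub_zero])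
      have h11 : (2 * d) • v ∈ S := by simpa using add_mem h10 h8
      cases d with
      | zero =>
        obtain ⟨c, rfl⟩ := Submodule.mem_one.1 (by simpa [stdFiltration] using hv)
        exact S.algebraMap_mem c
      | succ d =>
        rw [← Nat.cast_smul_eq_nsmul k] at h11
        exact (Submodule.smul_mem_iff (Subalgebra.toSubmodule S)
          (Nat.cast_ne_zero.2 (by lia))).1 h11
  obtain ⟨d, hd⟩ := exists_mem_stdFiltration u
  exact key d u hd (sub_eq_zero.2 hu)

end Involution

end Enveloping

/-! ### Ternary relations and their behaviour under multiplication of series -/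

section AbstractRTT

variable {S M : Type*} [CommRing S] [Ring M] [Algebra S M]

/-- A two-sided sequence satisfying a first order recursion with unit coefficients vanishes as soon
as it vanishes once. -/
theorem eq_zero_of_recursion {c₁ c₂ : S} (h₁ : IsUnit c₁) (h₂ : IsUnit c₂) {f : ℤ → M}
    (hf : ∀ m, c₁ • f m + c₂ • f (m + 1) = 0) {m₀ : ℤ} (h₀ : f m₀ = 0) (m : ℤ) : f m = 0 := by
  induction m using Int.inductionOn' (b := m₀) with
  | zero => exact h₀
  | succ k _ ih =>
    have := hf k
    rw [ih, smul_zero, zero_add] at this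
    exact (h₂.smul_eq_zero).1 this
  | pred k _ ih =>
    have := hf (k - 1)
    rw [sub_add_cancel, ih, smul_zero, add_zero] at this
    exact (h₁.smul_eq_zero).1 this

/-- `L(u) = u A + B` satisfies the ternary relation with `R(u,v) = u ru + v rv`; here `a₁, b₁` and
`a₂, b₂` are the images of `A, B` in the two tensor factors. -/
structure LinearRTT (ru rv a₁ b₁ a₂ b₂ : M) : Prop where
  uaa : ru * (a₁ * a₂) = a₂ * a₁ * ru
  uab : ru * (a₁ * b₂) = b₂ * a₁ * ru
  mixed : ru * (b₁ * a₂) + rv * (a₁ * b₂) = a₂ * b₁ * ru + b₂ * a₁ * rv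
  ubb : ru * (b₁ * b₂) = b₂ * b₁ * ru
  vaa : rv * (a₁ * a₂) = a₂ * a₁ * rv
  vba : rv * (b₁ * a₂) = a₂ * b₁ * rv
  vbb : rv * (b₁ * b₂) = b₂ * b₁ * rv

/-- One coefficient of R (xL)₁ (yL)₂ = R x₁y₂ L₁L₂ = y₂x₁ R L₁L₂ = y₂x₁ L₂L₁ R = (yL)₂ (xL)₁ R. It
uses that entries of L in one tensor factor commute with the series in the other. The indices 0, 1,
2 mark consecutive coefficients. -/
theorem LinearRTT.mul_aux {ru rv a₁ b₁ a₂ b₂ x₀ x₁ x₂ y₀ y₁ y₂ : M}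
    (hL : LinearRTT ru rv a₁ b₁ a₂ b₂)
    (ha₀ : a₁ * y₀ = y₀ * a₁) (ha₁ : a₁ * y₁ = y₁ * a₁) (ha₂ : a₁ * y₂ = y₂ * a₁)
    (hb₀ : b₁ * y₀ = y₀ * b₁) (hb₁ : b₁ * y₁ = y₁ * b₁) (hb₂ : b₁ * y₂ = y₂ * b₁)
    (ka₀ : a₂ * x₀ = x₀ * a₂) (ka₁ : a₂ * x₁ = x₁ * a₂) (ka₂ : a₂ * x₂ = x₂ * a₂)
    (kb₀ : b₂ * x₀ = x₀ * b₂) (kb₁ : b₂ * x₁ = x₁ * b₂) (kb₂ : b₂ * x₂ = x₂ * b₂)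
    (h₁ : ru * (x₀ * y₁) + rv * (x₁ * y₀) = y₁ * x₀ * ru + y₀ * x₁ * rv)
    (h₂ : ru * (x₀ * y₂) + rv * (x₁ * y₁) = y₂ * x₀ * ru + y₁ * x₁ * rv)
    (h₃ : ru * (x₁ * y₁) + rv * (x₂ * y₀) = y₁ * x₁ * ru + y₀ * x₂ * rv)
    (h₄ : ru * (x₁ * y₂) + rv * (x₂ * y₁) = y₂ * x₁ * ru + y₁ * x₂ * rv) :
    ru * ((x₀ * a₁ + x₁ * b₁) * (y₁ * a₂ + y₂ * b₂))
      + rv * ((x₁ * a₁ + x₂ * b₁) * (y₀ * a₂ + y₁ * b₂)) =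
    (y₁ * a₂ + y₂ * b₂) * (x₀ * a₁ + x₁ * b₁) * ru
      + (y₀ * a₂ + y₁ * b₂) * (x₁ * a₁ + x₂ * b₁) * rv := by
  have e : ∀ {x y a b : M}, a * y = y * a → x * a * (y * b) = x * y * (a * b) := by
    intro x y a b h
    rw [mul_assoc, ← mul_assoc a, h]; simp only [mul_assoc]
  have L1 : ru * ((x₀ * a₁ + x₁ * b₁) * (y₁ * a₂ + y₂ * b₂))
      + rv * ((x₁ * a₁ + x₂ * b₁) * (y₀ * a₂ + y₁ * b₂)) =
      (ru * (x₀ * y₁) + rv * (x₁ * y₀)) * (a₁ * a₂) + (ru * (x₀ * y₂) + rv * (x₁ * y₁)) * (a₁ * b₂)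
      + (ru * (x₁ * y₁) + rv * (x₂ * y₀)) * (b₁ * a₂)
      + (ru * (x₁ * y₂) + rv * (x₂ * y₁)) * (b₁ * b₂) := by
    simp only [add_mul, mul_add, e ha₀, e ha₁, e ha₂, e hb₀, e hb₁, e hb₂]
    simp only [mul_assoc]
    abel
  have L2 : (y₁ * a₂ + y₂ * b₂) * (x₀ * a₁ + x₁ * b₁) * ru
      + (y₀ * a₂ + y₁ * b₂) * (x₁ * a₁ + x₂ * b₁) * rv =
      y₁ * x₀ * (a₂ * a₁ * ru) + y₁ * x₁ * (a₂ * b₁ * ru + b₂ * a₁ * rv)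
      + y₂ * x₀ * (b₂ * a₁ * ru) + y₂ * x₁ * (b₂ * b₁ * ru) + y₀ * x₁ * (a₂ * a₁ * rv)
      + y₀ * x₂ * (a₂ * b₁ * rv) + y₁ * x₂ * (b₂ * b₁ * rv) := by
    simp only [add_mul, mul_add, e ka₀, e ka₁, e ka₂, e kb₀, e kb₁, e kb₂]
    simp only [mul_assoc]
    abel
  rw [L1, L2, h₁, h₂, h₃, h₄, ← hL.uaa, ← hL.uab, ← hL.mixed, ← hL.ubb, ← hL.vaa, ← hL.vba,
    ← hL.vbb]
  simp only [add_mul, mul_add, mul_assoc]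
  abel

/-- If `x(u)`, `y(u)` and `L(u) = u A + B` satisfy the ternary relation, then so do the products
`x'(u) = x(u) L(u) / (c₁ u + c₂)` and `y'(u) = y(u) L(u) / (c₁ u + c₂)`. -/
theorem LinearRTT.mul {ru rv a₁ b₁ a₂ b₂ : M} (hL : LinearRTT ru rv a₁ b₁ a₂ b₂)
    {c₁ c₂ : S} (h₁ : IsUnit c₁) (h₂ : IsUnit c₂) {x y x' y' : ℤ → M}
    (hay : ∀ n, a₁ * y n = y n * a₁) (hby : ∀ n, b₁ * y n = y n * b₁)
    (hax : ∀ n, a₂ * x n = x n * a₂) (hbx : ∀ n, b₂ * x n = x n * b₂)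
    (h : ∀ m n, ru * (x (m - 1) * y n) + rv * (x m * y (n - 1)) =
      y n * x (m - 1) * ru + y (n - 1) * x m * rv)
    (hx' : ∀ m, c₁ • x' m + c₂ • x' (m + 1) = x m * a₁ + x (m + 1) * b₁)
    (hy' : ∀ m, c₁ • y' m + c₂ • y' (m + 1) = y m * a₂ + y (m + 1) * b₂)
    {m₀ n₀ : ℤ} (hx₀ : x' (m₀ - 1) = 0) (hx₀' : x' m₀ = 0) (hy₀ : y' (n₀ - 1) = 0)
    (hy₀' : y' n₀ = 0) (m n : ℤ) :
    ru * (x' (m - 1) * y' n) + rv * (x' m * y' (n - 1)) =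
      y' n * x' (m - 1) * ru + y' (n - 1) * x' m * rv := by
  set Z : ℤ → ℤ → M := fun m n => ru * (x' (m - 1) * y' n) + rv * (x' m * y' (n - 1)) -
      (y' n * x' (m - 1) * ru + y' (n - 1) * x' m * rv) with hZ
  -- The numerators satisfy the relation by `mul_aux`, so the defect Z is killed by c₁ + c₂ · shift
  -- in each variable. Such a recursion has no nonzero solution vanishing at one index; Z vanishes
  -- there because x' and y' vanish at two consecutive indices.
  have hW : ∀ m n, c₁ • (c₁ • Z m n + c₂ • Z (m + 1) n)
      + c₂ • (c₁ • Z m (n + 1) + c₂ • Z (m + 1) (n + 1)) = 0 := by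
    intro m n
    have key := hL.mul_aux (hay (n - 1)) (hay n) (hay (n + 1)) (hby (n - 1)) (hby n) (hby (n + 1))
      (hax (m - 1)) (hax m) (hax (m + 1)) (hbx (m - 1)) (hbx m) (hbx (m + 1)) (h m n)
      (by simpa using h m (n + 1)) (by simpa using h (m + 1) n)
      (by simpa using h (m + 1) (n + 1))
    have k1 := hx' (m - 1)
    have k2 := hy' (n - 1)
    rw [sub_add_cancel] at k1 k2
    rw [← k1, ← hx' m, ← k2, ← hy' n] at key
    simp only [hZ, add_sub_cancel_right]
    rw [← sub_eq_zero] at key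
    rw [← key]
    simp only [add_mul, mul_add, smul_mul_assoc, mul_smul_comm, smul_add, smul_sub, smul_smul]
    module
  have hW' : ∀ m n, c₁ • Z m n + c₂ • Z (m + 1) n = 0 := fun m n =>
    eq_zero_of_recursion h₁ h₂ (f := fun n => c₁ • Z m n + c₂ • Z (m + 1) n) (hW m) (m₀ := n₀)
      (by simp [hZ, hy₀, hy₀']) n
  exact sub_eq_zero.1 (eq_zero_of_recursion h₁ h₂ (f := fun m => Z m n) (fun m => hW' m n)
    (m₀ := m₀) (by simp [hZ, hx₀, hx₀']) m)

end AbstractRTT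

/-! ### Homomorphisms out of the quantum affine algebra -/

section Legs

variable {ι Q : Type*} [Fintype ι] [DecidableEq ι] [Ring Q]

/-- The embedding `X ↦ X ⊗ 1` of matrices. -/
def legOne : Matrix ι ι Q →+* Matrix (ι × ι) (ι × ι) Q where
  toFun X := X ⊗ₖ (1 : Matrix ι ι Q)
  map_one' := Matrix.one_kronecker_one
  map_mul' X Y := by
    ext ⟨i, k⟩ ⟨j, l⟩
    simp [Matrix.mul_apply, Matrix.kroneckerMap_apply, Fintype.sum_prod_type, Matrix.one_apply]
  map_zero' := by ext; simp
  map_add' X Y := by ext; simp [add_mul]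

/-- The embedding `X ↦ 1 ⊗ X` of matrices. -/
def legTwo : Matrix ι ι Q →+* Matrix (ι × ι) (ι × ι) Q where
  toFun X := (1 : Matrix ι ι Q) ⊗ₖ X
  map_one' := Matrix.one_kronecker_one
  map_mul' X Y := by
    ext ⟨i, k⟩ ⟨j, l⟩
    simp [Matrix.mul_apply, Matrix.kroneckerMap_apply, Fintype.sum_prod_type, Matrix.one_apply]
  map_zero' := by ext; simp
  map_add' X Y := by ext; simp [mul_add]

theorem legOne_apply (X : Matrix ι ι Q) (i j k l : ι) :
    legOne X (i, k) (j, l) = if k = l then X i j else 0 := by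
  simp [legOne, Matrix.one_apply]

theorem legTwo_apply (X : Matrix ι ι Q) (i j k l : ι) :
    legTwo X (i, k) (j, l) = if i = j then X k l else 0 := by
  simp [legTwo, Matrix.one_apply]

theorem legOne_mul_legTwo_apply (X Y : Matrix ι ι Q) (i j k l : ι) :
    (legOne X * legTwo Y) (i, k) (j, l) = X i j * Y k l := by
  simp [Matrix.mul_apply, Fintype.sum_prod_type, legOne_apply, legTwo_apply]

theorem legTwo_mul_legOne_apply (X Y : Matrix ι ι Q) (i j k l : ι) :
    (legTwo Y * legOne X) (i, k) (j, l) = Y k l * X i j := by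
  simp [Matrix.mul_apply, Fintype.sum_prod_type, legOne_apply, legTwo_apply]

theorem legOne_mul_legTwo_comm {X Y : Matrix ι ι Q} (h : ∀ i j k l, X i j * Y k l = Y k l * X i j) :
    legOne X * legTwo Y = legTwo Y * legOne X := by
  ext ⟨i, k⟩ ⟨j, l⟩
  rw [legOne_mul_legTwo_apply, legTwo_mul_legOne_apply, h]

theorem legOne_smul {S : Type*} [CommRing S] [Algebra S Q] (c : S) (X : Matrix ι ι Q) :
    legOne (c • X) = c • legOne X := by
  ext ⟨i, k⟩ ⟨j, l⟩
  simp only [legOne_apply, Matrix.smul_apply]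
  split_ifs <;> simp

theorem legTwo_smul {S : Type*} [CommRing S] [Algebra S Q] (c : S) (X : Matrix ι ι Q) :
    legTwo (c • X) = c • legTwo X := by
  ext ⟨i, k⟩ ⟨j, l⟩
  simp only [legTwo_apply, Matrix.smul_apply]
  split_ifs <;> simp

end Legs

/-! ### Solutions of the defining relations in an algebra and the induced homomorphisms -/

section Lift

variable {N : ℕ} {Q : Type*} [Ring Q] [Algebra K Q]

/-- The coefficients of the `R`-matrix over a `ℂ(q)`-algebra. -/
def RuQ (N : ℕ) (Q : Type*) [Ring Q] [Algebra K Q] :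
    Matrix (Fin N × Fin N) (Fin N × Fin N) Q := (Ru N).map (algebraMap K Q)

/-- The coefficients of the `R`-matrix over a `ℂ(q)`-algebra. -/
def RvQ (N : ℕ) (Q : Type*) [Ring Q] [Algebra K Q] :
    Matrix (Fin N × Fin N) (Fin N × Fin N) Q := (Rv N).map (algebraMap K Q)

/-- The relation `R(u,v) X₁(u) Y₂(v) = Y₂(v) X₁(u) R(u,v)` for formal series with matrix
coefficients. -/
def RTT (X Y : ℤ → Matrix (Fin N) (Fin N) Q) : Prop :=
  ∀ m n, RuQ N Q * (legOne (X (m - 1)) * legTwo (Y n))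
      + RvQ N Q * (legOne (X m) * legTwo (Y (n - 1))) =
    legTwo (Y n) * legOne (X (m - 1)) * RuQ N Q + legTwo (Y (n - 1)) * legOne (X m) * RvQ N Q

/-- The series `∑_r X_r u^{-r}`. -/
def negSeries (X : ℕ → Matrix (Fin N) (Fin N) Q) (m : ℤ) : Matrix (Fin N) (Fin N) Q :=
  if m ≤ 0 then X m.natAbs else 0

/-- The series `∑_r X_r u^r`. -/
def posSeries (X : ℕ → Matrix (Fin N) (Fin N) Q) (m : ℤ) : Matrix (Fin N) (Fin N) Q :=
  if 0 ≤ m then X m.natAbs else 0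

/-- The matrices `T`, `Tb` of elements of `Q` satisfy the defining relations of `U_q(ĝl_N)`. -/
structure IsRTT (T Tb : ℕ → Matrix (Fin N) (Fin N) Q) : Prop where
  t_zero : ∀ i j, i < j → T 0 i j = 0
  tbar_zero : ∀ i j, i < j → Tb 0 j i = 0
  t_mul_tbar : ∀ i, T 0 i i * Tb 0 i i = 1
  tbar_mul_t : ∀ i, Tb 0 i i * T 0 i i = 1
  rtt : RTT (negSeries T) (negSeries T)
  rtbartbar : RTT (posSeries Tb) (posSeries Tb)
  rtbart : RTT (posSeries Tb) (negSeries T)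

theorem map_rttLeft (φ : Free N →ₐ[K] Q) (X Y : ℤ → Matrix (Fin N) (Fin N) (Free N)) (m n : ℤ) :
    (rttLeft N X Y m n).map φ =
      RuQ N Q * (legOne ((X (m - 1)).map φ) * legTwo ((Y n).map φ))
      + RvQ N Q * (legOne ((X m).map φ) * legTwo ((Y (n - 1)).map φ)) := by
  have h : ∀ (R : Matrix (Fin N × Fin N) (Fin N × Fin N) K) (X Y : Matrix (Fin N) (Fin N) (Free N)),
      (R.map (algebraMap K (Free N)) * ((X ⊗ₖ 1) * (1 ⊗ₖ Y))).map φ =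
        R.map (algebraMap K Q) * (legOne (X.map φ) * legTwo (Y.map φ)) := by
    intro R X Y
    rw [Matrix.map_mul]
    congr 1
    · ext; simp
    · ext ⟨i, k⟩ ⟨j, l⟩
      rw [legOne_mul_legTwo_apply, Matrix.map_apply]
      exact (congrArg φ (legOne_mul_legTwo_apply X Y i j k l)).trans (by simp)
  rw [rttLeft, Matrix.map_add _ (map_add φ), h, h]
  rfl

theorem map_rttRight (φ : Free N →ₐ[K] Q) (X Y : ℤ → Matrix (Fin N) (Fin N) (Free N)) (m n : ℤ) :
    (rttRight N X Y m n).map φ =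
      legTwo ((Y n).map φ) * legOne ((X (m - 1)).map φ) * RuQ N Q
      + legTwo ((Y (n - 1)).map φ) * legOne ((X m).map φ) * RvQ N Q := by
  have h : ∀ (R : Matrix (Fin N × Fin N) (Fin N × Fin N) K) (X Y : Matrix (Fin N) (Fin N) (Free N)),
      (((1 ⊗ₖ Y) * (X ⊗ₖ 1)) * R.map (algebraMap K (Free N))).map φ =
        (legTwo (Y.map φ) * legOne (X.map φ)) * R.map (algebraMap K Q) := by
    intro R X Y
    rw [Matrix.map_mul]
    congr 1
    · ext ⟨i, k⟩ ⟨j, l⟩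
      rw [legTwo_mul_legOne_apply, Matrix.map_apply]
      exact (congrArg φ (legTwo_mul_legOne_apply X Y i j k l)).trans (by simp)
    · ext; simp
  rw [rttRight, Matrix.map_add _ (map_add φ), h, h]
  rfl

theorem map_tCoeff (φ : Free N →ₐ[K] Q) (m : ℤ) :
    (tCoeff N m).map φ =
      negSeries (fun r => Matrix.of fun i j => φ (FreeAlgebra.ι K (Gen.t r i j))) m := by
  ext i j
  simp only [tCoeff, negSeries, Matrix.map_apply]
  split_ifs <;> simp

theorem map_tbarCoeff (φ : Free N →ₐ[K] Q) (m : ℤ) :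
    (tbarCoeff N m).map φ =
      posSeries (fun r => Matrix.of fun i j => φ (FreeAlgebra.ι K (Gen.tbar r i j))) m := by
  ext i j
  simp only [tbarCoeff, posSeries, Matrix.map_apply]
  split_ifs <;> simp

/-- The free algebra homomorphism with prescribed values on the generators. -/
def freeLift (T Tb : ℕ → Matrix (Fin N) (Fin N) Q) : Free N →ₐ[K] Q :=
  FreeAlgebra.lift K fun g => match g with
    | Gen.t r i j => T r i j
    | Gen.tbar r i j => Tb r i j

/-- The homomorphism out of `U_q(ĝl_N)` given by matrices satisfying the defining relations. -/
def UqLift {T Tb : ℕ → Matrix (Fin N) (Fin N) Q} (h : IsRTT T Tb) : Uq N →ₐ[K] Q :=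
  RingQuot.liftAlgHom K ⟨freeLift T Tb, by
    obtain ⟨φ, hφ⟩ : ∃ φ, φ = freeLift T Tb := ⟨_, rfl⟩
    have hT : (fun r => Matrix.of fun i j => φ (FreeAlgebra.ι K (Gen.t r i j))) = T := by
      ext r i j; simp [hφ, freeLift]
    have hTb : (fun r => Matrix.of fun i j => φ (FreeAlgebra.ι K (Gen.tbar r i j))) = Tb := by
      ext r i j; simp [hφ, freeLift]
    rw [← hφ]
    intro a b hab
    cases hab with
    | t_zero i j hij => simpa [hφ, freeLift] using h.t_zero i j hij
    | tbar_zero i j hij => simpa [hφ, freeLift] using h.tbar_zero i j hij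
    | t_mul_tbar i => simpa [hφ, freeLift] using h.t_mul_tbar i
    | tbar_mul_t i => simpa [hφ, freeLift] using h.tbar_mul_t i
    | rtt m n x y =>
      have := h.rtt m n
      rw [← hT] at this
      simp only [← map_tCoeff] at this
      rw [← map_rttLeft, ← map_rttRight] at this
      exact congrFun (congrFun this x) y
    | rtbartbar m n x y =>
      have := h.rtbartbar m n
      rw [← hTb] at this
      simp only [← map_tbarCoeff] at this
      rw [← map_rttLeft, ← map_rttRight] at this
      exact congrFun (congrFun this x) y
    | rtbart m n x y =>
      have := h.rtbart m n
      rw [← hT, ← hTb] at this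
      simp only [← map_tCoeff, ← map_tbarCoeff] at this
      rw [← map_rttLeft, ← map_rttRight] at this
      exact congrFun (congrFun this x) y⟩

@[simp]
theorem UqLift_t {T Tb : ℕ → Matrix (Fin N) (Fin N) Q} (h : IsRTT T Tb) (r : ℕ) (i j : Fin N) :
    UqLift h (t r i j) = T r i j := by
  simp [UqLift, t, freeLift]

@[simp]
theorem UqLift_tbar {T Tb : ℕ → Matrix (Fin N) (Fin N) Q} (h : IsRTT T Tb) (r : ℕ) (i j : Fin N) :
    UqLift h (tbar r i j) = Tb r i j := by
  simp [UqLift, tbar, freeLift]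

/-- The images of the generators under a homomorphism satisfy the defining relations. -/
theorem isRTT_map (φ : Uq N →ₐ[K] Q) :
    IsRTT (fun r => Matrix.of fun i j => φ (t r i j))
      (fun r => Matrix.of fun i j => φ (tbar r i j)) := by
  set ψ : Free N →ₐ[K] Q := φ.comp (RingQuot.mkAlgHom K (Rel N)) with hψ
  have hrel : ∀ {a b}, Rel N a b → ψ a = ψ b := fun hab =>
    congrArg φ (RingQuot.mkAlgHom_rel K hab)
  constructor
  · intro i j hij
    have := hrel (Rel.t_zero i j hij)
    rw [map_zero] at this
    exact this
  · intro i j hij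
    have := hrel (Rel.tbar_zero i j hij)
    rw [map_zero] at this
    exact this
  · intro i
    have := hrel (Rel.t_mul_tbar i)
    rw [map_mul, map_one] at this
    exact this
  · intro i
    have := hrel (Rel.tbar_mul_t i)
    rw [map_mul, map_one] at this
    exact this
  · intro m n
    have : (rttLeft N (tCoeff N) (tCoeff N) m n).map ψ =
      (rttRight N (tCoeff N) (tCoeff N) m n).map ψ := by ext x y; exact hrel (Rel.rtt m n x y)
    rw [map_rttLeft, map_rttRight] at this
    simp only [map_tCoeff] at this
    exact this
  · intro m n
    have : (rttLeft N (tbarCoeff N) (tbarCoeff N) m n).map ψ =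
      (rttRight N (tbarCoeff N) (tbarCoeff N) m n).map ψ := by
        ext x y; exact hrel (Rel.rtbartbar m n x y)
    rw [map_rttLeft, map_rttRight] at this
    simp only [map_tbarCoeff] at this
    exact this
  · intro m n
    have : (rttLeft N (tbarCoeff N) (tCoeff N) m n).map ψ =
      (rttRight N (tbarCoeff N) (tCoeff N) m n).map ψ := by
        ext x y; exact hrel (Rel.rtbart m n x y)
    rw [map_rttLeft, map_rttRight] at this
    simp only [map_tCoeff, map_tbarCoeff] at this
    exact this

end Lift

/-! ### The Yang–Baxter equation -/

section YangBaxter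

variable {N : ℕ}

theorem q_ne_zero : q ≠ 0 := by
  rw [q, Ne, FaithfulSMul.algebraMap_eq_zero_iff]
  exact (LaurentPolynomial.isUnit_T 1).ne_zero

section Coefficients

variable {ι F : Type*} [LinearOrder ι] [Field F]

/-- Diagonal coefficients of `Ru`. -/
def du (q : F) (i k : ι) : F := if i = k then q⁻¹ else 1

/-- Off-diagonal coefficients of `Ru`. -/
def ou (q : F) (i k : ι) : F := if k < i then q⁻¹ - q else 0

/-- Diagonal coefficients of `Rv`. -/
def dv (q : F) (i k : ι) : F := if i = k then -q else -1

/-- Off-diagonal coefficients of `Rv`. -/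
def ov (q : F) (i k : ι) : F := if i < k then q⁻¹ - q else 0

/-- The operator with diagonal part `d` and swap part `o` in the tensor factors 1 and 2. -/
def op12 (d o : ι → ι → F) (f : ι → ι → ι → F) (i k p : ι) : F := d i k * f i k p + o i k * f k i p

/-- The operator with diagonal part `d` and swap part `o` in the tensor factors 1 and 3. -/
def op13 (d o : ι → ι → F) (f : ι → ι → ι → F) (i k p : ι) : F := d i p * f i k p + o i p * f p k i

/-- The operator with diagonal part `d` and swap part `o` in the tensor factors 2 and 3. -/
def op23 (d o : ι → ι → F) (f : ι → ι → ι → F) (i k p : ι) : F := d k p * f i k p + o k p * f i p k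

/-- The seven identities `ybe_uuu` to `ybe_mixed` are the coefficients of the Yang–Baxter equation
R₁₂R₁₃R₂₃ = R₂₃R₁₃R₁₂ in three spectral parameters. The letters tell whether `Ru` or `Rv` is taken
in R₁₂, R₁₃, R₂₃; only the monomial containing all three parameters receives two contributions. Each
operator is diagonal plus a swap whose coefficients depend only on the order of the indices, so the
27 order patterns of three indices suffice. -/
theorem ybe_uuu {q : F} (hq : q ≠ 0) (f : ι → ι → ι → F) (i k p : ι) :
    op12 (du q) (ou q) (op13 (du q) (ou q) (op23 (du q) (ou q) f)) i k p =
      op23 (du q) (ou q) (op13 (du q) (ou q) (op12 (du q) (ou q) f)) i k p := by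
  simp only [op12, op13, op23, du, ou, dv, ov]
  rcases lt_trichotomy i k with h1 | h1 | h1 <;> rcases lt_trichotomy i p with h2 | h2 | h2 <;>
  rcases lt_trichotomy k p with h3 | h3 | h3 <;>
  first
  | (exfalso; order)
  | (subst_vars
     simp only [*, lt_irrefl, ne_of_lt, ne_of_gt, not_lt_of_gt, if_true, if_false]
     all_goals first | ring1 | (field_simp; done) | (field_simp; ring1))

theorem ybe_uuv {q : F} (hq : q ≠ 0) (f : ι → ι → ι → F) (i k p : ι) :
    op12 (du q) (ou q) (op13 (du q) (ou q) (op23 (dv q) (ov q) f)) i k p =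
      op23 (dv q) (ov q) (op13 (du q) (ou q) (op12 (du q) (ou q) f)) i k p := by
  simp only [op12, op13, op23, du, ou, dv, ov]
  rcases lt_trichotomy i k with h1 | h1 | h1 <;> rcases lt_trichotomy i p with h2 | h2 | h2 <;>
  rcases lt_trichotomy k p with h3 | h3 | h3 <;>
  first
  | (exfalso; order)
  | (subst_vars
     simp only [*, lt_irrefl, ne_of_lt, ne_of_gt, not_lt_of_gt, if_true, if_false]
     all_goals first | ring1 | (field_simp; done) | (field_simp; ring1))

theorem ybe_uvv {q : F} (hq : q ≠ 0) (f : ι → ι → ι → F) (i k p : ι) :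
    op12 (du q) (ou q) (op13 (dv q) (ov q) (op23 (dv q) (ov q) f)) i k p =
      op23 (dv q) (ov q) (op13 (dv q) (ov q) (op12 (du q) (ou q) f)) i k p := by
  simp only [op12, op13, op23, du, ou, dv, ov]
  rcases lt_trichotomy i k with h1 | h1 | h1 <;> rcases lt_trichotomy i p with h2 | h2 | h2 <;>
  rcases lt_trichotomy k p with h3 | h3 | h3 <;>
  first
  | (exfalso; order)
  | (subst_vars
     simp only [*, lt_irrefl, ne_of_lt, ne_of_gt, not_lt_of_gt, if_true, if_false]
     all_goals first | ring1 | (field_simp; done) | (field_simp; ring1))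

theorem ybe_vuu {q : F} (hq : q ≠ 0) (f : ι → ι → ι → F) (i k p : ι) :
    op12 (dv q) (ov q) (op13 (du q) (ou q) (op23 (du q) (ou q) f)) i k p =
      op23 (du q) (ou q) (op13 (du q) (ou q) (op12 (dv q) (ov q) f)) i k p := by
  simp only [op12, op13, op23, du, ou, dv, ov]
  rcases lt_trichotomy i k with h1 | h1 | h1 <;> rcases lt_trichotomy i p with h2 | h2 | h2 <;>
  rcases lt_trichotomy k p with h3 | h3 | h3 <;>
  first
  | (exfalso; order)
  | (subst_vars
     simp only [*, lt_irrefl, ne_of_lt, ne_of_gt, not_lt_of_gt, if_true, if_false]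
     all_goals first | ring1 | (field_simp; done) | (field_simp; ring1))

theorem ybe_vvu {q : F} (hq : q ≠ 0) (f : ι → ι → ι → F) (i k p : ι) :
    op12 (dv q) (ov q) (op13 (dv q) (ov q) (op23 (du q) (ou q) f)) i k p =
      op23 (du q) (ou q) (op13 (dv q) (ov q) (op12 (dv q) (ov q) f)) i k p := by
  simp only [op12, op13, op23, du, ou, dv, ov]
  rcases lt_trichotomy i k with h1 | h1 | h1 <;> rcases lt_trichotomy i p with h2 | h2 | h2 <;>
  rcases lt_trichotomy k p with h3 | h3 | h3 <;>
  first
  | (exfalso; order)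
  | (subst_vars
     simp only [*, lt_irrefl, ne_of_lt, ne_of_gt, not_lt_of_gt, if_true, if_false]
     all_goals first | ring1 | (field_simp; done) | (field_simp; ring1))

theorem ybe_vvv {q : F} (hq : q ≠ 0) (f : ι → ι → ι → F) (i k p : ι) :
    op12 (dv q) (ov q) (op13 (dv q) (ov q) (op23 (dv q) (ov q) f)) i k p =
      op23 (dv q) (ov q) (op13 (dv q) (ov q) (op12 (dv q) (ov q) f)) i k p := by
  simp only [op12, op13, op23, du, ou, dv, ov]
  rcases lt_trichotomy i k with h1 | h1 | h1 <;> rcases lt_trichotomy i p with h2 | h2 | h2 <;>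
  rcases lt_trichotomy k p with h3 | h3 | h3 <;>
  first
  | (exfalso; order)
  | (subst_vars
     simp only [*, lt_irrefl, ne_of_lt, ne_of_gt, not_lt_of_gt, if_true, if_false]
     all_goals first | ring1 | (field_simp; done) | (field_simp; ring1))

theorem ybe_mixed {q : F} (hq : q ≠ 0) (f : ι → ι → ι → F) (i k p : ι) :
    op12 (du q) (ou q) (op13 (dv q) (ov q) (op23 (du q) (ou q) f)) i k p
      + op12 (dv q) (ov q) (op13 (du q) (ou q) (op23 (dv q) (ov q) f)) i k p =
    op23 (du q) (ou q) (op13 (dv q) (ov q) (op12 (du q) (ou q) f)) i k p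
      + op23 (dv q) (ov q) (op13 (du q) (ou q) (op12 (dv q) (ov q) f)) i k p := by
  simp only [op12, op13, op23, du, ou, dv, ov]
  rcases lt_trichotomy i k with h1 | h1 | h1 <;> rcases lt_trichotomy i p with h2 | h2 | h2 <;>
  rcases lt_trichotomy k p with h3 | h3 | h3 <;>
  first
  | (exfalso; order)
  | (subst_vars
     simp only [*, lt_irrefl, ne_of_lt, ne_of_gt, not_lt_of_gt, if_true, if_false]
     all_goals first | ring1 | (field_simp; done) | (field_simp; ring1))

end Coefficients

theorem sum_sum_eq_single {F : Fin N → Fin N → K} (i k : Fin N)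
    (h : ∀ a b, ¬(a = i ∧ b = k) → F a b = 0) : ∑ a, ∑ b, F a b = F i k := by
  rw [Finset.sum_eq_single i, Finset.sum_eq_single k]
  · exact fun b _ hb => h i b (fun h' => hb h'.2)
  · simp
  · exact fun a _ ha => Finset.sum_eq_zero fun b _ => h a b fun h' => ha h'.1
  · simp

theorem Ru_apply (i k j l : Fin N) :
    Ru N (i, k) (j, l) = (if i = j ∧ k = l then du q i k else 0)
      + (if i = l ∧ k = j then ou q i k else 0) := by
  have e : ∀ a b c d : Fin N, (E a b ⊗ₖ E c d) (i, k) (j, l) =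
      if (a = i ∧ b = j) ∧ (c = k ∧ d = l) then (1 : K) else 0 := by
    intro a b c d
    simp only [E, Matrix.kroneckerMap_apply, Matrix.single_apply, mul_ite, mul_one, mul_zero]
    split_ifs <;> tauto
  simp only [Ru, Matrix.add_apply, Matrix.sum_apply, Matrix.smul_apply, apply_ite
    (fun M : Matrix (Fin N × Fin N) (Fin N × Fin N) K => M (i, k) (j, l)), e, Matrix.zero_apply,
    du, ou]
  have h1 : (∑ a, ∑ b, if a ≠ b then if (a = i ∧ a = j) ∧ b = k ∧ b = l then (1 : K) else 0 else 0) =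
      if i ≠ k ∧ i = j ∧ k = l then 1 else 0 := by
    rw [sum_sum_eq_single i k (fun a b hab => by grind)]
    grind
  have h2 : (∑ a, if (a = i ∧ a = j) ∧ a = k ∧ a = l then (1 : K) else 0) =
      if i = j ∧ i = k ∧ i = l then 1 else 0 := by
    rw [Finset.sum_eq_single i (by intro b _ hb; simp [hb]) (by simp)]
    grind
  have h3 : (∑ a, ∑ b, if b < a then if (a = i ∧ b = j) ∧ b = k ∧ a = l then (1 : K) else 0 else 0) =
      if j < i ∧ j = k ∧ i = l then 1 else 0 := by
    rw [sum_sum_eq_single i k (fun a b hab => by grind)]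
    grind
  rw [h1, h2, h3]
  simp only [smul_eq_mul, mul_ite, mul_one, mul_zero]
  grind

theorem Rv_apply (i k j l : Fin N) :
    Rv N (i, k) (j, l) = (if i = j ∧ k = l then dv q i k else 0)
      + (if i = l ∧ k = j then ov q i k else 0) := by
  have e : ∀ a b c d : Fin N, (E a b ⊗ₖ E c d) (i, k) (j, l) =
      if (a = i ∧ b = j) ∧ (c = k ∧ d = l) then (1 : K) else 0 := by
    intro a b c d
    simp only [E, Matrix.kroneckerMap_apply, Matrix.single_apply, mul_ite, mul_one, mul_zero]
    split_ifs <;> tauto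
  simp only [Rv, Matrix.add_apply, Matrix.sub_apply, Matrix.neg_apply, Matrix.sum_apply,
    Matrix.smul_apply, apply_ite
    (fun M : Matrix (Fin N × Fin N) (Fin N × Fin N) K => M (i, k) (j, l)), e, Matrix.zero_apply,
    dv, ov]
  have h1 : (∑ a, ∑ b, if a ≠ b then if (a = i ∧ a = j) ∧ b = k ∧ b = l then (1 : K) else 0 else 0) =
      if i ≠ k ∧ i = j ∧ k = l then 1 else 0 := by
    rw [sum_sum_eq_single i k (fun a b hab => by grind)]
    grind
  have h2 : (∑ a, if (a = i ∧ a = j) ∧ a = k ∧ a = l then (1 : K) else 0) =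
      if i = j ∧ i = k ∧ i = l then 1 else 0 := by
    rw [Finset.sum_eq_single i (by intro b _ hb; simp [hb]) (by simp)]
    grind
  have h3 : (∑ a, ∑ b, if a < b then if (a = i ∧ b = j) ∧ b = k ∧ a = l then (1 : K) else 0 else 0) =
      if i < j ∧ j = k ∧ i = l then 1 else 0 := by
    rw [sum_sum_eq_single i k (fun a b hab => by grind)]
    grind
  rw [h1, h2, h3]
  simp only [smul_eq_mul, mul_ite, mul_one, mul_zero]
  grind

/-- A matrix indexed by pairs, viewed as a matrix of matrices. -/
def blocks {R : Type*} (M : Matrix (Fin N × Fin N) (Fin N × Fin N) R) :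
    Matrix (Fin N) (Fin N) (Matrix (Fin N) (Fin N) R) :=
  Matrix.of fun i j => Matrix.of fun p r => M (i, p) (j, r)

/-- A matrix `M` acting on a pair of tensor factors by `e_i ⊗ e_k ↦ d e_i ⊗ e_k + o e_k ⊗ e_i`. -/
def IsSwapMatrix (M : Matrix (Fin N × Fin N) (Fin N × Fin N) K) (d o : Fin N → Fin N → K) : Prop :=
  ∀ i k j l, M (i, k) (j, l) = (if i = j ∧ k = l then d i k else 0)
      + (if i = l ∧ k = j then o i k else 0)

variable {M : Matrix (Fin N × Fin N) (Fin N × Fin N) K} {d o : Fin N → Fin N → K}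

theorem mulVec_of_two_entries {n : Type*} [Fintype n] [DecidableEq n] {B : Matrix n n K}
    {x a b : n} {c c' : K}
    (h : ∀ y, B x y = (if y = a then c else 0) + (if y = b then c' else 0)) (f : n → K) :
    B.mulVec f x = c * f a + c' * f b := by
  simp [Matrix.mulVec, dotProduct, h, add_mul, Finset.sum_add_distrib]

theorem IsSwapMatrix.mulVec_legOne (h : IsSwapMatrix M d o) (f : (Fin N × Fin N) × Fin N → K)
    (i k p : Fin N) :
    (Matrix.compRingEquiv (Fin N × Fin N) (Fin N) K (legOne (blocks M))).mulVec f ((i, k), p) =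
      d i p * f ((i, k), p) + o i p * f ((p, k), i) := by
  refine mulVec_of_two_entries ?_ f
  rintro ⟨⟨j, l⟩, r⟩
  change (legOne (blocks M)) (i, k) (j, l) p r = _
  rw [legOne_apply]
  have := h i p j r
  simp only [blocks, Matrix.of_apply, Prod.mk.injEq] at this ⊢
  split_ifs at this ⊢ <;> grind [Matrix.zero_apply, Matrix.of_apply]

theorem IsSwapMatrix.mulVec_legTwo (h : IsSwapMatrix M d o) (f : (Fin N × Fin N) × Fin N → K)
    (i k p : Fin N) :
    (Matrix.compRingEquiv (Fin N × Fin N) (Fin N) K (legTwo (blocks M))).mulVec f ((i, k), p) =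
      d k p * f ((i, k), p) + o k p * f ((i, p), k) := by
  refine mulVec_of_two_entries ?_ f
  rintro ⟨⟨j, l⟩, r⟩
  change (legTwo (blocks M)) (i, k) (j, l) p r = _
  rw [legTwo_apply]
  have := h k p l r
  simp only [blocks, Matrix.of_apply, Prod.mk.injEq] at this ⊢
  split_ifs at this ⊢ <;> grind [Matrix.zero_apply, Matrix.of_apply]

theorem IsSwapMatrix.mulVec_scalar (h : IsSwapMatrix M d o) (f : (Fin N × Fin N) × Fin N → K)
    (i k p : Fin N) :
    (Matrix.compRingEquiv (Fin N × Fin N) (Fin N) K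
      (M.map (algebraMap K (Matrix (Fin N) (Fin N) K)))).mulVec f ((i, k), p) =
      d i k * f ((i, k), p) + o i k * f ((k, i), p) := by
  refine mulVec_of_two_entries ?_ f
  rintro ⟨⟨j, l⟩, r⟩
  change algebraMap K (Matrix (Fin N) (Fin N) K) (M (i, k) (j, l)) p r = _
  rw [Matrix.algebraMap_matrix_apply, h i k j l]
  simp only [Prod.mk.injEq, Algebra.algebraMap_self, RingHom.id_apply]
  grind

theorem isSwapMatrix_Ru : IsSwapMatrix (Ru N) (du q) (ou q) := fun i k j l => Ru_apply i k j l

theorem isSwapMatrix_Rv : IsSwapMatrix (Rv N) (dv q) (ov q) := fun i k j l => Rv_apply i k j l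

theorem eq_of_mulVec_comp {X Y : Matrix (Fin N × Fin N) (Fin N × Fin N) (Matrix (Fin N) (Fin N) K)}
    (h : ∀ f i k p, (Matrix.compRingEquiv (Fin N × Fin N) (Fin N) K X).mulVec f ((i, k), p) =
      (Matrix.compRingEquiv (Fin N × Fin N) (Fin N) K Y).mulVec f ((i, k), p)) : X = Y := by
  apply (Matrix.compRingEquiv (Fin N × Fin N) (Fin N) K).injective
  apply Matrix.ext_of_mulVec_single
  intro x
  ext ⟨⟨i, k⟩, p⟩
  exact h _ i k p

/-- The coefficients of the Yang–Baxter equation. -/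
theorem linearRTT_blocks :
    LinearRTT (RuQ N (Matrix (Fin N) (Fin N) K)) (RvQ N (Matrix (Fin N) (Fin N) K))
      (legOne (blocks (Ru N))) (legOne (blocks (Rv N)))
      (legTwo (blocks (Ru N))) (legTwo (blocks (Rv N))) := by
  -- With the outer indices in factors 1 and 2 and the inner index in factor 3, scalar R acts as R₁₂
  -- and the two legs of the blocks act as R₁₃ and R₂₃. Each field is then one of the seven
  -- identities.
  constructor <;>
  · apply eq_of_mulVec_comp
    intro f i k p
    have h1 := ybe_uuu q_ne_zero (fun i k p => f ((i, k), p)) i k p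
    have h2 := ybe_uuv q_ne_zero (fun i k p => f ((i, k), p)) i k p
    have h3 := ybe_uvv q_ne_zero (fun i k p => f ((i, k), p)) i k p
    have h4 := ybe_vuu q_ne_zero (fun i k p => f ((i, k), p)) i k p
    have h5 := ybe_vvu q_ne_zero (fun i k p => f ((i, k), p)) i k p
    have h6 := ybe_vvv q_ne_zero (fun i k p => f ((i, k), p)) i k p
    have h7 := ybe_mixed q_ne_zero (fun i k p => f ((i, k), p)) i k p
    simp only [op12, op13, op23] at h1 h2 h3 h4 h5 h6 h7
    simp only [map_mul, map_add, Matrix.add_mulVec, Pi.add_apply, ← Matrix.mulVec_mulVec, RuQ, RvQ,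
      isSwapMatrix_Ru.mulVec_scalar, isSwapMatrix_Rv.mulVec_scalar,
      isSwapMatrix_Ru.mulVec_legOne, isSwapMatrix_Rv.mulVec_legOne,
      isSwapMatrix_Ru.mulVec_legTwo, isSwapMatrix_Rv.mulVec_legTwo]
    assumption

end YangBaxter

/-! ### Rescaling, base change and transposition of linear solutions -/

section LinearRTTOps

/-- Each relation is homogeneous separately in (a₁, a₂) and in (b₁, b₂). Scaling A and B
independently later absorbs signs and the parameter μ. -/
theorem LinearRTT.smul {S M : Type*} [CommRing S] [Ring M] [Algebra S M]
    {ru rv a₁ b₁ a₂ b₂ : M} (h : LinearRTT ru rv a₁ b₁ a₂ b₂) (c d : S) :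
    LinearRTT ru rv (c • a₁) (d • b₁) (c • a₂) (d • b₂) := by
  constructor <;> simp only [smul_mul_assoc, mul_smul_comm, smul_smul]
  · rw [h.uaa]
  · rw [h.uab, mul_comm]
  · have := congrArg (fun x => (c * d) • x) h.mixed
    simp only [smul_add] at this
    rw [mul_comm d c]
    exact this
  · rw [h.ubb]
  · rw [h.vaa]
  · rw [h.vba, mul_comm]
  · rw [h.vbb]

variable {N : ℕ} {Q Q' : Type*} [Ring Q] [Algebra K Q] [Ring Q'] [Algebra K Q']

/-- The matrices `A`, `B` define a linear solution `u A + B` of the ternary relation. -/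
def IsLinearRTT (A B : Matrix (Fin N) (Fin N) Q) : Prop :=
  LinearRTT (RuQ N Q) (RvQ N Q) (legOne A) (legOne B) (legTwo A) (legTwo B)

theorem isLinearRTT_blocks : IsLinearRTT (blocks (Ru N)) (blocks (Rv N)) := linearRTT_blocks

theorem IsLinearRTT.map {A B : Matrix (Fin N) (Fin N) Q} (h : IsLinearRTT A B) (φ : Q →ₐ[K] Q') :
    IsLinearRTT (A.map φ) (B.map φ) := by
  have hu : φ.toRingHom.mapMatrix (RuQ N Q) = RuQ N Q' := by ext; simp [RuQ]
  have hv : φ.toRingHom.mapMatrix (RvQ N Q) = RvQ N Q' := by ext; simp [RvQ]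
  have h1 : ∀ X : Matrix (Fin N) (Fin N) Q, φ.toRingHom.mapMatrix (legOne X) = legOne (X.map φ) := by
    intro X
    ext ⟨i, k⟩ ⟨j, l⟩
    simp [legOne_apply, apply_ite φ]
  have h2 : ∀ X : Matrix (Fin N) (Fin N) Q, φ.toRingHom.mapMatrix (legTwo X) = legTwo (X.map φ) := by
    intro X
    ext ⟨i, k⟩ ⟨j, l⟩
    simp [legTwo_apply, apply_ite φ]
  rw [IsLinearRTT, ← hu, ← hv, ← h1, ← h1, ← h2, ← h2]
  have e := fun {x y : Matrix (Fin N × Fin N) (Fin N × Fin N) Q} (hxy : x = y) =>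
    congrArg φ.toRingHom.mapMatrix hxy
  constructor <;> simp only [← map_mul, ← map_add]
  exacts [e h.uaa, e h.uab, e h.mixed, e h.ubb, e h.vaa, e h.vba, e h.vbb]

/-- Transposition in both tensor factors followed by the flip of the factors. -/
def transposeFlip (M : Matrix (Fin N × Fin N) (Fin N × Fin N) Q) :
    Matrix (Fin N × Fin N) (Fin N × Fin N) Q :=
  M.transpose.submatrix Prod.swap Prod.swap

theorem transposeFlip_add (M M' : Matrix (Fin N × Fin N) (Fin N × Fin N) Q) :
    transposeFlip (M + M') = transposeFlip M + transposeFlip M' := rfl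

theorem transposeFlip_legs (X Y : Matrix (Fin N) (Fin N) Q) :
    transposeFlip (legOne X * legTwo Y) = legTwo X.transpose * legOne Y.transpose := by
  ext ⟨i, k⟩ ⟨j, l⟩
  rw [legTwo_mul_legOne_apply]
  exact legOne_mul_legTwo_apply X Y l k j i

theorem transposeFlip_legs' (X Y : Matrix (Fin N) (Fin N) Q) :
    transposeFlip (legTwo Y * legOne X) = legOne Y.transpose * legTwo X.transpose := by
  ext ⟨i, k⟩ ⟨j, l⟩
  rw [legOne_mul_legTwo_apply]
  exact legTwo_mul_legOne_apply X Y l k j i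

/-- Transposition does not reverse products of matrices over a noncommutative ring; it does when one
of them has central entries. -/
theorem transposeFlip_scalar_mul (R : Matrix (Fin N × Fin N) (Fin N × Fin N) K)
    (M : Matrix (Fin N × Fin N) (Fin N × Fin N) Q) :
    transposeFlip (R.map (algebraMap K Q) * M) =
      transposeFlip M * transposeFlip (R.map (algebraMap K Q)) := by
  ext ⟨i, k⟩ ⟨j, l⟩
  simp only [transposeFlip, Matrix.submatrix_apply, Matrix.transpose_apply, Matrix.mul_apply,
    Prod.swap_prod_mk, Fintype.sum_prod_type, Matrix.map_apply]
  rw [Finset.sum_comm]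
  exact Finset.sum_congr rfl fun _ _ => Finset.sum_congr rfl fun _ _ => Algebra.commutes _ _

theorem transposeFlip_mul_scalar (R : Matrix (Fin N × Fin N) (Fin N × Fin N) K)
    (M : Matrix (Fin N × Fin N) (Fin N × Fin N) Q) :
    transposeFlip (M * R.map (algebraMap K Q)) =
      transposeFlip (R.map (algebraMap K Q)) * transposeFlip M := by
  ext ⟨i, k⟩ ⟨j, l⟩
  simp only [transposeFlip, Matrix.submatrix_apply, Matrix.transpose_apply, Matrix.mul_apply,
    Prod.swap_prod_mk, Fintype.sum_prod_type, Matrix.map_apply]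
  rw [Finset.sum_comm]
  exact Finset.sum_congr rfl fun _ _ => Finset.sum_congr rfl fun _ _ => (Algebra.commutes _ _).symm

/-- Transposing both factors turns E_{ij} ⊗ E_{ji} into E_{ji} ⊗ E_{ij}, and the flip turns it back.
-/
theorem transposeFlip_RuQ : transposeFlip (RuQ N Q) = RuQ N Q := by
  ext ⟨i, k⟩ ⟨j, l⟩
  simp only [transposeFlip, RuQ, Matrix.submatrix_apply, Matrix.transpose_apply, Prod.swap_prod_mk,
    Matrix.map_apply, Ru_apply, du, ou]
  congr 1
  grind

theorem transposeFlip_RvQ : transposeFlip (RvQ N Q) = RvQ N Q := by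
  ext ⟨i, k⟩ ⟨j, l⟩
  simp only [transposeFlip, RvQ, Matrix.submatrix_apply, Matrix.transpose_apply, Prod.swap_prod_mk,
    Matrix.map_apply, Rv_apply, dv, ov]
  congr 1
  grind

/-- Transposition and flip reverse the two sides of the relation and interchange the tensor factors,
hence the roles of A and B. This produces the solution for the identity from the one for θ. -/
theorem IsLinearRTT.transpose {A B : Matrix (Fin N) (Fin N) Q} (h : IsLinearRTT A B) :
    IsLinearRTT B.transpose A.transpose := by
  have e := fun {x y : Matrix (Fin N × Fin N) (Fin N × Fin N) Q} (hxy : x = y) =>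
    congrArg transposeFlip hxy
  have u1 := fun M => transposeFlip_scalar_mul (Q := Q) (Ru N) M
  have u2 := fun M => transposeFlip_mul_scalar (Q := Q) (Ru N) M
  have v1 := fun M => transposeFlip_scalar_mul (Q := Q) (Rv N) M
  have v2 := fun M => transposeFlip_mul_scalar (Q := Q) (Rv N) M
  simp only [← RuQ.eq_1, ← RvQ.eq_1, transposeFlip_RuQ, transposeFlip_RvQ] at u1 u2 v1 v2
  constructor
  · simpa only [u1, u2, transposeFlip_legs, transposeFlip_legs'] using (e h.ubb).symm
  · simpa only [u1, u2, transposeFlip_legs, transposeFlip_legs'] using (e h.uab).symm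
  · simpa only [u1, u2, v1, v2, transposeFlip_legs, transposeFlip_legs', transposeFlip_add]
      using (e h.mixed).symm
  · simpa only [u1, u2, transposeFlip_legs, transposeFlip_legs'] using (e h.uaa).symm
  · simpa only [v1, v2, transposeFlip_legs, transposeFlip_legs'] using (e h.vbb).symm
  · simpa only [v1, v2, transposeFlip_legs, transposeFlip_legs'] using (e h.vba).symm
  · simpa only [v1, v2, transposeFlip_legs, transposeFlip_legs'] using (e h.vaa).symm

end LinearRTTOps

/-! ### Commutation of the R-matrix with its partial transpose -/

section BlockProducts

variable {N : ℕ} {M M' : Matrix (Fin N × Fin N) (Fin N × Fin N) K} {d o d' o' : Fin N → Fin N → K}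

theorem IsSwapMatrix.sum_mul_right (h : IsSwapMatrix M d o) (g : Fin N → Fin N → K)
    (i k : Fin N) : ∑ a, ∑ b, M (i, k) (a, b) * g a b = d i k * g i k + o i k * g k i := by
  simp only [h i k, add_mul, Finset.sum_add_distrib]
  rw [sum_sum_eq_single i k (fun a b hab => by grind), sum_sum_eq_single k i (fun a b hab => by grind)]
  simp

theorem IsSwapMatrix.sum_mul_left (h : IsSwapMatrix M d o) (g : Fin N → Fin N → K)
    (j l : Fin N) : ∑ a, ∑ b, g a b * M (a, b) (j, l) = g j l * d j l + g l j * o l j := by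
  have h' : ∀ a b, M (a, b) (j, l) = (if a = j ∧ b = l then d j l else 0)
      + (if a = l ∧ b = j then o l j else 0) := by
    intro a b
    rw [h a b]
    grind
  simp only [h', mul_add, Finset.sum_add_distrib]
  rw [sum_sum_eq_single j l (fun a b hab => by grind), sum_sum_eq_single l j (fun a b hab => by grind)]
  simp

/-- In tensor form: M commutes with the transpose of M' in the first factor. This is the identity
behind the agreement of the two quantum homomorphisms on the generators of `Ytw`. -/
theorem blocks_mul_eq (h : IsSwapMatrix M d o) (h' : IsSwapMatrix M' d' o')
    (hd' : ∀ i k, d' i k = d' k i) (ho : ∀ i, o i i = 0) (hd : ∀ i k, d i i = d k k)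
    (b c : Fin N) :
    ∑ a, blocks M b a * blocks M' c a = ∑ a, blocks M' a b * blocks M a c := by
  ext p r
  simp only [Matrix.sum_apply, Matrix.mul_apply, blocks, Matrix.of_apply]
  rw [h.sum_mul_right (fun a s => M' (c, s) (a, r)),
    h.sum_mul_left (fun a s => M' (a, p) (b, s)), h' c p, h' c b, h' r p]
  grind

/-- The commutation relation `R(u,z) Rᵗ(u⁻¹,z) = Rᵗ(u⁻¹,z) R(u,z)`, coefficientwise. -/
theorem blocks_Ru_mul_Rv (b c : Fin N) :
    ∑ a, blocks (Ru N) b a * blocks (Rv N) c a = ∑ a, blocks (Rv N) a b * blocks (Ru N) a c :=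
  blocks_mul_eq isSwapMatrix_Ru isSwapMatrix_Rv (by grind [dv]) (by grind [ou]) (by grind [du]) b c

theorem blocks_Rv_mul_Ru (b c : Fin N) :
    ∑ a, blocks (Rv N) b a * blocks (Ru N) c a = ∑ a, blocks (Ru N) a b * blocks (Rv N) a c :=
  blocks_mul_eq isSwapMatrix_Rv isSwapMatrix_Ru (by grind [du]) (by grind [ov]) (by grind [dv]) b c

theorem blocks_Ru_mul_Ru (b c : Fin N) :
    ∑ a, blocks (Ru N) b a * blocks (Ru N) c a = ∑ a, blocks (Ru N) a b * blocks (Ru N) a c :=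
  blocks_mul_eq isSwapMatrix_Ru isSwapMatrix_Ru (by grind [du]) (by grind [ou]) (by grind [du]) b c

theorem blocks_Rv_mul_Rv (b c : Fin N) :
    ∑ a, blocks (Rv N) b a * blocks (Rv N) c a = ∑ a, blocks (Rv N) a b * blocks (Rv N) a c :=
  blocks_mul_eq isSwapMatrix_Rv isSwapMatrix_Rv (by grind [dv]) (by grind [ov]) (by grind [dv]) b c

end BlockProducts

/-! ### Products with linear solutions -/

section SeqMul

variable {N : ℕ} {Q : Type*} [Ring Q]

/-- The coefficients of `X(w) (A - μ w B) / (1 - μ w)` for a series `X(w) = ∑_r X_r w^r`. -/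
def seqMul (A B : Matrix (Fin N) (Fin N) Q) (μ : Q) (X : ℕ → Matrix (Fin N) (Fin N) Q) :
    ℕ → Matrix (Fin N) (Fin N) Q
  | 0 => X 0 * A
  | r + 1 => X (r + 1) * A + μ • (seqMul A B μ X r - X r * B)

theorem mul_center_smul {μ : Q} (hμ : μ ∈ Subring.center Q) (X B : Matrix (Fin N) (Fin N) Q) :
    X * (μ • B) = μ • (X * B) := by
  ext i j
  simp only [Matrix.mul_apply, Matrix.smul_apply, smul_eq_mul, Finset.mul_sum]
  refine Finset.sum_congr rfl fun a _ => ?_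
  rw [← mul_assoc, Subring.mem_center_iff.1 hμ, mul_assoc]

theorem negSeries_neg (X : ℕ → Matrix (Fin N) (Fin N) Q) (r : ℕ) : negSeries X (-r) = X r := by
  simp [negSeries]

theorem negSeries_pos (X : ℕ → Matrix (Fin N) (Fin N) Q) {m : ℤ} (hm : 0 < m) :
    negSeries X m = 0 := by
  simp [negSeries, hm]

theorem posSeries_nat (X : ℕ → Matrix (Fin N) (Fin N) Q) (r : ℕ) : posSeries X r = X r := by
  simp [posSeries]

theorem posSeries_neg (X : ℕ → Matrix (Fin N) (Fin N) Q) {m : ℤ} (hm : m < 0) :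
    posSeries X m = 0 := by
  simp [posSeries, hm]

theorem negSeries_seqMul {A B : Matrix (Fin N) (Fin N) Q} {μ : Q} (hμ : μ ∈ Subring.center Q)
    (X : ℕ → Matrix (Fin N) (Fin N) Q) (m : ℤ) :
    negSeries (seqMul A B μ X) m - μ • negSeries (seqMul A B μ X) (m + 1) =
      negSeries X m * A - negSeries X (m + 1) * (μ • B) := by
  rw [mul_center_smul hμ]
  rcases lt_or_ge 0 m with hm | hm
  · simp [negSeries_pos, hm, show 0 < m + 1 by lia]
  · obtain ⟨r, hr⟩ := Int.eq_ofNat_of_zero_le (neg_nonneg.2 hm)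
    obtain rfl : m = -(r : ℤ) := by lia
    cases r with
    | zero => simp [negSeries_pos, seqMul, negSeries]
    | succ r =>
      rw [show -((r + 1 : ℕ) : ℤ) + 1 = -(r : ℤ) by push_cast; ring]
      simp only [negSeries_neg, seqMul, smul_sub]
      abel

/-- The factor is the same rational function as for the negative series: multiplying numerator and
denominator of (B - νuA)/(1 - νu) by -μu⁻¹ gives (A - μu⁻¹B)/(1 - μu⁻¹). Only the point of expansion
differs, so A, B are exchanged and μ is inverted. -/
theorem posSeries_seqMul {A B : Matrix (Fin N) (Fin N) Q} {μ ν : Q} (hμ : μ ∈ Subring.center Q)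
    (hμν : μ * ν = 1) (X : ℕ → Matrix (Fin N) (Fin N) Q) (m : ℤ) :
    posSeries (seqMul B A ν X) m - μ • posSeries (seqMul B A ν X) (m + 1) =
      posSeries X m * A - posSeries X (m + 1) * (μ • B) := by
  rw [mul_center_smul hμ]
  rcases lt_or_ge m 0 with hm | hm
  · rcases eq_or_ne m (-1) with rfl | hm'
    · simp [posSeries, seqMul]
    · simp [posSeries_neg, hm, show m + 1 < 0 by lia]
  · obtain ⟨r, rfl⟩ := Int.eq_ofNat_of_zero_le hm
    rw [show (r : ℤ) + 1 = ((r + 1 : ℕ) : ℤ) by push_cast; ring]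
    simp only [posSeries_nat, seqMul, smul_add, smul_smul, hμν, one_smul]
    abel

theorem triangular_mul_diag {X Y : Matrix (Fin N) (Fin N) Q} (hX : ∀ i j, i < j → X i j = 0)
    (hY : ∀ i j, i < j → Y i j = 0) (i : Fin N) : (X * Y) i i = X i i * Y i i := by
  rw [Matrix.mul_apply]
  refine Finset.sum_eq_single i (fun a _ ha => ?_) (by simp)
  rcases lt_or_gt_of_ne ha with h | h
  · rw [hY _ _ h, mul_zero]
  · rw [hX _ _ h, zero_mul]

theorem triangular_mul_zero {X Y : Matrix (Fin N) (Fin N) Q} (hX : ∀ i j, i < j → X i j = 0)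
    (hY : ∀ i j, i < j → Y i j = 0) (i j : Fin N) (hij : i < j) : (X * Y) i j = 0 := by
  rw [Matrix.mul_apply]
  refine Finset.sum_eq_zero fun a _ => ?_
  rcases lt_or_ge i a with h | h
  · rw [hX _ _ h, zero_mul]
  · rw [hY _ _ (h.trans_lt hij), mul_zero]

theorem triangular_mul_diag' {X Y : Matrix (Fin N) (Fin N) Q} (hX : ∀ i j, i < j → X j i = 0)
    (hY : ∀ i j, i < j → Y j i = 0) (i : Fin N) : (X * Y) i i = X i i * Y i i := by
  rw [Matrix.mul_apply]
  refine Finset.sum_eq_single i (fun a _ ha => ?_) (by simp)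
  rcases lt_or_gt_of_ne ha with h | h
  · rw [hX _ _ h, zero_mul]
  · rw [hY _ _ h, mul_zero]

theorem triangular_mul_zero' {X Y : Matrix (Fin N) (Fin N) Q} (hX : ∀ i j, i < j → X j i = 0)
    (hY : ∀ i j, i < j → Y j i = 0) (i j : Fin N) (hij : i < j) : (X * Y) j i = 0 := by
  rw [Matrix.mul_apply]
  refine Finset.sum_eq_zero fun a _ => ?_
  rcases lt_or_ge a j with h | h
  · rw [hX _ _ h, zero_mul]
  · rw [hY _ _ (hij.trans_le h), mul_zero]

variable [Algebra K Q]

theorem RTT.mul_linear {A B : Matrix (Fin N) (Fin N) Q} (hL : IsLinearRTT A B) {μ ν : Q}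
    (hμ : μ ∈ Subring.center Q) (hν : ν ∈ Subring.center Q) (hμν : μ * ν = 1)
    {X Y X' Y' : ℤ → Matrix (Fin N) (Fin N) Q}
    (h : RTT X Y) (hAX : ∀ m i j k l, A i j * X m k l = X m k l * A i j)
    (hBX : ∀ m i j k l, B i j * X m k l = X m k l * B i j)
    (hAY : ∀ m i j k l, A i j * Y m k l = Y m k l * A i j)
    (hBY : ∀ m i j k l, B i j * Y m k l = Y m k l * B i j)
    (hX' : ∀ m, X' m - μ • X' (m + 1) = X m * A - X (m + 1) * (μ • B))
    (hY' : ∀ m, Y' m - μ • Y' (m + 1) = Y m * A - Y (m + 1) * (μ • B))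
    {m₀ n₀ : ℤ} (hx₀ : X' (m₀ - 1) = 0) (hx₀' : X' m₀ = 0) (hy₀ : Y' (n₀ - 1) = 0)
    (hy₀' : Y' n₀ = 0) : RTT X' Y' := by
  -- The center serves as the commutative ring of scalars, over which μ is a unit with inverse ν.
  set z : Subring.center Q := ⟨μ, hμ⟩ with hz
  have hzu : IsUnit z := IsUnit.of_mul_eq_one ⟨ν, hν⟩ (Subtype.ext hμν)
  have hzs : ∀ Z : Matrix (Fin N) (Fin N) Q, z • Z = μ • Z := fun Z => rfl
  have hcomm : ∀ {W : ℤ → Matrix (Fin N) (Fin N) Q},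
      (∀ m i j k l, B i j * W m k l = W m k l * B i j) →
      ∀ m i j k l, (-(μ • B)) i j * W m k l = W m k l * (-(μ • B)) i j := by
    intro W hW m i j k l
    simp only [Matrix.neg_apply, Matrix.smul_apply, smul_eq_mul, neg_mul, mul_neg]
    rw [mul_assoc, hW, ← mul_assoc, ← Subring.mem_center_iff.1 hμ, mul_assoc]
  have hL' : LinearRTT (RuQ N Q) (RvQ N Q) (legOne A) (legOne (-(μ • B)))
      (legTwo A) (legTwo (-(μ • B))) := by
    have := LinearRTT.smul hL (1 : Subring.center Q) (-z)
    simp only [← legOne_smul, ← legTwo_smul, one_smul, neg_smul, ← map_neg] at this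
    exact this
  refine hL'.mul (S := Subring.center Q) (c₁ := 1) (c₂ := -z) isUnit_one hzu.neg
    (x := fun m => legOne (X m)) (y := fun m => legTwo (Y m)) (x' := fun m => legOne (X' m))
    (y' := fun m => legTwo (Y' m)) (fun n => legOne_mul_legTwo_comm fun i j k l => hAY n i j k l)
    (fun n => legOne_mul_legTwo_comm fun i j k l => hcomm hBY n i j k l)
    (fun n => (legOne_mul_legTwo_comm fun i j k l => (hAX n k l i j).symm).symm)
    (fun n => (legOne_mul_legTwo_comm fun i j k l => (hcomm hBX n k l i j).symm).symm) h ?_ ?_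
    (m₀ := m₀) (n₀ := n₀) (by simp [hx₀]) (by simp [hx₀']) (by simp [hy₀]) (by simp [hy₀'])
  · intro m
    rw [one_smul, neg_smul, ← legOne_smul, ← sub_eq_add_neg, ← map_sub, hzs, hX', map_sub, map_neg,
      map_mul, map_mul, mul_neg, sub_eq_add_neg]
  · intro m
    rw [one_smul, neg_smul, ← legTwo_smul, ← sub_eq_add_neg, ← map_sub, hzs, hY', map_sub, map_neg,
      map_mul, map_mul, mul_neg, sub_eq_add_neg]

/-- Multiplication of a solution of the defining relations by a linear solution. -/
theorem IsRTT.seqMul {T Tb : ℕ → Matrix (Fin N) (Fin N) Q} (h : IsRTT T Tb)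
    {A B : Matrix (Fin N) (Fin N) Q} (hL : IsLinearRTT A B) {μ ν : Q}
    (hμ : μ ∈ Subring.center Q) (hν : ν ∈ Subring.center Q) (hμν : μ * ν = 1)
    (hAT : ∀ r i j k l, A i j * T r k l = T r k l * A i j)
    (hBT : ∀ r i j k l, B i j * T r k l = T r k l * B i j)
    (hATb : ∀ r i j k l, A i j * Tb r k l = Tb r k l * A i j)
    (hBTb : ∀ r i j k l, B i j * Tb r k l = Tb r k l * B i j)
    (hA : ∀ i j, i < j → A i j = 0) (hB : ∀ i j, i < j → B j i = 0)
    (hAB : ∀ i, A i i * B i i = 1) (hBA : ∀ i, B i i * A i i = 1) :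
    IsRTT (seqMul A B μ T) (seqMul B A ν Tb) := by
  have cn : ∀ {A : Matrix (Fin N) (Fin N) Q} {T : ℕ → Matrix (Fin N) (Fin N) Q},
      (∀ r i j k l, A i j * T r k l = T r k l * A i j) →
      ∀ m i j k l, A i j * negSeries T m k l = negSeries T m k l * A i j := by
    intro A T h m i j k l
    rw [negSeries]
    split_ifs
    · exact h _ _ _ _ _
    · simp
  have cp : ∀ {A : Matrix (Fin N) (Fin N) Q} {T : ℕ → Matrix (Fin N) (Fin N) Q},
      (∀ r i j k l, A i j * T r k l = T r k l * A i j) →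
      ∀ m i j k l, A i j * posSeries T m k l = posSeries T m k l * A i j := by
    intro A T h m i j k l
    rw [posSeries]
    split_ifs
    · exact h _ _ _ _ _
    · simp
  constructor
  · exact triangular_mul_zero h.t_zero hA
  · exact triangular_mul_zero' h.tbar_zero hB
  · intro i
    change (T 0 * A) i i * (Tb 0 * B) i i = 1
    rw [triangular_mul_diag h.t_zero hA, triangular_mul_diag' h.tbar_zero hB, mul_assoc,
      ← mul_assoc (A i i), hATb, mul_assoc, hAB, mul_one, h.t_mul_tbar]
  · intro i
    change (Tb 0 * B) i i * (T 0 * A) i i = 1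
    rw [triangular_mul_diag h.t_zero hA, triangular_mul_diag' h.tbar_zero hB, mul_assoc,
      ← mul_assoc (B i i), hBT, mul_assoc, hBA, mul_one, h.tbar_mul_t]
  -- The recursion needs two consecutive zero coefficients: at 1, 2 for series in u⁻¹ and at -2, -1
  -- for series in u.
  · exact h.rtt.mul_linear hL hμ hν hμν (cn hAT) (cn hBT) (cn hAT) (cn hBT) (negSeries_seqMul hμ T)
      (negSeries_seqMul hμ T) (m₀ := 2) (n₀ := 2) (negSeries_pos _ (by norm_num))
      (negSeries_pos _ (by norm_num)) (negSeries_pos _ (by norm_num)) (negSeries_pos _ (by norm_num))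
  · exact h.rtbartbar.mul_linear hL hμ hν hμν (cp hATb) (cp hBTb) (cp hATb) (cp hBTb)
      (posSeries_seqMul hμ hμν Tb) (posSeries_seqMul hμ hμν Tb) (m₀ := -1) (n₀ := -1)
      (posSeries_neg _ (by norm_num)) (posSeries_neg _ (by norm_num))
      (posSeries_neg _ (by norm_num)) (posSeries_neg _ (by norm_num))
  · exact h.rtbart.mul_linear hL hμ hν hμν (cp hATb) (cp hBTb) (cn hAT) (cn hBT)
      (posSeries_seqMul hμ hμν Tb) (negSeries_seqMul hμ T) (m₀ := -1) (n₀ := 2)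
      (posSeries_neg _ (by norm_num)) (posSeries_neg _ (by norm_num))
      (negSeries_pos _ (by norm_num)) (negSeries_pos _ (by norm_num))

end SeqMul

/-! ### Triangular linear solutions -/

section Triangular

variable {N : ℕ}

/-- The variable `q` in `𝒜`. -/
abbrev qA : A := LaurentPolynomial.T 1

/-- The inverse of the variable `q` in `𝒜`. -/
abbrev qinvA : A := LaurentPolynomial.T (-1)

theorem qA_mul_qinvA : qA * qinvA = 1 := by
  rw [← LaurentPolynomial.T_add]; simp

theorem algebraMap_qA : algebraMap A K qA = q := rfl

theorem algebraMap_qinvA : algebraMap A K qinvA = q⁻¹ := by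
  refine eq_inv_of_mul_eq_one_left ?_
  rw [q, ← map_mul, mul_comm, qA_mul_qinvA, map_one]

theorem evalOne_T (n : ℤ) : evalOne (LaurentPolynomial.T n) = 1 := by
  simp [evalOne]

variable {R R' : Type*} [Ring R] [Algebra A R] [Ring R'] [Algebra A R']

/-- The lower triangular matrix with diagonal entries `1 + (q - 1) c F_{ii}` and entries
`(q - q⁻¹) F_{ij}` below the diagonal. -/
def lowerL (c : A) (F : Matrix (Fin N) (Fin N) R) : Matrix (Fin N) (Fin N) R :=
  Matrix.of fun i j => if i = j then 1 + ((qA - 1) * c) • F i i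
    else if j < i then (qA - qinvA) • F i j else 0

/-- The upper triangular matrix with diagonal entries `1 + (q - 1) c F_{ii}` and entries
`(q - q⁻¹) F_{ij}` above the diagonal. -/
def upperL (c : A) (F : Matrix (Fin N) (Fin N) R) : Matrix (Fin N) (Fin N) R :=
  Matrix.of fun i j => if i = j then 1 + ((qA - 1) * c) • F i i
    else if i < j then (qA - qinvA) • F i j else 0

theorem lowerL_apply (c : A) (F : Matrix (Fin N) (Fin N) R) (i j : Fin N) :
    lowerL c F i j = if i = j then
      1 + (qA - 1) • (if i = j then c • F i j else if j < i then F i j else 0) else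
      (qA - qinvA) • (if i = j then c • F i j else if j < i then F i j else 0) := by
  rw [lowerL, Matrix.of_apply]
  split_ifs with h h'
  · rw [mul_smul, h]
  · rfl
  · rw [smul_zero]

theorem upperL_apply (c : A) (F : Matrix (Fin N) (Fin N) R) (i j : Fin N) :
    upperL c F i j = if i = j then
      1 + (qA - 1) • (if i = j then c • F i j else if i < j then F i j else 0) else
      (qA - qinvA) • (if i = j then c • F i j else if i < j then F i j else 0) := by
  rw [upperL, Matrix.of_apply]
  split_ifs with h h'
  · rw [mul_smul, h]
  · rfl
  · rw [smul_zero]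

theorem lowerL_map (φ : R →ₐ[A] R') (c : A) (F : Matrix (Fin N) (Fin N) R) :
    (lowerL c F).map φ = lowerL c (F.map φ) := by
  ext i j
  simp only [lowerL, Matrix.map_apply, Matrix.of_apply]
  split_ifs <;> simp

theorem upperL_map (φ : R →ₐ[A] R') (c : A) (F : Matrix (Fin N) (Fin N) R) :
    (upperL c F).map φ = upperL c (F.map φ) := by
  ext i j
  simp only [upperL, Matrix.map_apply, Matrix.of_apply]
  split_ifs <;> simp

theorem lowerL_transpose (c : A) (F : Matrix (Fin N) (Fin N) R) :
    (lowerL c F).transpose = upperL c F.transpose := by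
  ext i j
  simp only [lowerL, upperL, Matrix.transpose_apply, Matrix.of_apply]
  grind

theorem upperL_transpose (c : A) (F : Matrix (Fin N) (Fin N) R) :
    (upperL c F).transpose = lowerL c F.transpose := by
  ext i j
  simp only [lowerL, upperL, Matrix.transpose_apply, Matrix.of_apply]
  grind

/-- Divisibility of this difference by q - q⁻¹ keeps the quotient defining `seqMul` inside the
integral form. -/
theorem upperL_sub_lowerL {c d : A} (hcd : (qA - 1) * (c + d) = qA - qinvA)
    (F : Matrix (Fin N) (Fin N) R) : upperL c F - lowerL d (-F) = (qA - qinvA) • F := by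
  ext i j
  simp only [lowerL, upperL, Matrix.sub_apply, Matrix.of_apply, Matrix.smul_apply, Matrix.neg_apply]
  rcases lt_trichotomy i j with h | rfl | h
  · simp [h.ne, h, h.not_gt]
  · simp only [if_true, ← hcd]; module
  · simp [h.ne', h, h.not_gt]

theorem smul_matrix_apply (a : A) (M : Matrix (Fin N) (Fin N) K) (p r : Fin N) :
    (a • M) p r = algebraMap A K a * M p r := by
  rw [Matrix.smul_apply, Algebra.smul_def]

/-- Read through its first leg, the R-matrix is a triangular solution built on -E_{ji}, the image of
E_{ij} under θ. Thus θ is the automorphism lifted without a transposition. -/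
theorem blocks_Ru_eq_lowerL :
    blocks (Ru N) = lowerL qinvA (Matrix.of fun i j => -Matrix.single j i (1 : K)) := by
  have hq := q_ne_zero
  ext i j p r
  simp only [blocks, Matrix.of_apply, Ru_apply, du, ou, lowerL]
  rcases lt_trichotomy i j with h | rfl | h
  · rw [if_neg h.ne, if_neg h.not_gt, Matrix.zero_apply]
    grind
  · rw [if_pos rfl, Matrix.add_apply, smul_matrix_apply, Matrix.one_apply, Matrix.neg_apply,
      Matrix.single_apply, map_mul, map_sub, algebraMap_qA, algebraMap_qinvA, map_one]
    have : (q - 1) * q⁻¹ = 1 - q⁻¹ := by field_simp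
    grind
  · rw [if_neg h.ne', if_pos h, smul_matrix_apply, Matrix.neg_apply, Matrix.single_apply, map_sub,
      algebraMap_qA, algebraMap_qinvA]
    grind

theorem neg_blocks_Rv_eq_upperL :
    -blocks (Rv N) = upperL 1 (Matrix.of fun i j => Matrix.single j i (1 : K)) := by
  ext i j p r
  simp only [blocks, Matrix.of_apply, Matrix.neg_apply, Rv_apply, dv, ov, upperL]
  rcases lt_trichotomy i j with h | rfl | h
  · rw [if_neg h.ne, if_pos h, smul_matrix_apply, Matrix.single_apply, map_sub,
      algebraMap_qA, algebraMap_qinvA]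
    grind
  · rw [if_pos rfl, Matrix.add_apply, smul_matrix_apply, Matrix.one_apply,
      Matrix.single_apply, map_mul, map_sub, algebraMap_qA, map_one]
    grind
  · rw [if_neg h.ne', if_neg h.not_gt, Matrix.zero_apply]
    grind

theorem smul_eq_zero_of_red {S S' : Type*} [Ring S] [Algebra A S] [Ring S'] {red : S →+* S'}
    (hred : ∀ x : S, red ((qA - 1) • x) = 0) (x : S) : red ((qA - qinvA) • x) = 0 := by
  have : qA - qinvA = (qA - 1) * (1 + qinvA) := by linear_combination -qA_mul_qinvA
  rw [this, mul_smul, hred]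

/-- Multiplication by a triangular linear solution preserves the integral form. -/
theorem exists_integral_seqMul {S S' : Type*} [Ring S] [Algebra A S] [Ring S'] (red : S →+* S')
    (hred : ∀ x : S, red ((qA - 1) • x) = 0) {τ X : ℕ → Matrix (Fin N) (Fin N) S}
    {A₀ B₀ α P : Matrix (Fin N) (Fin N) S} {μ : S}
    (hX : ∀ r i j, X r i j =
      if r = 0 ∧ i = j then 1 + (qA - 1) • τ r i j else (qA - qinvA) • τ r i j)
    (hA : ∀ i j, A₀ i j = if i = j then 1 + (qA - 1) • α i j else (qA - qinvA) • α i j)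
    (hAB : A₀ - B₀ = (qA - qinvA) • P) (hdiag : ∀ i, (X 0 * A₀) i i = X 0 i i * A₀ i i) :
    ∃ w : ℕ → Matrix (Fin N) (Fin N) S,
      (∀ r i j, seqMul A₀ B₀ μ X r i j =
        if r = 0 ∧ i = j then 1 + (qA - 1) • w r i j else (qA - qinvA) • w r i j) ∧
      ∀ r i j, red (w r i j) =
        red (τ r i j) + if r = 0 then red (α i j) else red (μ ^ r * P i j) := by
  have hred' := smul_eq_zero_of_red hred
  have redX0 : (X 0).map red = 1 := by
    ext i j
    rw [Matrix.map_apply, hX, Matrix.one_apply]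
    split_ifs <;> simp_all
  have redX : ∀ r, (X (r + 1)).map red = 0 := by
    intro r
    ext i j
    rw [Matrix.map_apply, hX, Matrix.zero_apply]
    simp [hred']
  have redA : A₀.map red = 1 := by
    ext i j
    rw [Matrix.map_apply, hA, Matrix.one_apply]
    split_ifs <;> simp_all
  -- y_r is the quotient of `seqMul` minus X_r A₀ by q - q⁻¹; its recursion comes from A₀ - B₀ = (q
  -- - q⁻¹)P.
  let y : ℕ → Matrix (Fin N) (Fin N) S := fun r => Nat.rec 0 (fun r yr => μ • (yr + X r * P)) r
  have y0 : y 0 = 0 := rfl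
  have ys : ∀ r, y (r + 1) = μ • (y r + X r * P) := fun r => rfl
  have hy : ∀ r, seqMul A₀ B₀ μ X r = X r * A₀ + (qA - qinvA) • y r := by
    intro r
    induction r with
    | zero => simp [seqMul, y0]
    | succ r ih =>
      rw [seqMul, ih, ys, smul_comm _ μ, smul_add, ← Matrix.mul_smul, ← hAB, mul_sub]
      congr 2
      abel
  -- After reduction only X₀ = 1 survives, so the recursion starts from P and merely multiplies by
  -- μ.
  have redy : ∀ r, (y (r + 1)).map red = (μ ^ (r + 1) • P).map red := by
    intro r
    have hs : ∀ Z : Matrix (Fin N) (Fin N) S, (μ • Z).map red = red μ • Z.map red := by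
      intro Z; ext; simp
    induction r with
    | zero =>
      rw [ys, y0, zero_add, zero_add, pow_one, hs, hs, Matrix.map_mul, redX0, one_mul]
    | succ r ih =>
      rw [ys (r + 1), hs, Matrix.map_add _ (map_add red), ih, Matrix.map_mul, redX, zero_mul, add_zero,
        ← hs, smul_smul, ← pow_succ']
  -- For r = 0 on the diagonal, w comes from expanding (1 + (q-1)τ)(1 + (q-1)α) and removing 1 and a
  -- factor q - 1. Elsewhere a factor q - q⁻¹ is taken out of each summand of the product.
  refine ⟨fun r => Matrix.of fun i j => if r = 0 then (if i = j then
      τ 0 i j + α i j + (qA - 1) • (τ 0 i j * α i j) else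
      (∑ a ∈ Finset.univ.erase i, τ 0 i a * A₀ a j) + X 0 i i * α i j) else
      (τ r * A₀ + y r) i j, fun r i j => ?_, fun r i j => ?_⟩
  · rw [hy]
    rcases r with _ | r
    · rw [y0, smul_zero, add_zero]
      by_cases hij : i = j
      · subst hij
        rw [hdiag, hX, hA]
        simp only [and_self, if_true, Matrix.of_apply, mul_add, add_mul, one_mul, mul_one,
          smul_mul_assoc, mul_smul_comm]
        module
      · simp only [hij, and_false, if_false, if_true, Matrix.of_apply]
        rw [Matrix.mul_apply, ← Finset.sum_erase_add _ _ (Finset.mem_univ i), smul_add,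
          Finset.smul_sum]
        congr 1
        · refine Finset.sum_congr rfl fun a ha => ?_
          rw [hX, if_neg (by simpa using (Finset.ne_of_mem_erase ha).symm), smul_mul_assoc]
        · rw [hA i j, if_neg hij, mul_smul_comm]
    · simp only [Nat.add_eq_zero_iff, one_ne_zero, and_false, false_and, if_false, Matrix.of_apply]
      have : X (r + 1) = (qA - qinvA) • τ (r + 1) := by
        ext i j
        rw [hX]
        simp
      rw [this, smul_mul_assoc, ← smul_add, Matrix.smul_apply]
  · have redA' : ∀ i j, red (A₀ i j) = if i = j then 1 else 0 := fun i j => by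
      rw [← Matrix.one_apply, ← redA, Matrix.map_apply]
    rcases r with _ | r
    · by_cases hij : i = j
      · subst hij
        simp [hred]
      · have hX0 : red (X 0 i i) = 1 := by simp [hX, hred]
        simp only [hij, if_false, if_true, Matrix.of_apply, map_add, map_sum, map_mul, redA', hX0,
          one_mul, mul_ite, mul_one, mul_zero]
        simp [Ne.symm hij]
    · simp only [Nat.add_eq_zero_iff, one_ne_zero, and_false, if_false, Matrix.of_apply,
        Matrix.add_apply, map_add]
      have h1 := congrFun (congrFun (redy r) i) j
      have h2 : ((τ (r + 1)) * A₀).map red = (τ (r + 1)).map red := by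
        rw [Matrix.map_mul, redA, mul_one]
      have h2 := congrFun (congrFun h2 i) j
      simp only [Matrix.map_apply, Matrix.smul_apply, smul_eq_mul] at h1 h2
      rw [h1, h2]

end Triangular

/-! ### The homomorphisms `U_q(ĝl_N) → U_q(ĝl_N) ⊗ gl_N[λ, λ⁻¹]` -/

/-- A ring structure on `U_q(ĝl_N)` whose semiring structure is syntactically the canonical one. -/
instance uqRing (N : ℕ) : Ring (Uq N) :=
  { (inferInstance : Semiring (Uq N)), RingQuot.instRing (Rel N) with }

section Loop

variable {N : ℕ} (C : Type*) [Ring C] [Algebra ℂ C]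

/-- The scalar matrix `λ^p` as an element of `C ⊗ gl_N[λ, λ⁻¹]`. -/
def lam (N : ℕ) (p : ℤ) : C ⊗[ℂ] LoopGL N :=
  1 ⊗ₜ Matrix.scalar (Fin N) (LaurentPolynomial.T p)

theorem lam_mem_center (p : ℤ) : lam C N p ∈ Subring.center (C ⊗[ℂ] LoopGL N) := by
  rw [Subring.mem_center_iff]
  intro g
  induction g with
  | zero => simp
  | add x y hx hy => rw [add_mul, mul_add, hx, hy]
  | tmul x y =>
    rw [lam, Algebra.TensorProduct.tmul_mul_tmul, Algebra.TensorProduct.tmul_mul_tmul, one_mul,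
      mul_one, (Matrix.scalar_commute _ (fun r => Commute.all _ r) y).eq]

theorem lam_mul (p p' : ℤ) : lam C N p * lam C N p' = lam C N (p + p') := by
  rw [lam, lam, lam, Algebra.TensorProduct.tmul_mul_tmul, one_mul, ← map_mul,
    LaurentPolynomial.T_add]

theorem lam_zero : lam C N 0 = 1 := by
  rw [lam, LaurentPolynomial.T_zero, map_one]; rfl

theorem lam_pow (p : ℤ) (r : ℕ) : lam C N p ^ r = lam C N (p * r) := by
  induction r with
  | zero => simp [lam_zero]
  | succ r ih => rw [pow_succ, ih, lam_mul]; push_cast; ring_nf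

theorem scalar_mul_Eloop (i j : Fin N) (p p' : ℤ) :
    Matrix.scalar (Fin N) (LaurentPolynomial.T p) * Eloop i j p' = Eloop i j (p + p') := by
  refine Matrix.ext fun a b => ?_
  rw [Matrix.scalar_apply, Matrix.diagonal_mul, Eloop, Eloop, Matrix.single_apply,
    Matrix.single_apply, LaurentPolynomial.T_add]
  split_ifs
  · rfl
  · exact mul_zero (LaurentPolynomial.T p : ℂ[T;T⁻¹])

end Loop

instance isScalarTower_atOne : IsScalarTower ℂ A ℂ where
  smul_assoc c a x := by
    change evalOne (c • a) * x = c * (evalOne a * x)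
    rw [LaurentPolynomial.smul_eq_C_mul, map_mul, mul_assoc]
    simp [evalOne]

instance isScalarTower_specialization (N : ℕ) : IsScalarTower ℂ A (ℂ ⊗[A] UA N) where
  smul_assoc c a x := by
    induction x with
    | zero => simp
    | add x y hx hy => simp only [smul_add, hx, hy]
    | tmul x y => simp only [TensorProduct.smul_tmul', smul_assoc]

section Delta

variable (N : ℕ)

/-- The algebra `U_q(ĝl_N) ⊗ gl_N[λ, λ⁻¹]`. -/
abbrev UqLoop : Type := Uq N ⊗[ℂ] LoopGL N

/-- The algebra `U_𝒜 ⊗ gl_N[λ, λ⁻¹]`. -/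
abbrev UALoop : Type := UA N ⊗[ℂ] LoopGL N

/-- The specialization of `U_𝒜` at `q = 1`. -/
abbrev Ubar : Type := ℂ ⊗[A] UA N

/-- The algebra obtained from `U_𝒜 ⊗ gl_N[λ, λ⁻¹]` at `q = 1`. -/
abbrev UbarLoop : Type := Ubar N ⊗[ℂ] LoopGL N

/-- The embedding of `U_𝒜 ⊗ gl_N[λ, λ⁻¹]`. -/
def inclLoop : UALoop N →ₐ[A] UqLoop N :=
  Algebra.TensorProduct.map (UA N).val (AlgHom.id ℂ _)

theorem inclLoop_injective : Function.Injective (inclLoop N) :=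
  Module.Flat.rTensor_preserves_injective_linearMap (M := LoopGL N)
    ((UA N).val.toLinearMap.restrictScalars ℂ) Subtype.val_injective

/-- The specialization map `U_𝒜 → U_𝒜 ⊗ ℂ`. -/
def spec : UA N →ₐ[A] Ubar N := Algebra.TensorProduct.includeRight

/-- The specialization map of `U_𝒜 ⊗ gl_N[λ, λ⁻¹]`. -/
def redLoop : UALoop N →ₐ[A] UbarLoop N :=
  Algebra.TensorProduct.map (spec N) (AlgHom.id ℂ _)

/-- Constant matrices over `ℂ(q)` as elements of `U_q(ĝl_N) ⊗ gl_N[λ, λ⁻¹]`. -/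
def constMatrix : Matrix (Fin N) (Fin N) K →ₐ[K] UqLoop N :=
  (Algebra.TensorProduct.map (Algebra.ofId K (Uq N)) (Algebra.ofId ℂ ℂ[T;T⁻¹]).mapMatrix).comp
    { (matrixEquivTensor (Fin N) ℂ K).toAlgHom with
      commutes' := fun c => by
        apply (matrixEquivTensor (Fin N) ℂ K).symm.injective
        rw [Algebra.TensorProduct.algebraMap_apply, matrixEquivTensor_apply_symm]
        refine ((matrixEquivTensor (Fin N) ℂ K).symm_apply_apply _).trans ?_
        rw [Matrix.map_one _ (map_zero _) (map_one _), Algebra.algebraMap_eq_smul_one]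
        rfl }

theorem constMatrix_single (i j : Fin N) :
    constMatrix N (Matrix.single i j 1) = 1 ⊗ₜ Eloop i j 0 := by
  change Algebra.TensorProduct.map (Algebra.ofId K (Uq N)) (Algebra.ofId ℂ ℂ[T;T⁻¹]).mapMatrix
    (matrixEquivTensor (Fin N) ℂ K (Matrix.single i j 1)) = _
  rw [matrixEquivTensor_apply_single, Algebra.TensorProduct.map_tmul, map_one]
  congr 1
  rw [AlgHom.mapMatrix_apply, Matrix.map_single, map_one, Eloop, LaurentPolynomial.T_zero]

variable {N}

theorem spec_smul (a : A) (x : UA N) : spec N (a • x) = evalOne a • spec N x := by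
  rw [map_smul, ← algebraMap_smul ℂ]; rfl

theorem evalOne_sub_one : evalOne (qA - 1) = 0 := by
  rw [map_sub, evalOne_T, map_one, sub_self]

theorem redLoop_smul (x : UALoop N) : redLoop N ((qA - 1) • x) = 0 := by
  rw [map_smul, ← algebraMap_smul ℂ]
  change evalOne (qA - 1) • _ = _
  rw [evalOne_sub_one, zero_smul]

variable (N)

/-- The data of a homomorphism `U_q(ĝl_N) → U_q(ĝl_N) ⊗ gl_N[λ, λ⁻¹]` lifting
`E_{ij} λ^p ↦ F_{ij} λ^{εp}`. -/
structure LoopTwist where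
  /-- the lower diagonal coefficient -/
  c : A
  /-- the upper diagonal coefficient -/
  d : A
  /-- the matrix of constant elements -/
  F : Matrix (Fin N) (Fin N) (LoopGL N)
  /-- the power of `λ` -/
  ε : ℤ
  -- `sum_eq` makes lower minus upper divisible by q - q⁻¹; `sub_eq` together with `F_diag` makes
  -- their diagonal entries mutually inverse.
  sum_eq : (qA - 1) * (c + d) = qA - qinvA
  sub_eq : c - d = ε * ((qA - 1) * c * d)
  F_diag : ∀ i, F i i * F i i = ε • F i i
  evalOne_c : evalOne c = 1
  evalOne_d : evalOne d = 1
  linear : IsLinearRTT (lowerL c (F.map (1 ⊗ₜ · : _ → UqLoop N)))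
    (upperL d (-F.map (1 ⊗ₜ · : _ → UqLoop N)))

theorem lowerL_zero {R : Type*} [Ring R] [Algebra A R] (c : A) (F : Matrix (Fin N) (Fin N) R)
    (i j : Fin N) (hij : i < j) : lowerL c F i j = 0 := by
  simp [lowerL, hij.ne, hij.not_gt]

theorem upperL_zero {R : Type*} [Ring R] [Algebra A R] (c : A) (F : Matrix (Fin N) (Fin N) R)
    (i j : Fin N) (hij : i < j) : upperL c F j i = 0 := by
  simp [upperL, hij.ne', hij.not_gt]

variable {N}

namespace LoopTwist

variable (D : LoopTwist N)

/-- The matrix `1 ⊗ F`. -/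
def FC (C : Type*) [Ring C] [Algebra ℂ C] : Matrix (Fin N) (Fin N) (C ⊗[ℂ] LoopGL N) :=
  D.F.map (1 ⊗ₜ ·)

/-- The lower triangular linear solution. -/
def lower (C : Type*) [Ring C] [Algebra ℂ C] [Algebra A C] [IsScalarTower ℂ A C] :
    Matrix (Fin N) (Fin N) (C ⊗[ℂ] LoopGL N) := lowerL D.c (D.FC C)

/-- The upper triangular linear solution. -/
def upper (C : Type*) [Ring C] [Algebra ℂ C] [Algebra A C] [IsScalarTower ℂ A C] :
    Matrix (Fin N) (Fin N) (C ⊗[ℂ] LoopGL N) := upperL D.d (-D.FC C)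

theorem lower_diag (i : Fin N) :
    D.lower (Uq N) i i = 1 + ((qA - 1) * D.c) • D.FC (Uq N) i i := by
  simp [lower, lowerL]

theorem upper_diag (i : Fin N) :
    D.upper (Uq N) i i = 1 - ((qA - 1) * D.d) • D.FC (Uq N) i i := by
  simp [upper, upperL, sub_eq_add_neg]

theorem FC_diag (i : Fin N) :
    D.FC (Uq N) i i * D.FC (Uq N) i i = D.ε • D.FC (Uq N) i i := by
  simp only [FC, Matrix.map_apply]
  rw [Algebra.TensorProduct.tmul_mul_tmul, one_mul, D.F_diag, TensorProduct.tmul_smul]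

theorem diag_aux : (qA - 1) * D.c - (qA - 1) * D.d -
    (qA - 1) * D.c * ((qA - 1) * D.d) * D.ε = 0 := by
  linear_combination (qA - 1) * D.sub_eq

theorem one_add_mul_one_sub {R : Type*} [Ring R] [Algebra A R] {a b : A} {e : ℤ} {x : R}
    (hx : x * x = e • x) (h : a - b - a * b * e = 0) :
    (1 + a • x) * (1 - b • x) = 1 ∧ (1 - b • x) * (1 + a • x) = 1 := by
  have hx' : (a * b) • (x * x) = a • x - b • x := by
    rw [hx, ← Int.cast_smul_eq_zsmul A, smul_smul, ← sub_smul]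
    congr 1
    linear_combination -h
  constructor
  · rw [mul_sub, add_mul, add_mul, one_mul, one_mul, mul_one, smul_mul_smul_comm, hx']
    abel
  · rw [mul_add, sub_mul, sub_mul, one_mul, one_mul, mul_one, smul_mul_smul_comm, mul_comm b, hx']
    abel

theorem lower_mul_upper (i : Fin N) : D.lower (Uq N) i i * D.upper (Uq N) i i = 1 := by
  rw [lower_diag, upper_diag]
  exact (one_add_mul_one_sub (D.FC_diag i) D.diag_aux).1

theorem upper_mul_lower (i : Fin N) : D.upper (Uq N) i i * D.lower (Uq N) i i = 1 := by
  rw [lower_diag, upper_diag]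
  exact (one_add_mul_one_sub (D.FC_diag i) D.diag_aux).2

end LoopTwist

/-- The matrices of the elements `t_{ij}^{(r)} ⊗ 1`. -/
def tLoop (r : ℕ) : Matrix (Fin N) (Fin N) (UqLoop N) := Matrix.of fun i j => t r i j ⊗ₜ 1

/-- The matrices of the elements `t̄_{ij}^{(r)} ⊗ 1`. -/
def tbarLoop (r : ℕ) : Matrix (Fin N) (Fin N) (UqLoop N) := Matrix.of fun i j => tbar r i j ⊗ₜ 1

theorem isRTT_tLoop : IsRTT (tLoop (N := N)) tbarLoop :=
  isRTT_map (Algebra.TensorProduct.includeLeft : Uq N →ₐ[K] UqLoop N)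

namespace LoopTwist

variable (D : LoopTwist N)

theorem FC_commute (i j : Fin N) (x : Uq N) : Commute (D.FC (Uq N) i j) (x ⊗ₜ 1) := by
  simp [FC, Commute, SemiconjBy]

theorem lower_commute (i j : Fin N) (x : Uq N) : Commute (D.lower (Uq N) i j) (x ⊗ₜ 1) := by
  simp only [lower, lowerL, Matrix.of_apply]
  split_ifs
  · exact (Commute.one_left _).add_left ((D.FC_commute i i x).smul_left _)
  · exact (D.FC_commute i j x).smul_left _
  · exact Commute.zero_left _

theorem upper_commute (i j : Fin N) (x : Uq N) : Commute (D.upper (Uq N) i j) (x ⊗ₜ 1) := by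
  simp only [upper, upperL, Matrix.of_apply]
  split_ifs
  · exact (Commute.one_left _).add_left ((D.FC_commute i i x).neg_left.smul_left _)
  · exact (D.FC_commute i j x).neg_left.smul_left _
  · exact Commute.zero_left _

theorem isRTT : IsRTT (seqMul (D.lower (Uq N)) (D.upper (Uq N)) (lam (Uq N) N D.ε) tLoop)
    (seqMul (D.upper (Uq N)) (D.lower (Uq N)) (lam (Uq N) N (-D.ε)) tbarLoop) :=
  isRTT_tLoop.seqMul D.linear (lam_mem_center _ _) (lam_mem_center _ _)
    (by rw [lam_mul, add_neg_cancel, lam_zero]) (fun r i j k l => D.lower_commute i j _)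
    (fun r i j k l => D.upper_commute i j _) (fun r i j k l => D.lower_commute i j _)
    (fun r i j k l => D.upper_commute i j _) (lowerL_zero _ _ _) (upperL_zero _ _ _)
    D.lower_mul_upper D.upper_mul_lower

/-- The homomorphism `U_q(ĝl_N) → U_q(ĝl_N) ⊗ gl_N[λ, λ⁻¹]` attached to a twist. -/
def delta : Uq N →ₐ[K] UqLoop N := UqLift D.isRTT

end LoopTwist

end Delta

/-! ### Integrality of the homomorphisms and their specializations at `q = 1` -/

section Integrality

variable {N : ℕ}

theorem T_injective : Function.Injective (LaurentPolynomial.T : ℤ → A) := fun m n h => by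
  have := congrArg (fun p : A => p.coeff m) h
  by_contra hmn
  simp [LaurentPolynomial.T_apply, Ne.symm hmn] at this

theorem qA_sub_one_ne_zero : qA - 1 ≠ 0 := by
  rw [sub_ne_zero, ← LaurentPolynomial.T_zero]
  exact T_injective.ne (by norm_num)

theorem qA_sub_qinvA_ne_zero : qA - qinvA ≠ 0 :=
  sub_ne_zero.2 (T_injective.ne (by norm_num))

theorem algebraMap_ne_zero {a : A} (ha : a ≠ 0) : algebraMap A K a ≠ 0 := by
  rwa [Ne, FaithfulSMul.algebraMap_eq_zero_iff]

theorem q_sub_one_ne_zero : q - 1 ≠ 0 := by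
  have := algebraMap_ne_zero qA_sub_one_ne_zero
  rwa [map_sub, map_one] at this

theorem q_sub_inv_ne_zero : q - q⁻¹ ≠ 0 := by
  have := algebraMap_ne_zero qA_sub_qinvA_ne_zero
  rwa [map_sub, algebraMap_qinvA] at this

theorem qA_sub_one_smul {V : Type*} [AddCommGroup V] [Module A V] [Module K V] [IsScalarTower A K V]
    (x : V) : (qA - 1) • x = (q - 1) • x := by
  rw [← algebraMap_smul K, map_sub, map_one]; rfl

theorem qA_sub_qinvA_smul {V : Type*} [AddCommGroup V] [Module A V] [Module K V]
    [IsScalarTower A K V] (x : V) : (qA - qinvA) • x = (q - q⁻¹) • x := by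
  rw [← algebraMap_smul K, map_sub, algebraMap_qinvA]; rfl

theorem smul_cancel {V : Type*} [AddCommGroup V] [Module A V] [Module K V] [IsScalarTower A K V]
    {a : A} (ha : a ≠ 0) {x y : V} (h : a • x = a • y) : x = y := by
  rw [← algebraMap_smul K a x, ← algebraMap_smul K a y] at h
  exact smul_right_injective _ (algebraMap_ne_zero ha) h

theorem t_eq_tau (r : ℕ) (i j : Fin N) : t r i j =
    if r = 0 ∧ i = j then 1 + (qA - 1) • tau r i j else (qA - qinvA) • tau r i j := by
  rw [qA_sub_one_smul, qA_sub_qinvA_smul, tau]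
  split_ifs
  · rw [smul_inv_smul₀ q_sub_one_ne_zero]
    exact (add_sub_cancel _ _).symm
  · rw [smul_inv_smul₀ q_sub_inv_ne_zero]

theorem tbar_eq_taubar (r : ℕ) (i j : Fin N) : tbar r i j =
    if r = 0 ∧ i = j then 1 + (qA - 1) • taubar r i j else (qA - qinvA) • taubar r i j := by
  rw [qA_sub_one_smul, qA_sub_qinvA_smul, taubar]
  split_ifs
  · rw [smul_inv_smul₀ q_sub_one_ne_zero]
    exact (add_sub_cancel _ _).symm
  · rw [smul_inv_smul₀ q_sub_inv_ne_zero]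

theorem t_zero_of_lt {i j : Fin N} (h : i < j) : t 0 i j = 0 :=
  (isRTT_map (AlgHom.id K (Uq N))).t_zero i j h

theorem tbar_zero_of_lt {i j : Fin N} (h : i < j) : tbar 0 j i = 0 :=
  (isRTT_map (AlgHom.id K (Uq N))).tbar_zero i j h

theorem tauA_zero_of_lt {i j : Fin N} (h : i < j) : tauA 0 i j = 0 := by
  apply Subtype.ext
  simp [tauA, tau, h.ne, t_zero_of_lt h]

theorem taubarA_zero_of_lt {i j : Fin N} (h : i < j) : taubarA 0 j i = 0 := by
  apply Subtype.ext
  simp [taubarA, taubar, h.ne', tbar_zero_of_lt h]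

/-- The matrices with entries `1 + (q - 1) τ` or `(q - q⁻¹) τ`, as in the definition of `τ`. -/
def rescale {R : Type*} [Ring R] [Algebra A R] (τ : ℕ → Matrix (Fin N) (Fin N) R) (r : ℕ) :
    Matrix (Fin N) (Fin N) R :=
  Matrix.of fun i j => if r = 0 ∧ i = j then 1 + (qA - 1) • τ r i j else (qA - qinvA) • τ r i j

theorem rescale_map {R R' : Type*} [Ring R] [Algebra A R] [Ring R'] [Algebra A R'] (φ : R →ₐ[A] R')
    (τ : ℕ → Matrix (Fin N) (Fin N) R) (r : ℕ) :
    (rescale τ r).map φ = rescale (fun r => (τ r).map φ) r := by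
  ext i j
  simp only [rescale, Matrix.map_apply, Matrix.of_apply]
  split_ifs <;> simp

theorem seqMul_map {R R' : Type*} [Ring R] [Ring R'] (φ : R →+* R')
    (A₀ B₀ : Matrix (Fin N) (Fin N) R) (μ : R) (X : ℕ → Matrix (Fin N) (Fin N) R) (r : ℕ) :
    (seqMul A₀ B₀ μ X r).map φ =
      seqMul (A₀.map φ) (B₀.map φ) (φ μ) (fun r => (X r).map φ) r := by
  have hs : ∀ (c : R) (Z : Matrix (Fin N) (Fin N) R), (c • Z).map φ = φ c • Z.map φ := by
    intro c Z; ext; simp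
  induction r with
  | zero => simp [seqMul, Matrix.map_mul]
  | succ r ih =>
    rw [seqMul, seqMul, ← ih, Matrix.map_add _ (map_add φ), hs, Matrix.map_sub _ (map_sub φ),
      Matrix.map_mul, Matrix.map_mul]

/-- The matrices of the elements `τ_{ij}^{(r)} ⊗ 1`. -/
def tauLoop (r : ℕ) : Matrix (Fin N) (Fin N) (UALoop N) := Matrix.of fun i j => tauA r i j ⊗ₜ 1

/-- The matrices of the elements `τ̄_{ij}^{(r)} ⊗ 1`. -/
def taubarLoop (r : ℕ) : Matrix (Fin N) (Fin N) (UALoop N) :=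
  Matrix.of fun i j => taubarA r i j ⊗ₜ 1

theorem rescale_tauLoop_map (r : ℕ) :
    (rescale tauLoop r).map (inclLoop N) = tLoop (N := N) r := by
  ext i j
  have h : inclLoop N (tauA r i j ⊗ₜ 1) = tau r i j ⊗ₜ 1 := rfl
  rw [rescale_map]
  simp only [rescale, tLoop, tauLoop, Matrix.of_apply, Matrix.map_apply]
  rw [h, t_eq_tau r i j]
  split_ifs
  · rw [TensorProduct.add_tmul, TensorProduct.smul_tmul']; rfl
  · rw [TensorProduct.smul_tmul']

theorem rescale_taubarLoop_map (r : ℕ) :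
    (rescale taubarLoop r).map (inclLoop N) = tbarLoop (N := N) r := by
  ext i j
  have h : inclLoop N (taubarA r i j ⊗ₜ 1) = taubar r i j ⊗ₜ 1 := rfl
  rw [rescale_map]
  simp only [rescale, tbarLoop, taubarLoop, Matrix.of_apply, Matrix.map_apply]
  rw [h, tbar_eq_taubar r i j]
  split_ifs
  · rw [TensorProduct.add_tmul, TensorProduct.smul_tmul']; rfl
  · rw [TensorProduct.smul_tmul']

theorem tensor_mul_neg {C G : Type*} [Ring C] [Algebra ℂ C] [Ring G] [Algebra ℂ G] (x y : C ⊗[ℂ] G) :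
    x * -y = -(x * y) :=
  mul_neg x y

namespace LoopTwist

variable (D : LoopTwist N)

theorem FC_map : (D.FC (UA N)).map (inclLoop N) = D.FC (Uq N) := by
  ext i j
  simp [FC, inclLoop]

theorem lower_map : (D.lower (UA N)).map (inclLoop N) = D.lower (Uq N) := by
  rw [lower, lowerL_map, FC_map]; rfl

theorem upper_map : (D.upper (UA N)).map (inclLoop N) = D.upper (Uq N) := by
  rw [upper, upperL_map, upper, ← FC_map, Matrix.map_neg _ (map_neg _)]

theorem inclLoop_lam (p : ℤ) : inclLoop N (lam (UA N) N p) = lam (Uq N) N p := by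
  simp [lam, inclLoop]

theorem upper_sub_lower (C : Type*) [Ring C] [Algebra ℂ C] [Algebra A C] [IsScalarTower ℂ A C] :
    D.upper C - D.lower C = (qA - qinvA) • -D.FC C := by
  have := upperL_sub_lowerL (c := D.d) (d := D.c) (by rw [add_comm, D.sum_eq]) (-D.FC C)
  rw [neg_neg] at this
  exact this

theorem lower_sub_upper (C : Type*) [Ring C] [Algebra ℂ C] [Algebra A C] [IsScalarTower ℂ A C] :
    D.lower C - D.upper C = (qA - qinvA) • D.FC C := by
  rw [← neg_sub, upper_sub_lower, smul_neg, neg_neg]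

/-- The value of the specialized homomorphism on `E_{ij} λ^p`. -/
def image (i j : Fin N) (p : ℤ) : LoopGL N :=
  Matrix.scalar (Fin N) (LaurentPolynomial.T (D.ε * p)) * D.F i j

theorem redLoop_lam_mul (i j : Fin N) (p : ℤ) :
    redLoop N (lam (UA N) N (D.ε * p) * D.FC (UA N) i j) = 1 ⊗ₜ D.image i j p := by
  simp [lam, FC, redLoop, image]

theorem redLoop_FC (i j : Fin N) : redLoop N (D.FC (UA N) i j) = 1 ⊗ₜ D.F i j := by
  simp [FC, redLoop]

theorem image_zero (i j : Fin N) : D.image i j 0 = D.F i j := by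
  simp [image]

theorem redLoop_smul_eq (a : A) (x : UALoop N) : redLoop N (a • x) = evalOne a • redLoop N x := by
  rw [map_smul, ← algebraMap_smul ℂ]; rfl

theorem redLoop_smul_FC {a : A} (ha : evalOne a = 1) (i j : Fin N) :
    redLoop N (a • D.FC (UA N) i j) = 1 ⊗ₜ D.F i j := by
  rw [redLoop_smul_eq, ha, one_smul, redLoop_FC]

theorem redLoop_smul_neg {a : A} (ha : evalOne a = 1) {x : UALoop N} {y : UbarLoop N}
    (h : redLoop N x = y) : redLoop N (a • -x) = -y := by
  rw [redLoop_smul_eq, ha, one_smul]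
  exact (map_neg (redLoop N).toRingHom x).trans (congrArg Neg.neg h)

/-- The image of t is computed inside the integral form by `exists_integral_seqMul`; the factor q -
1 or q - q⁻¹ is then cancelled in a ℂ(q)-vector space. In the exceptional case r = 0, i < j the
triangular matrix contributes nothing. -/
theorem exists_delta_tau (r : ℕ) (i j : Fin N) : ∃ w : UALoop N, inclLoop N w = D.delta (tau r i j) ∧
    redLoop N w = spec N (tauA r i j) ⊗ₜ 1 +
      if r = 0 ∧ i < j then 0 else 1 ⊗ₜ D.image i j r := by
  obtain ⟨w, hw, hw'⟩ := exists_integral_seqMul (S' := UbarLoop N) (redLoop N).toRingHom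
    (fun x => redLoop_smul x)
    (τ := tauLoop (N := N)) (X := rescale tauLoop) (A₀ := D.lower (UA N)) (B₀ := D.upper (UA N))
    (α := Matrix.of fun i j => if i = j then D.c • D.FC (UA N) i j else if j < i then
      D.FC (UA N) i j else 0) (P := D.FC (UA N)) (μ := lam (UA N) N D.ε) (fun r i j => rfl)
    (lowerL_apply _ _) (D.lower_sub_upper _)
    (triangular_mul_diag (fun i j hij => by
      simp [rescale, hij.ne, tauLoop, tauA_zero_of_lt hij]) (lowerL_zero N _ _))
  refine ⟨w r i j, ?_, ?_⟩
  · have h1 : D.delta (t r i j) = if r = 0 ∧ i = j then 1 + (qA - 1) • inclLoop N (w r i j)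
        else (qA - qinvA) • inclLoop N (w r i j) := by
      have := congrFun (congrFun (seqMul_map (inclLoop N).toRingHom (D.lower (UA N)) (D.upper (UA N))
        (lam (UA N) N D.ε) (rescale tauLoop) r) i) j
      simp only [AlgHom.toRingHom_eq_coe, RingHom.coe_coe, rescale_tauLoop_map, inclLoop_lam,
        lower_map, upper_map, Matrix.map_apply, hw] at this
      rw [delta, UqLift_t]
      refine Eq.trans this.symm ?_
      split_ifs <;> simp
    rw [t_eq_tau, apply_ite D.delta] at h1
    have hs : ∀ (a : A) (x : Uq N), D.delta (a • x) = a • D.delta x := fun a x =>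
      map_smul (D.delta.restrictScalars A) a x
    split_ifs at h1
    · rw [map_add, map_one, add_right_inj, hs] at h1
      exact (smul_cancel qA_sub_one_ne_zero h1).symm
    · rw [hs] at h1
      exact (smul_cancel qA_sub_qinvA_ne_zero h1).symm
  · refine (hw' r i j).trans ?_
    congr 1
    · rcases r with _ | r
      · simp only [true_and, if_true, Matrix.of_apply]
        rcases lt_trichotomy i j with h | rfl | h
        · simp [h, h.ne, h.not_gt]
        · rw [if_pos rfl, if_neg (lt_irrefl i), Nat.cast_zero, image_zero]
          exact D.redLoop_smul_FC D.evalOne_c i i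
        · simp [h, h.ne', h.not_gt, redLoop_FC, image_zero]
      · simp only [Nat.add_eq_zero_iff, one_ne_zero, and_false, false_and, if_false]
        rw [lam_pow]
        exact D.redLoop_lam_mul i j _

theorem exists_delta_taubar (r : ℕ) (i j : Fin N) :
    ∃ w : UALoop N, inclLoop N w = D.delta (taubar r i j) ∧
    redLoop N w = spec N (taubarA r i j) ⊗ₜ 1 -
      if r = 0 ∧ j < i then 0 else 1 ⊗ₜ D.image i j (-r) := by
  obtain ⟨w, hw, hw'⟩ := exists_integral_seqMul (S' := UbarLoop N) (redLoop N).toRingHom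
    (fun x => redLoop_smul x)
    (τ := taubarLoop (N := N)) (X := rescale taubarLoop) (A₀ := D.upper (UA N))
    (B₀ := D.lower (UA N))
    (α := Matrix.of fun i j => if i = j then D.d • (-D.FC (UA N)) i j else if i < j then
      (-D.FC (UA N)) i j else 0) (P := -D.FC (UA N)) (μ := lam (UA N) N (-D.ε)) (fun r i j => rfl)
    (upperL_apply _ _) (D.upper_sub_lower _)
    (triangular_mul_diag' (fun i j hij => by
      simp [rescale, hij.ne', taubarLoop, taubarA_zero_of_lt hij]) (upperL_zero N _ _))
  refine ⟨w r i j, ?_, ?_⟩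
  · have h1 : D.delta (tbar r i j) = if r = 0 ∧ i = j then 1 + (qA - 1) • inclLoop N (w r i j)
        else (qA - qinvA) • inclLoop N (w r i j) := by
      have := congrFun (congrFun (seqMul_map (inclLoop N).toRingHom (D.upper (UA N)) (D.lower (UA N))
        (lam (UA N) N (-D.ε)) (rescale taubarLoop) r) i) j
      simp only [AlgHom.toRingHom_eq_coe, RingHom.coe_coe, rescale_taubarLoop_map, inclLoop_lam,
        lower_map, upper_map, Matrix.map_apply, hw] at this
      rw [delta, UqLift_tbar]
      refine Eq.trans this.symm ?_
      split_ifs <;> simp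
    rw [tbar_eq_taubar, apply_ite D.delta] at h1
    have hs : ∀ (a : A) (x : Uq N), D.delta (a • x) = a • D.delta x := fun a x =>
      map_smul (D.delta.restrictScalars A) a x
    split_ifs at h1
    · rw [map_add, map_one, add_right_inj, hs] at h1
      exact (smul_cancel qA_sub_one_ne_zero h1).symm
    · rw [hs] at h1
      exact (smul_cancel qA_sub_qinvA_ne_zero h1).symm
  · refine (hw' r i j).trans ?_
    rw [sub_eq_add_neg]
    congr 1
    · rcases r with _ | r
      · simp only [true_and, if_true, Matrix.of_apply]
        rcases lt_trichotomy i j with h | rfl | h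
        · rw [if_neg h.ne, if_pos h, if_neg h.not_gt, Nat.cast_zero, neg_zero, image_zero,
            ← one_smul A ((-D.FC (UA N)) i j)]
          exact redLoop_smul_neg (map_one _) (D.redLoop_FC i j)
        · rw [if_pos rfl, if_neg (lt_irrefl i), Nat.cast_zero, neg_zero, image_zero]
          exact redLoop_smul_neg D.evalOne_d (D.redLoop_FC i i)
        · simp [h, h.ne', h.not_gt]
      · simp only [Nat.add_eq_zero_iff, one_ne_zero, and_false, false_and, if_false]
        rw [lam_pow, neg_mul, ← mul_neg]
        refine (map_mul (redLoop N).toRingHom _ _).trans ?_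
        rw [← D.redLoop_lam_mul, map_mul]
        exact (congrArg (_ * ·) (map_neg (redLoop N).toRingHom (D.FC (UA N) i j))).trans
          (tensor_mul_neg _ _)

end LoopTwist

end Integrality

/-! ### The homomorphisms at q = 1 and the twists for θ and the identity -/

section Specialization

variable {N : ℕ}

namespace LoopTwist

variable (D : LoopTwist N)

theorem UA_le_comap : UA N ≤ (inclLoop N).range.comap (D.delta.restrictScalars A) := by
  refine Algebra.adjoin_le ?_
  rintro _ (⟨r, i, j, rfl⟩ | ⟨r, i, j, rfl⟩)
  · obtain ⟨w, hw, -⟩ := D.exists_delta_tau r i j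
    exact ⟨w, hw⟩
  · obtain ⟨w, hw, -⟩ := D.exists_delta_taubar r i j
    exact ⟨w, hw⟩

/-- The restriction of `delta` to the integral form. -/
def deltaA : UA N →ₐ[A] UALoop N :=
  (AlgEquiv.ofInjective (inclLoop N) (inclLoop_injective N)).symm.toAlgHom.comp
    (((D.delta.restrictScalars A).comp (UA N).val).codRestrict (inclLoop N).range
      fun u => D.UA_le_comap u.2)

theorem inclLoop_deltaA (u : UA N) : inclLoop N (D.deltaA u) = D.delta u :=
  congrArg Subtype.val ((AlgEquiv.ofInjective (inclLoop N) (inclLoop_injective N)).apply_symm_apply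
    ⟨D.delta u, D.UA_le_comap u.2⟩)

/-- The specialization of `delta` at `q = 1`. -/
def deltaBar : Ubar N →ₐ[ℂ] UbarLoop N :=
  Algebra.TensorProduct.lift (Algebra.ofId ℂ _) ((redLoop N).comp D.deltaA)
    fun x y => Algebra.commutes x _

theorem deltaBar_spec (u : UA N) : D.deltaBar (spec N u) = redLoop N (D.deltaA u) := by
  refine (Algebra.TensorProduct.lift_tmul _ _ _ _ _).trans ?_
  exact (congrArg (· * _) (RingHom.map_one _)).trans (one_mul _)

theorem deltaBar_tau (r : ℕ) (i j : Fin N) : D.deltaBar (spec N (tauA r i j)) =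
    spec N (tauA r i j) ⊗ₜ 1 + if r = 0 ∧ i < j then 0 else 1 ⊗ₜ D.image i j r := by
  obtain ⟨w, hw, hw'⟩ := D.exists_delta_tau r i j
  rw [deltaBar_spec, ← hw']
  congr 1
  apply inclLoop_injective
  rw [hw, inclLoop_deltaA]
  rfl

theorem deltaBar_taubar (r : ℕ) (i j : Fin N) : D.deltaBar (spec N (taubarA r i j)) =
    spec N (taubarA r i j) ⊗ₜ 1 - if r = 0 ∧ j < i then 0 else 1 ⊗ₜ D.image i j (-r) := by
  obtain ⟨w, hw, hw'⟩ := D.exists_delta_taubar r i j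
  rw [deltaBar_spec, ← hw']
  congr 1
  apply inclLoop_injective
  rw [hw, inclLoop_deltaA]
  rfl

end LoopTwist

theorem isLinearRTT_neg {Q : Type*} [Ring Q] [Algebra K Q] {A₀ B₀ : Matrix (Fin N) (Fin N) Q}
    (h : IsLinearRTT A₀ B₀) : IsLinearRTT A₀ (-B₀) := by
  have := LinearRTT.smul h (1 : K) (-1)
  simp only [one_smul, neg_smul, ← map_neg] at this
  exact this

theorem isLinearRTT_theta : IsLinearRTT
    (lowerL qinvA (Matrix.of fun i j => -Matrix.single j i (1 : K)))
    (upperL 1 (Matrix.of fun i j : Fin N => Matrix.single j i (1 : K))) := by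
  rw [← blocks_Ru_eq_lowerL, ← neg_blocks_Rv_eq_upperL]
  exact isLinearRTT_neg isLinearRTT_blocks

/-- The twist lifting the automorphism `θ`. -/
def thetaTwist (N : ℕ) : LoopTwist N where
  c := qinvA
  d := 1
  F := Matrix.of fun i j => -Eloop j i 0
  ε := -1
  sum_eq := by linear_combination qA_mul_qinvA
  sub_eq := by push_cast; linear_combination qA_mul_qinvA
  F_diag i := by simp [Eloop]
  evalOne_c := evalOne_T _
  evalOne_d := map_one _
  linear := by
    have := isLinearRTT_theta.map (constMatrix N)
    have e1 := lowerL_map ((constMatrix N).restrictScalars A) qinvA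
      (Matrix.of fun i j => -Matrix.single j i (1 : K))
    have e2 := upperL_map ((constMatrix N).restrictScalars A) 1
      (Matrix.of fun i j => Matrix.single j i (1 : K))
    simp only [AlgHom.coe_restrictScalars'] at e1 e2
    rw [e1, e2] at this
    convert this using 2
    · refine Matrix.ext fun i j => ?_
      exact (TensorProduct.tmul_neg _ _).trans
        (((map_neg (constMatrix N) _).trans (congrArg _ (constMatrix_single N j i))).symm)
    · refine Matrix.ext fun i j => ?_
      refine Eq.trans ?_ (constMatrix_single N j i).symm
      exact (congrArg Neg.neg (TensorProduct.tmul_neg _ _)).trans (neg_neg _)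

/-- The twist lifting the identity. -/
def idTwist (N : ℕ) : LoopTwist N where
  c := 1
  d := qinvA
  F := Matrix.of fun i j => Eloop i j 0
  ε := 1
  sum_eq := by linear_combination qA_mul_qinvA
  sub_eq := by push_cast; linear_combination -qA_mul_qinvA
  F_diag i := by simp [Eloop]
  evalOne_c := map_one _
  evalOne_d := evalOne_T _
  linear := by
    -- Transposing the solution for θ replaces E_{ji} by E_{ij} and exchanges the two matrices,
    -- which also moves q⁻¹ from the lower to the upper diagonal.
    have := isLinearRTT_theta.transpose.map (constMatrix N)
    rw [lowerL_transpose, upperL_transpose] at this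
    have e1 := lowerL_map ((constMatrix N).restrictScalars A) 1
      (Matrix.of fun i j => Matrix.single j i (1 : K)).transpose
    have e2 := upperL_map ((constMatrix N).restrictScalars A) qinvA
      (Matrix.of fun i j => -Matrix.single j i (1 : K)).transpose
    simp only [AlgHom.coe_restrictScalars'] at e1 e2
    rw [e1, e2] at this
    convert this using 2
    · exact Matrix.ext fun i j => (constMatrix_single N i j).symm
    · refine Matrix.ext fun i j => ?_
      exact ((map_neg (constMatrix N) _).trans (congrArg _ (constMatrix_single N i j))).symm

theorem idTwist_image (i j : Fin N) (p : ℤ) : (idTwist N).image i j p = Eloop i j p := by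
  change Matrix.scalar (Fin N) (LaurentPolynomial.T (1 * p)) * Eloop i j 0 = _
  rw [scalar_mul_Eloop, one_mul, add_zero]

theorem thetaTwist_image (i j : Fin N) (p : ℤ) :
    (thetaTwist N).image i j p = theta N (Eloop i j p) := by
  change Matrix.scalar (Fin N) (LaurentPolynomial.T (-1 * p)) * -Eloop j i 0 = _
  rw [mul_neg, scalar_mul_Eloop, theta_Eloop, neg_one_mul, add_zero]

end Specialization

/-! ### Loop algebra relations from the first order ternary relations -/

section SignIdentity

/-- An addition formula for the sign. It is applied to the integers pN + i - j attached to
E_{ij}λ^p, which add up when such elements are multiplied. -/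
theorem sign_identity (x y : ℤ) :
    x.sign * y.sign - (x + y).sign * (x.sign + y.sign) = -1 + if x = 0 ∧ y = 0 then 1 else 0 := by
  rcases lt_trichotomy x 0 with hx | rfl | hx <;> rcases lt_trichotomy y 0 with hy | rfl | hy <;>
  simp [Int.sign_eq_neg_one_of_neg, Int.sign_eq_one_of_pos, *, add_pos, add_neg, ne_of_lt, ne_of_gt]

variable {N : ℕ}

/-- The sign of `E_{ij} λ^p` in the triangular decomposition of the loop algebra. -/
def sg (i j : Fin N) (p : ℤ) : ℤ := (p * N + (i : ℤ) - (j : ℤ)).sign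

theorem sg_of_pos (i j : Fin N) {p : ℤ} (hp : 0 < p) : sg i j p = 1 := by
  have h1 : (N : ℤ) ≤ p * N := by nlinarith [Int.natCast_nonneg N]
  have := j.2
  exact Int.sign_eq_one_of_pos (by lia)

theorem sg_of_neg (i j : Fin N) {p : ℤ} (hp : p < 0) : sg i j p = -1 := by
  have h1 : p * N ≤ -N := by nlinarith [Int.natCast_nonneg N]
  have := i.2
  exact Int.sign_eq_neg_one_of_neg (by lia)

theorem sg_zero (i j : Fin N) :
    sg i j 0 = (if j < i then 1 else 0) - (if i < j then 1 else 0) := by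
  rw [sg]
  rcases lt_trichotomy i j with h | rfl | h
  · rw [Int.sign_eq_neg_one_of_neg (by have := Fin.lt_def.1 h; lia)]
    simp [h, h.not_gt]
  · simp
  · rw [Int.sign_eq_one_of_pos (by have := Fin.lt_def.1 h; lia)]
    simp [h, h.not_gt]

theorem sg_eq_zero_iff (i j : Fin N) (p : ℤ) : p * N + (i : ℤ) - (j : ℤ) = 0 ↔ p = 0 ∧ i = j := by
  constructor
  · intro h
    have hs : sg i j p = 0 := by rw [sg, h, Int.sign_zero]
    rcases lt_trichotomy p 0 with hp | rfl | hp
    · rw [sg_of_neg i j hp] at hs; lia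
    · exact ⟨rfl, Fin.ext (by lia)⟩
    · rw [sg_of_pos i j hp] at hs; lia
  · rintro ⟨rfl, rfl⟩; simp

/-- The sign can jump only between -1, 0 and 1; the jumps match the diagonal and off-diagonal first
order coefficients of the R-matrix. -/
theorem sg_succ_sub (i j : Fin N) (p : ℤ) : sg i j (p + 1) - sg i j p =
    (if p = 0 then 1 else 0) * ((if i = j then 1 else 0) + 2 * (if i < j then 1 else 0)) +
    (if p + 1 = 0 then 1 else 0) * ((if i = j then 1 else 0) + 2 * (if j < i then 1 else 0)) := by
  rcases lt_trichotomy p 0 with hp | rfl | hp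
  · rcases eq_or_ne p (-1) with rfl | hp'
    · rw [neg_add_cancel, sg_zero, sg_of_neg i j hp]
      grind
    · rw [sg_of_neg i j hp, sg_of_neg i j (show p + 1 < 0 by lia)]
      grind
  · rw [zero_add, sg_zero, sg_of_pos i j one_pos]
    grind
  · rw [sg_of_pos i j hp, sg_of_pos i j (show 0 < p + 1 by lia)]
    grind

theorem sg_mul_sg (i j l : Fin N) (a b : ℤ) :
    sg i j a * sg j l b - sg i l (a + b) * (sg i j a + sg j l b) =
      -1 + if (a = 0 ∧ i = j) ∧ (b = 0 ∧ j = l) then 1 else 0 := by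
  rw [sg, sg, sg, show (a + b) * (N : ℤ) + (i : ℤ) - (l : ℤ) =
    (a * N + (i : ℤ) - (j : ℤ)) + (b * N + (j : ℤ) - (l : ℤ)) by ring, sign_identity]
  simp only [sg_eq_zero_iff]

/-- The pairs (a + 1, b) and (a, b + 1) have the same total, so the constants -1 in `sg_mul_sg`
cancel. -/
theorem sg_step (i j l : Fin N) (a b ε ε' : ℤ) :
    (ε + sg i j (a + 1)) * (ε' + sg j l b) - (ε + sg i j a) * (ε' + sg j l (b + 1)) =
      (sg i j (a + 1) - sg i j a) * (ε' + sg i l (a + 1 + b))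
      - (sg j l (b + 1) - sg j l b) * (ε + sg i l (a + 1 + b))
      + (if (a + 1 = 0 ∧ i = j) ∧ (b = 0 ∧ j = l) then 1 else 0)
      - (if (a = 0 ∧ i = j) ∧ (b + 1 = 0 ∧ j = l) then 1 else 0) := by
  have h1 := sg_mul_sg i j l (a + 1) b
  have h2 := sg_mul_sg i j l a (b + 1)
  rw [show a + (b + 1) = a + 1 + b by ring] at h2
  linear_combination h1 - h2

theorem sg_step' (i j k : Fin N) (a b ε ε' : ℤ) :
    (ε + sg i j (a + 1)) * (ε' + sg k i b) - (ε + sg i j a) * (ε' + sg k i (b + 1)) =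
      (sg i j (a + 1) - sg i j a) * (ε' + sg k j (a + 1 + b))
      - (sg k i (b + 1) - sg k i b) * (ε + sg k j (a + 1 + b))
      + (if (b = 0 ∧ k = i) ∧ (a + 1 = 0 ∧ i = j) then 1 else 0)
      - (if (b + 1 = 0 ∧ k = i) ∧ (a = 0 ∧ i = j) then 1 else 0) := by
  have h1 := sg_mul_sg k i j b (a + 1)
  have h2 := sg_mul_sg k i j (b + 1) a
  rw [show b + (a + 1) = a + 1 + b by ring] at h1
  rw [show b + 1 + a = a + 1 + b by ring] at h2
  linear_combination h1 - h2

end SignIdentity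

/-! ### From the first order relation to the loop algebra brackets -/

section Bracket

variable {N : ℕ} {V : Type*} [Ring V]

/-- Elements of the two tensor factors, multiplied by the constant terms of the series. -/
def legSum (X Y : Fin N → Fin N → ℤ → V) (a b : ℤ) (i k j l : Fin N) : V :=
  (if b = 0 then (1 : ℤ) else 0) • (if k = l then (1 : ℤ) else 0) • X i j (a + b) +
  (if a = 0 then (1 : ℤ) else 0) • (if i = j then (1 : ℤ) else 0) • Y k l (a + b)

/-- The leading term at `q = 1` of the ternary relation between two series. -/
def FirstOrderRTT (X Y : Fin N → Fin N → ℤ → V) : Prop :=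
  ∀ (i j k l : Fin N) (a b : ℤ),
    X i j (a + 1) * Y k l b - Y k l b * X i j (a + 1)
      - (X i j a * Y k l (b + 1) - Y k l (b + 1) * X i j a) =
    ((if i = k then (1 : ℤ) else 0) - (if j = l then 1 else 0)) •
      (legSum X Y (a + 1) b i k j l + legSum X Y a (b + 1) i k j l)
    + (2 * if k < i then (1 : ℤ) else 0) • legSum X Y (a + 1) b k i j l
    + (2 * if i < k then (1 : ℤ) else 0) • legSum X Y a (b + 1) k i j l
    - (2 * if j < l then (1 : ℤ) else 0) • legSum X Y (a + 1) b i k l j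
    - (2 * if l < j then (1 : ℤ) else 0) • legSum X Y a (b + 1) i k l j

/-- The defect of the loop algebra relations. -/
def bracketDefect (e : Fin N → Fin N → ℤ → V) (i j k l : Fin N) (a b : ℤ) : V :=
  e i j a * e k l b - e k l b * e i j a
    - ((if j = k then (1 : ℤ) else 0) • e i l (a + b) - (if i = l then (1 : ℤ) else 0) • e k j (a + b))

/-- The weight ε + sg equals 2ε on the half of the loop algebra where sg = ε, ε where sg = 0, and 0
on the opposite half. The sign identities say that the loop brackets solve the first order relation
with these weights; what remains is that the weighted defect is invariant under moving one unit of
degree between the factors. -/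
theorem FirstOrderRTT.step {e : Fin N → Fin N → ℤ → V} {ε ε' : ℤ}
    (h : FirstOrderRTT (fun i j a => (ε + sg i j a) • e i j a)
      (fun i j a => (ε' + sg i j a) • e i j a)) (i j k l : Fin N) (a b : ℤ) :
    ((ε + sg i j (a + 1)) * (ε' + sg k l b)) • bracketDefect e i j k l (a + 1) b =
      ((ε + sg i j a) * (ε' + sg k l (b + 1))) • bracketDefect e i j k l a (b + 1) := by
  have h0 := h i j k l a b
  simp only [legSum, smul_mul_smul_comm] at h0
  rw [show a + (b + 1) = a + 1 + b by ring] at h0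
  rw [mul_comm (ε' + sg k l b), mul_comm (ε' + sg k l (b + 1)), ← smul_sub, ← smul_sub] at h0
  rw [bracketDefect, bracketDefect, show a + (b + 1) = a + 1 + b by ring, smul_sub,
    smul_sub _ (_ - _) (_ - _), sub_eq_sub_iff_sub_eq_sub, h0, ← sub_smul]
  clear h0 h
  have hs := sg_succ_sub i j a
  have hs' := sg_succ_sub k l b
  -- The cases record which of the two terms of [E_{ij}, E_{kl}] survive and which indices coincide
  -- on the right hand side.
  by_cases hjk : j = k
  · subst hjk
    have t1 := sg_step i j l a b ε ε'
    rw [hs, hs'] at t1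
    by_cases hil : i = l
    · subst hil
      have t2 := sg_step' i j j a b ε ε'
      rw [hs, hs'] at t2
      by_cases hij : i = j
      · subst hij
        simp
      · simp only [hij, Ne.symm hij, if_true, if_false, and_false, false_and,
          lt_self_iff_false] at t1 t2 ⊢
        linear_combination (norm := module) (-t1) • e i i (a + 1 + b) + t2 • e j j (a + 1 + b)
    · by_cases hij : i = j
      · subst hij
        simp only [hil, Ne.symm hil, if_true, if_false, and_false, false_and,
          lt_self_iff_false] at t1 ⊢
        linear_combination (norm := module) (-t1) • e i l (a + 1 + b)
      · by_cases hjl : j = l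
        · subst hjl
          simp only [hij, Ne.symm hij, if_true, if_false, and_false, false_and,
          lt_self_iff_false] at t1 ⊢
          linear_combination (norm := module) (-t1) • e i j (a + 1 + b)
        · simp only [hij, hil, hjl, if_true, if_false, and_false, false_and,
          lt_self_iff_false] at t1 ⊢
          linear_combination (norm := module) (-t1) • e i l (a + 1 + b)
  · by_cases hil : i = l
    · subst hil
      have t2 := sg_step' i j k a b ε ε'
      rw [hs, hs'] at t2
      by_cases hij : i = j
      · subst hij
        simp only [hjk, Ne.symm hjk, if_true, if_false, and_false, false_and,
          lt_self_iff_false] at t2 ⊢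
        linear_combination (norm := module) t2 • e k i (a + 1 + b)
      · by_cases hik : i = k
        · subst hik
          simp only [hij, Ne.symm hij, if_true, if_false, and_false, false_and,
          lt_self_iff_false] at t2 ⊢
          linear_combination (norm := module) t2 • e i j (a + 1 + b)
        · simp only [hij, hik, hjk, Ne.symm hik, Ne.symm hij, Ne.symm hjk, if_true, if_false, and_false,
            false_and, lt_self_iff_false] at t2 ⊢
          linear_combination (norm := module) t2 • e k j (a + 1 + b)
    · simp only [hjk, Ne.symm hjk, hil, if_false, smul_zero, zero_smul, add_zero, sub_zero, zero_sub, neg_zero]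
      by_cases hij : i = j
      · subst hij
        simp [hjk, hil, Ne.symm hjk]
      · by_cases hkl : k = l
        · subst hkl
          simp [hil, hjk, Ne.symm hjk]
        · simp [hij, hkl, Ne.symm hjk]

/-- By shift invariance, degree can be moved until the weight of the first factor is zero: to
negative a when ε = 1, to positive a when ε = -1. -/
theorem FirstOrderRTT.smul_bracketDefect_eq_zero {e : Fin N → Fin N → ℤ → V} {ε ε' : ℤ}
    (hε : ε = 1 ∨ ε = -1) (h : FirstOrderRTT (fun i j a => (ε + sg i j a) • e i j a)
      (fun i j a => (ε' + sg i j a) • e i j a)) (i j k l : Fin N) (a b : ℤ) :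
    ((ε + sg i j a) * (ε' + sg k l b)) • bracketDefect e i j k l a b = 0 := by
  set G : ℤ → ℤ → V := fun a b =>
    ((ε + sg i j a) * (ε' + sg k l b)) • bracketDefect e i j k l a b with hG
  have hstep : ∀ a b, G (a + 1) b = G a (b + 1) := h.step i j k l
  have hdown : ∀ (n : ℕ) (a b : ℤ), G (a + n) b = G a (b + n) := by
    intro n
    induction n with
    | zero => simp
    | succ n ih =>
      intro a b
      push_cast
      rw [← add_assoc, hstep, ih, show b + 1 + (n : ℤ) = b + (n + 1) by ring]
  change G a b = 0
  rcases hε with rfl | rfl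
  · have := hdown (a.natAbs + 1) (a - (a.natAbs + 1 : ℕ)) b
    rw [sub_add_cancel] at this
    rw [this]
    simp only [hG]
    rw [sg_of_neg i j (by lia)]
    simp
  · have := hdown (a.natAbs + 1) a (b - (a.natAbs + 1 : ℕ))
    rw [sub_add_cancel] at this
    rw [← this]
    simp only [hG]
    rw [sg_of_pos i j (by lia)]
    simp

theorem bracketDefect_swap (e : Fin N → Fin N → ℤ → V) (i j k l : Fin N) (a b : ℤ) :
    bracketDefect e i j k l a b = -bracketDefect e k l i j b a := by
  simp only [bracketDefect, add_comm b a, eq_comm (a := l) (b := i), eq_comm (a := k) (b := j)]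
  abel

/-- The loop algebra relations follow from the first order ternary relations. -/
theorem bracketDefect_eq_zero [Module.IsTorsionFree ℤ V] {e : Fin N → Fin N → ℤ → V}
    (hpp : FirstOrderRTT (fun i j a => (1 + sg i j a) • e i j a)
      (fun i j a => (1 + sg i j a) • e i j a))
    (hnn : FirstOrderRTT (fun i j a => (-1 + sg i j a) • e i j a)
      (fun i j a => (-1 + sg i j a) • e i j a))
    (hnp : FirstOrderRTT (fun i j a => (-1 + sg i j a) • e i j a)
      (fun i j a => (1 + sg i j a) • e i j a)) (i j k l : Fin N) (a b : ℤ) :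
    bracketDefect e i j k l a b = 0 := by
  have aux : ∀ {c : ℤ} {v : V}, c ≠ 0 → c • v = 0 → v = 0 := fun hc h =>
    (smul_eq_zero.1 h).resolve_left hc
  -- Each factor is taken from the family whose weight is nonzero at its sign. The mixed relation is
  -- available in one order only; the other order follows by antisymmetry.
  rcases lt_or_ge (sg i j a) 0 with h | h <;> rcases lt_or_ge (sg k l b) 0 with h' | h'
  · exact aux (mul_ne_zero (by lia) (by lia))
      (hnn.smul_bracketDefect_eq_zero (Or.inr rfl) i j k l a b)
  · exact aux (mul_ne_zero (by lia) (by lia))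
      (hnp.smul_bracketDefect_eq_zero (Or.inr rfl) i j k l a b)
  · rw [bracketDefect_swap, neg_eq_zero]
    exact aux (mul_ne_zero (by lia) (by lia))
      (hnp.smul_bracketDefect_eq_zero (Or.inr rfl) k l i j b a)
  · exact aux (mul_ne_zero (by lia) (by lia))
      (hpp.smul_bracketDefect_eq_zero (Or.inl rfl) i j k l a b)

end Bracket

/-! ### First order terms of the ternary relation at `q = 1` -/

section FirstOrder

/-- The terms of order 0 and 1 in h cancel since e and f are integers and thus central, so the
relation is divisible by h². -/
theorem first_order_identity {M : Type*} [Ring M] [Algebra A M] {h : A} {ru rv x y x' y' : M}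
    {e₁ f₁ e₂ f₂ : ℤ}
    (H : (1 + h • ru) * ((e₁ • 1 + h • x) * (f₁ • 1 + h • y))
      + (-1 + h • rv) * ((e₂ • 1 + h • x') * (f₂ • 1 + h • y')) =
      (f₁ • 1 + h • y) * (e₁ • 1 + h • x) * (1 + h • ru)
      + (f₂ • 1 + h • y') * (e₂ • 1 + h • x') * (-1 + h • rv)) :
    (h * h) • (x * y - y * x - (x' * y' - y' * x')
      + (ru * (f₁ • x + e₁ • y) - (f₁ • x + e₁ • y) * ru)
      + (rv * (f₂ • x' + e₂ • y') - (f₂ • x' + e₂ • y') * rv)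
      + h • (ru * (x * y) - y * x * ru + rv * (x' * y') - y' * x' * rv)) = 0 := by
  rw [← sub_eq_zero] at H
  rw [← H]
  simp only [mul_add, add_mul, smul_mul_assoc, mul_smul_comm, one_mul, mul_one, neg_mul, mul_neg,
    smul_add, smul_sub, smul_smul, mul_assoc]
  module

variable {N : ℕ} {R R' : Type*} [Ring R] [Ring R']

/-- The matrix with diagonal part `d` and swap part `o`. -/
def swapMatrix (d o : Fin N → Fin N → R) : Matrix (Fin N × Fin N) (Fin N × Fin N) R :=
  Matrix.of fun x y => (if x.1 = y.1 ∧ x.2 = y.2 then d x.1 x.2 else 0)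
    + (if x.1 = y.2 ∧ x.2 = y.1 then o x.1 x.2 else 0)

theorem swapMatrix_mul_apply (d o : Fin N → Fin N → R)
    (W : Matrix (Fin N × Fin N) (Fin N × Fin N) R) (i k : Fin N) (y : Fin N × Fin N) :
    (swapMatrix d o * W) (i, k) y = d i k * W (i, k) y + o i k * W (k, i) y := by
  simp [swapMatrix, Matrix.mul_apply, Fintype.sum_prod_type, add_mul, Finset.sum_add_distrib,
    ite_and, ite_mul]

theorem mul_swapMatrix_apply (d o : Fin N → Fin N → R)
    (W : Matrix (Fin N × Fin N) (Fin N × Fin N) R) (x : Fin N × Fin N) (j l : Fin N) :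
    (W * swapMatrix d o) x (j, l) = W x (j, l) * d j l + W x (l, j) * o l j := by
  simp [swapMatrix, Matrix.mul_apply, Fintype.sum_prod_type, mul_add, Finset.sum_add_distrib,
    ite_and, mul_ite]

theorem map_swapMatrix (φ : R →+* R') (d o : Fin N → Fin N → R) :
    φ.mapMatrix (swapMatrix d o) = swapMatrix (fun i k => φ (d i k)) (fun i k => φ (o i k)) := by
  ext x y
  simp [swapMatrix, apply_ite φ]

theorem map_legOne (φ : R →+* R') (X : Matrix (Fin N) (Fin N) R) :
    φ.mapMatrix (legOne X) = legOne (X.map φ) := by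
  ext ⟨i, k⟩ ⟨j, l⟩
  simp [legOne_apply, apply_ite φ]

theorem map_legTwo (φ : R →+* R') (X : Matrix (Fin N) (Fin N) R) :
    φ.mapMatrix (legTwo X) = legTwo (X.map φ) := by
  ext ⟨i, k⟩ ⟨j, l⟩
  simp [legTwo_apply, apply_ite φ]

/-- The coefficient of `q - 1` in `Ru`. -/
def ruLin (N : ℕ) (R : Type*) [Ring R] [Algebra A R] :
    Matrix (Fin N × Fin N) (Fin N × Fin N) R :=
  swapMatrix (fun i k => algebraMap A R (if i = k then -qinvA else 0))
    (fun i k => algebraMap A R (if k < i then -(1 + qinvA) else 0))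

/-- The coefficient of `q - 1` in `Rv`. -/
def rvLin (N : ℕ) (R : Type*) [Ring R] [Algebra A R] :
    Matrix (Fin N × Fin N) (Fin N × Fin N) R :=
  swapMatrix (fun i k => algebraMap A R (if i = k then -1 else 0))
    (fun i k => algebraMap A R (if i < k then -(1 + qinvA) else 0))

variable {Q : Type*} [Ring Q] [Algebra K Q] [Algebra A Q] [IsScalarTower A K Q]

theorem Ru_eq : Ru N = 1 + (qA - 1) • ruLin N K := by
  have hq := q_ne_zero
  ext ⟨i, k⟩ ⟨j, l⟩
  rw [Matrix.add_apply, Matrix.smul_apply, Algebra.smul_def, Matrix.one_apply, ruLin, swapMatrix,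
    Matrix.of_apply, Ru_apply]
  simp only [du, ou, map_sub, map_one, algebraMap_qA, apply_ite (algebraMap A K), map_neg, map_add,
    algebraMap_qinvA, map_zero, Prod.mk.injEq]
  have h1 : (q - 1) * q⁻¹ = 1 - q⁻¹ := by field_simp
  have h2 : (q - 1) * (1 + q⁻¹) = q - q⁻¹ := by field_simp; ring
  grind

theorem Rv_eq : Rv N = -1 + (qA - 1) • rvLin N K := by
  have hq := q_ne_zero
  ext ⟨i, k⟩ ⟨j, l⟩
  rw [Matrix.add_apply, Matrix.smul_apply, Algebra.smul_def, Matrix.neg_apply, Matrix.one_apply,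
    rvLin, swapMatrix, Matrix.of_apply, Rv_apply]
  simp only [dv, ov, map_sub, map_one, algebraMap_qA, apply_ite (algebraMap A K), map_neg, map_add,
    algebraMap_qinvA, map_zero, Prod.mk.injEq]
  have h2 : (q - 1) * (1 + q⁻¹) = q - q⁻¹ := by field_simp; ring
  grind

theorem RuQ_eq : RuQ N Q = 1 + (qA - 1) • ruLin N Q := by
  have h := congrArg ((Algebra.ofId K Q).restrictScalars A).mapMatrix (Ru_eq (N := N))
  rw [map_add, map_one, map_smul] at h
  refine h.trans ?_
  congr 2
  refine (map_swapMatrix (algebraMap K Q) _ _).trans ?_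
  simp only [← IsScalarTower.algebraMap_apply A K Q]
  rfl

theorem RvQ_eq : RvQ N Q = -1 + (qA - 1) • rvLin N Q := by
  have h := congrArg ((Algebra.ofId K Q).restrictScalars A).mapMatrix (Rv_eq (N := N))
  rw [map_add, map_neg, map_one, map_smul] at h
  refine h.trans ?_
  congr 2
  refine (map_swapMatrix (algebraMap K Q) _ _).trans ?_
  simp only [← IsScalarTower.algebraMap_apply A K Q]
  rfl

variable {U V : Type*} [Ring U] [Algebra A U] [Ring V] [Algebra A V]

theorem map_ruLin (φ : U →ₐ[A] V) : φ.mapMatrix (ruLin N U) = ruLin N V := by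
  refine (map_swapMatrix φ.toRingHom _ _).trans ?_
  simp [ruLin]

theorem map_rvLin (φ : U →ₐ[A] V) : φ.mapMatrix (rvLin N U) = rvLin N V := by
  refine (map_swapMatrix φ.toRingHom _ _).trans ?_
  simp [rvLin]

theorem mapMatrix_legOne (φ : U →ₐ[A] V) (X : Matrix (Fin N) (Fin N) U) :
    φ.mapMatrix (legOne X) = legOne (X.map φ) :=
  map_legOne φ.toRingHom X

theorem mapMatrix_legTwo (φ : U →ₐ[A] V) (X : Matrix (Fin N) (Fin N) U) :
    φ.mapMatrix (legTwo X) = legTwo (X.map φ) :=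
  map_legTwo φ.toRingHom X

theorem qinvA_smul_eq (hV : ∀ v : V, (qA - 1) • v = 0) (v : V) : qinvA • v = v := by
  have : (qinvA : A) = 1 - qinvA * (qA - 1) := by linear_combination qA_mul_qinvA
  rw [this, sub_smul, mul_smul, hV, smul_zero, one_smul, sub_zero]

/-- The left hand side of the first order ternary relation. -/
def firstOrderMatrix (x y x' y' : Matrix (Fin N) (Fin N) U) (e₁ f₁ e₂ f₂ : ℤ) :
    Matrix (Fin N × Fin N) (Fin N × Fin N) U :=
  legOne x * legTwo y - legTwo y * legOne x - (legOne x' * legTwo y' - legTwo y' * legOne x')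
    + (ruLin N U * (f₁ • legOne x + e₁ • legTwo y) - (f₁ • legOne x + e₁ • legTwo y) * ruLin N U)
    + (rvLin N U * (f₂ • legOne x' + e₂ • legTwo y') - (f₂ • legOne x' + e₂ • legTwo y') * rvLin N U)

theorem map_firstOrderMatrix (φ : U →ₐ[A] V) (x y x' y' : Matrix (Fin N) (Fin N) U)
    (e₁ f₁ e₂ f₂ : ℤ) : φ.mapMatrix (firstOrderMatrix x y x' y' e₁ f₁ e₂ f₂) =
      firstOrderMatrix (x.map φ) (y.map φ) (x'.map φ) (y'.map φ) e₁ f₁ e₂ f₂ := by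
  simp only [firstOrderMatrix, map_add, map_sub, map_mul, map_zsmul, mapMatrix_legOne,
    mapMatrix_legTwo, map_ruLin, map_rvLin]

/-- The relation is divided by (q - 1)² in the ℂ(q)-algebra, pulled back along the injection to the
integral form, and then specialized, which kills the remainder. -/
theorem firstOrderMatrix_eq_zero (φ : U →ₐ[A] Q) (hφ : Function.Injective φ) (sp : U →ₐ[A] V)
    (hV : ∀ v : V, (qA - 1) • v = 0) {x y : ℤ → Matrix (Fin N) (Fin N) U}
    (h : RTT (fun m => (if m = 0 then (1 : ℤ) else 0) • 1 + (qA - 1) • (x m).map φ)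
      (fun m => (if m = 0 then (1 : ℤ) else 0) • 1 + (qA - 1) • (y m).map φ)) (m n : ℤ) :
    firstOrderMatrix ((x (m - 1)).map sp) ((y n).map sp) ((x m).map sp) ((y (n - 1)).map sp)
      (if m - 1 = 0 then 1 else 0) (if n = 0 then 1 else 0) (if m = 0 then 1 else 0)
      (if n - 1 = 0 then 1 else 0) = 0 := by
  have H := h m n
  simp only [map_add, map_zsmul, map_one, legOne_smul, legTwo_smul, RuQ_eq, RvQ_eq] at H
  have H' := first_order_identity H
  set Z : Matrix (Fin N × Fin N) (Fin N × Fin N) U :=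
    firstOrderMatrix (x (m - 1)) (y n) (x m) (y (n - 1))
      (if m - 1 = 0 then 1 else 0) (if n = 0 then 1 else 0) (if m = 0 then 1 else 0)
      (if n - 1 = 0 then 1 else 0) + (qA - 1) • (ruLin N U * (legOne (x (m - 1)) * legTwo (y n)) -
        legTwo (y n) * legOne (x (m - 1)) * ruLin N U + rvLin N U *
        (legOne (x m) * legTwo (y (n - 1))) - legTwo (y (n - 1)) * legOne (x m) * rvLin N U) with hZ
  have hZ0 : Z = 0 := by
    have h1 : ((qA - 1) * (qA - 1)) • φ.mapMatrix Z = 0 := by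
      rw [hZ, map_add, map_firstOrderMatrix, map_smul]
      simp only [map_add, map_sub, map_mul, mapMatrix_legOne, mapMatrix_legTwo, map_ruLin, map_rvLin]
      exact H'
    ext p r
    apply hφ
    have h2 := congrFun (congrFun h1 p) r
    rw [Matrix.smul_apply, Matrix.zero_apply, ← smul_zero ((qA - 1) * (qA - 1))] at h2
    have h3 := smul_cancel (mul_ne_zero qA_sub_one_ne_zero qA_sub_one_ne_zero) h2
    rw [Matrix.zero_apply, map_zero]
    exact h3
  have h4 := congrArg sp.mapMatrix hZ0
  have h5 : ∀ M : Matrix (Fin N × Fin N) (Fin N × Fin N) V, (qA - 1) • M = 0 := fun M => by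
    ext p r
    exact hV _
  rw [hZ, map_add, map_smul, h5, add_zero, map_zero, map_firstOrderMatrix] at h4
  exact h4

theorem swap_commutator_apply (hV : ∀ v : V, (qA - 1) • v = 0)
    (W : Matrix (Fin N × Fin N) (Fin N × Fin N) V) (i j k l : Fin N) :
    (ruLin N V * W - W * ruLin N V) (i, k) (j, l) =
      ((if j = l then (1 : ℤ) else 0) - (if i = k then 1 else 0)) • W (i, k) (j, l)
      - (2 * if k < i then (1 : ℤ) else 0) • W (k, i) (j, l)
      + (2 * if j < l then (1 : ℤ) else 0) • W (i, k) (l, j) ∧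
    (rvLin N V * W - W * rvLin N V) (i, k) (j, l) =
      ((if j = l then (1 : ℤ) else 0) - (if i = k then 1 else 0)) • W (i, k) (j, l)
      - (2 * if i < k then (1 : ℤ) else 0) • W (k, i) (j, l)
      + (2 * if l < j then (1 : ℤ) else 0) • W (i, k) (l, j) := by
  have hq : algebraMap A V qinvA = 1 := by
    rw [Algebra.algebraMap_eq_smul_one, qinvA_smul_eq hV]
  have h1 : ∀ (p : Prop) [Decidable p], algebraMap A V (if p then -qinvA else 0) =
      ((-(if p then 1 else 0) : ℤ) : V) := by
    intro p _; split_ifs <;> simp [hq]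
  have h2 : ∀ (p : Prop) [Decidable p], algebraMap A V (if p then -(1 + qinvA) else 0) =
      ((-(2 * if p then 1 else 0) : ℤ) : V) := by
    intro p _
    split_ifs
    · rw [map_neg, map_add, map_one, hq]; push_cast; norm_num
    · simp
  have h3 : ∀ (p : Prop) [Decidable p], algebraMap A V (if p then -1 else 0) =
      ((-(if p then 1 else 0) : ℤ) : V) := by
    intro p _; split_ifs <;> simp
  have h4 : ∀ (z : ℤ) (v : V), v * (z : V) = z • v := fun z v => by
    rw [zsmul_eq_mul, Int.cast_comm]
  constructor
  · rw [Matrix.sub_apply, ruLin, swapMatrix_mul_apply, mul_swapMatrix_apply, h1, h1, h2, h2,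
      ← zsmul_eq_mul, ← zsmul_eq_mul, h4, h4]
    module
  · rw [Matrix.sub_apply, rvLin, swapMatrix_mul_apply, mul_swapMatrix_apply, h3, h3, h2, h2,
      ← zsmul_eq_mul, ← zsmul_eq_mul, h4, h4]
    module

theorem legSum_eq (x y : ℤ → Matrix (Fin N) (Fin N) V) (a b : ℤ) (i k j l : Fin N) :
    legSum (fun i j a => x (-a) i j) (fun i j a => y (-a) i j) a b i k j l =
      ((if b = 0 then (1 : ℤ) else 0) • legOne (x (-a)) + (if a = 0 then (1 : ℤ) else 0) •
        legTwo (y (-b))) (i, k) (j, l) := by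
  simp only [legSum, Matrix.add_apply, Matrix.smul_apply, legOne_apply, legTwo_apply]
  by_cases ha : a = 0 <;> by_cases hb : b = 0 <;> simp [ha, hb]

/-- The index is negated because E_{ij}λ^p corresponds to the coefficient of u^{-p}. -/
theorem firstOrderRTT_of_RTT (φ : U →ₐ[A] Q) (hφ : Function.Injective φ) (sp : U →ₐ[A] V)
    (hV : ∀ v : V, (qA - 1) • v = 0) {x y : ℤ → Matrix (Fin N) (Fin N) U}
    (h : RTT (fun m => (if m = 0 then (1 : ℤ) else 0) • 1 + (qA - 1) • (x m).map φ)
      (fun m => (if m = 0 then (1 : ℤ) else 0) • 1 + (qA - 1) • (y m).map φ)) :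
    FirstOrderRTT (fun i j a => sp (x (-a) i j)) (fun i j a => sp (y (-a) i j)) := by
  intro i j k l a b
  have h0 := congrFun (congrFun (firstOrderMatrix_eq_zero φ hφ sp hV h (-a) (-b)) (i, k)) (j, l)
  rw [firstOrderMatrix, Matrix.add_apply, Matrix.add_apply, (swap_commutator_apply hV _ i j k l).1,
    (swap_commutator_apply hV _ i j k l).2] at h0
  have key := legSum_eq (N := N) (fun m => (x m).map sp) (fun m => (y m).map sp)
  simp only [Matrix.map_apply] at key
  simp only [key]
  have e2 : ∀ c : ℤ, (-c = 0) = (c = 0) := fun c => by simp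
  have e3 : ∀ c : ℤ, -c - 1 = -(c + 1) := fun c => by ring
  simp only [e2, e3, Matrix.sub_apply, legOne_mul_legTwo_apply, legTwo_mul_legOne_apply,
    Matrix.map_apply, Matrix.zero_apply] at h0
  rw [← sub_eq_zero, ← h0]
  module

end FirstOrder

/-! ### The homomorphism `U(ĝl_N) → U_𝒜 ⊗ ℂ` -/

section LoopRelations

variable {N : ℕ}

/-- The matrices `(t^{(r)} - δ_{r0}) / (q - 1)`. -/
def xA (r : ℕ) : Matrix (Fin N) (Fin N) (UA N) :=
  Matrix.of fun i j => if r = 0 ∧ i = j then tauA r i j else (1 + qinvA) • tauA r i j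

/-- The matrices `(t̄^{(r)} - δ_{r0}) / (q - 1)`. -/
def xbarA (r : ℕ) : Matrix (Fin N) (Fin N) (UA N) :=
  Matrix.of fun i j => if r = 0 ∧ i = j then taubarA r i j else (1 + qinvA) • taubarA r i j

theorem qA_sub_one_mul : (qA - 1) * (1 + qinvA) = qA - qinvA := by
  linear_combination qA_mul_qinvA

theorem t_eq_xA (r : ℕ) : (Matrix.of fun i j => t r i j : Matrix (Fin N) (Fin N) (Uq N)) =
    (if r = 0 then (1 : ℤ) else 0) • 1 + (qA - 1) • (xA r).map (UA N).val := by
  ext i j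
  rw [Matrix.of_apply, Matrix.add_apply, Matrix.smul_apply, Matrix.smul_apply, Matrix.map_apply, xA,
    Matrix.of_apply, t_eq_tau, Matrix.one_apply]
  by_cases hr : r = 0 <;> by_cases hij : i = j
  · simp only [hr, hij, true_and, if_true, one_smul]
    rfl
  · simp only [hr, hij, and_false, if_true, if_false, smul_zero, zero_add, map_smul]
    rw [smul_smul, qA_sub_one_mul]
    rfl
  · simp only [hr, false_and, if_false, zero_smul, zero_add, map_smul]
    rw [smul_smul, qA_sub_one_mul]
    rfl
  · simp only [hr, false_and, if_false, zero_smul, zero_add, map_smul]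
    rw [smul_smul, qA_sub_one_mul]
    rfl

theorem tbar_eq_xbarA (r : ℕ) : (Matrix.of fun i j => tbar r i j : Matrix (Fin N) (Fin N) (Uq N)) =
    (if r = 0 then (1 : ℤ) else 0) • 1 + (qA - 1) • (xbarA r).map (UA N).val := by
  ext i j
  rw [Matrix.of_apply, Matrix.add_apply, Matrix.smul_apply, Matrix.smul_apply, Matrix.map_apply,
    xbarA, Matrix.of_apply, tbar_eq_taubar, Matrix.one_apply]
  by_cases hr : r = 0 <;> by_cases hij : i = j
  · simp only [hr, hij, true_and, if_true, one_smul]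
    rfl
  · simp only [hr, hij, and_false, if_true, if_false, smul_zero, zero_add, map_smul]
    rw [smul_smul, qA_sub_one_mul]
    rfl
  · simp only [hr, false_and, if_false, zero_smul, zero_add, map_smul]
    rw [smul_smul, qA_sub_one_mul]
    rfl
  · simp only [hr, false_and, if_false, zero_smul, zero_add, map_smul]
    rw [smul_smul, qA_sub_one_mul]
    rfl

theorem negSeries_t (m : ℤ) :
    negSeries (fun r => (Matrix.of fun i j => t r i j : Matrix (Fin N) (Fin N) (Uq N))) m =
      (if m = 0 then (1 : ℤ) else 0) • 1 + (qA - 1) • (negSeries xA m).map (UA N).val := by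
  rw [negSeries, negSeries]
  split_ifs with h1 h2 h2
  · rw [t_eq_xA, if_pos (by lia)]
  · rw [t_eq_xA, if_neg (by lia)]
  · lia
  · rw [zero_smul, zero_add, Matrix.map_zero _ (map_zero _), smul_zero]

theorem posSeries_tbar (m : ℤ) :
    posSeries (fun r => (Matrix.of fun i j => tbar r i j : Matrix (Fin N) (Fin N) (Uq N))) m =
      (if m = 0 then (1 : ℤ) else 0) • 1 + (qA - 1) • (posSeries xbarA m).map (UA N).val := by
  rw [posSeries, posSeries]
  split_ifs with h1 h2 h2
  · rw [tbar_eq_xbarA, if_pos (by lia)]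
  · rw [tbar_eq_xbarA, if_neg (by lia)]
  · lia
  · rw [zero_smul, zero_add, Matrix.map_zero _ (map_zero _), smul_zero]

theorem Ubar_smul (v : Ubar N) : (qA - 1) • v = 0 := by
  rw [← algebraMap_smul ℂ]
  change evalOne (qA - 1) • v = 0
  rw [evalOne_sub_one, zero_smul]

theorem spec_smul_two (x : UA N) : spec N ((1 + qinvA) • x) = (2 : ℤ) • spec N x := by
  rw [spec_smul, map_add, map_one, evalOne_T]
  module

/-- Expanding t t̄ = 1 and dividing by q - 1 gives τ + τ̄ + (q - 1) τ τ̄ = 0. -/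
theorem spec_taubarA_diag (i : Fin N) : spec N (taubarA 0 i i) = -spec N (tauA 0 i i) := by
  have h := (isRTT_map (AlgHom.id K (Uq N))).t_mul_tbar i
  simp only [Matrix.of_apply, AlgHom.coe_id, id] at h
  rw [t_eq_tau, tbar_eq_taubar, if_pos ⟨rfl, rfl⟩, if_pos ⟨rfl, rfl⟩] at h
  have h2 : (qA - 1) • (tauA 0 i i + taubarA 0 i i + (qA - 1) • (tauA 0 i i * taubarA 0 i i)) =
      (qA - 1) • (0 : UA N) := by
    apply Subtype.ext
    change (qA - 1) • (tau 0 i i + taubar 0 i i + (qA - 1) • (tau 0 i i * taubar 0 i i)) =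
      (qA - 1) • (0 : Uq N)
    rw [smul_zero, ← sub_eq_zero.2 h]
    simp only [mul_add, add_mul, smul_mul_assoc, mul_smul_comm, one_mul, mul_one, smul_add]
    abel
  have h3 : tauA 0 i i + taubarA 0 i i + (qA - 1) • (tauA 0 i i * taubarA 0 i i) = 0 := by
    apply Subtype.ext
    exact smul_cancel (V := Uq N) qA_sub_one_ne_zero (congrArg Subtype.val h2)
  have h4 := congrArg (spec N) h3
  rw [map_add, map_add, map_smul, Ubar_smul, add_zero, map_zero] at h4
  exact (neg_eq_of_add_eq_zero_right h4).symm

/-- The image of `E_{ij} λ^p` in the specialization of `U_𝒜`. -/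
def eBar (i j : Fin N) (p : ℤ) : Ubar N :=
  if 0 < p ∨ (p = 0 ∧ j ≤ i) then spec N (tauA p.natAbs i j) else -spec N (taubarA p.natAbs i j)

/-- The factor 1 + q⁻¹ = (q - q⁻¹)/(q - 1) becomes 2 off the diagonal part, so the weights 2, 1, 0
are exactly 1 + sg. This and `spec_posSeries` express both series through the single family `eBar`.
-/
theorem spec_negSeries (i j : Fin N) (p : ℤ) :
    spec N (negSeries xA (-p) i j) = (1 + sg i j p) • eBar i j p := by
  rcases lt_trichotomy p 0 with hp | rfl | hp
  · rw [negSeries_pos _ (by lia), sg_of_neg _ _ hp]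
    simp
  · have e : negSeries xA (-0) = xA (N := N) 0 := by simp [negSeries]
    rw [e, sg_zero, eBar, xA, Matrix.of_apply]
    rcases lt_trichotomy i j with h | rfl | h
    · simp [h, h.not_gt, h.ne, tauA_zero_of_lt h]
    · simp
    · simp only [h.ne', h.not_gt, h, h.le, and_false, if_true, if_false, true_and, or_true,
        spec_smul_two]
      rfl
  · rw [show -p = -((p.natAbs : ℕ) : ℤ) by lia, negSeries_neg, sg_of_pos _ _ hp, eBar, if_pos (Or.inl hp),
      xA, Matrix.of_apply, if_neg (by lia), spec_smul_two]
    rfl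

theorem spec_posSeries (i j : Fin N) (p : ℤ) :
    spec N (posSeries xbarA (-p) i j) = (-1 + sg i j p) • eBar i j p := by
  rcases lt_trichotomy p 0 with hp | rfl | hp
  · rw [show -p = ((p.natAbs : ℕ) : ℤ) by lia, posSeries_nat, sg_of_neg _ _ hp, eBar,
      if_neg (by lia), xbarA, Matrix.of_apply, if_neg (by lia), spec_smul_two, smul_neg]
    module
  · have e : posSeries xbarA (-0) = xbarA (N := N) 0 := by simp [posSeries]
    rw [e, sg_zero, eBar, xbarA, Matrix.of_apply]
    rcases lt_trichotomy i j with h | rfl | h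
    · simp only [h.ne, h.not_gt, h, h.not_ge, and_false, if_true, if_false, true_and, or_false,
        spec_smul_two, lt_self_iff_false, Int.natAbs_zero]
      module
    · simp [spec_taubarA_diag]
    · simp [h, h.not_gt, h.ne', taubarA_zero_of_lt h]
  · rw [posSeries_neg _ (by lia), sg_of_pos _ _ hp]
    simp

theorem isTorsionFree_int_of_complex {V : Type*} [AddCommGroup V] [Module ℂ V] :
    Module.IsTorsionFree ℤ V := by
  refine .of_smul_eq_zero fun z v h => ?_
  rw [← Int.cast_smul_eq_zsmul ℂ] at h
  exact (smul_eq_zero.1 h).imp_left Int.cast_eq_zero.1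

theorem Ubar_isTorsionFree : Module.IsTorsionFree ℤ (Ubar N) :=
  isTorsionFree_int_of_complex

theorem bracketDefect_eBar (i j k l : Fin N) (a b : ℤ) :
    bracketDefect (eBar (N := N)) i j k l a b = 0 := by
  have := Ubar_isTorsionFree (N := N)
  have H := isRTT_map (AlgHom.id K (Uq N))
  have f := fun {x y : ℤ → Matrix (Fin N) (Fin N) (UA N)}
    (h : RTT (fun m => (if m = 0 then (1 : ℤ) else 0) • 1 + (qA - 1) • (x m).map (UA N).val)
      (fun m => (if m = 0 then (1 : ℤ) else 0) • 1 + (qA - 1) • (y m).map (UA N).val)) =>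
    firstOrderRTT_of_RTT (UA N).val Subtype.val_injective (spec N) Ubar_smul h
  have h1 : RTT (fun m => (if m = 0 then (1 : ℤ) else 0) • 1 + (qA - 1) •
        (negSeries xA m).map (UA N).val)
      (fun m => (if m = 0 then (1 : ℤ) else 0) • 1 + (qA - 1) •
        (negSeries xA m).map (UA N).val) := by
    simp only [← negSeries_t]
    exact H.rtt
  have h2 : RTT (fun m => (if m = 0 then (1 : ℤ) else 0) • 1 + (qA - 1) •
        (posSeries xbarA m).map (UA N).val)
      (fun m => (if m = 0 then (1 : ℤ) else 0) • 1 + (qA - 1) •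
        (posSeries xbarA m).map (UA N).val) := by
    simp only [← posSeries_tbar]
    exact H.rtbartbar
  have h3 : RTT (fun m => (if m = 0 then (1 : ℤ) else 0) • 1 + (qA - 1) •
        (posSeries xbarA m).map (UA N).val)
      (fun m => (if m = 0 then (1 : ℤ) else 0) • 1 + (qA - 1) •
        (negSeries xA m).map (UA N).val) := by
    simp only [← posSeries_tbar, ← negSeries_t]
    exact H.rtbart
  have h1 := f h1
  have h2 := f h2
  have h3 := f h3
  simp only [spec_negSeries, spec_posSeries] at h1 h2 h3
  exact bracketDefect_eq_zero h1 h2 h3 i j k l a b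

end LoopRelations

/-! ### The surjection from the enveloping algebra onto the specialization -/

section LoopHom

attribute [local instance] LieRing.ofAssociativeRing

open UniversalEnvelopingAlgebra

variable {N : ℕ}

theorem loop_induction {p : LoopGL N → Prop} (zero : p 0) (add : ∀ X Y, p X → p Y → p (X + Y))
    (basis : ∀ (c : ℂ) (i j : Fin N) (n : ℤ), p (c • Eloop i j n)) (X : LoopGL N) : p X := by
  induction X using Matrix.induction_on' with
  | h_zero => exact zero
  | h_add X Y hX hY => exact add X Y hX hY
  | h_std_basis i j x =>
    induction x using LaurentPolynomial.induction_on' with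
    | add x y hx hy => rw [Matrix.single_add]; exact add _ _ hx hy
    | C_mul_T n a =>
      have := basis a i j n
      rwa [Eloop, Matrix.smul_single, LaurentPolynomial.smul_eq_C_mul] at this

theorem Eloop_mul_Eloop (i j k l : Fin N) (a b : ℤ) :
    Eloop i j a * Eloop k l b = if j = k then Eloop i l (a + b) else 0 := by
  rw [Eloop, Eloop]
  split_ifs with h
  · subst h
    rw [Matrix.single_mul_single_same, ← LaurentPolynomial.T_add, Eloop]
  · exact Matrix.single_mul_single_of_ne _ _ _ _ h _

/-- The linear map `ĝl_N → U_𝒜 ⊗ ℂ`. -/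
def loopLinear (N : ℕ) : LoopGL N →ₗ[ℂ] Ubar N where
  toFun X := ∑ i, ∑ j, Finsupp.linearCombination ℂ (eBar i j) (X i j).coeff
  map_add' X Y := by
    simp only [Matrix.add_apply, AddMonoidAlgebra.coeff_add, map_add, Finset.sum_add_distrib]
  map_smul' c X := by
    simp only [Matrix.smul_apply, AddMonoidAlgebra.coeff_smul, map_smul, Finset.smul_sum,
      RingHom.id_apply]

theorem loopLinear_Eloop (i j : Fin N) (p : ℤ) : loopLinear N (Eloop i j p) = eBar i j p := by
  change ∑ k, ∑ l, Finsupp.linearCombination ℂ (eBar k l) (Eloop i j p k l).coeff = _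
  rw [Finset.sum_eq_single i, Finset.sum_eq_single j]
  · rw [Eloop, Matrix.single_apply_same, LaurentPolynomial.T, AddMonoidAlgebra.coeff_single,
      Finsupp.linearCombination_single, one_smul]
  · intro l _ hl
    rw [Eloop, Matrix.single_apply_of_ne _ _ _ _ _ (by simp [hl.symm])]
    exact map_zero _
  · simp
  · intro k _ hk
    refine Finset.sum_eq_zero fun l _ => ?_
    rw [Eloop, Matrix.single_apply_of_ne _ _ _ _ _ (by simp [hk.symm])]
    exact map_zero _
  · simp

theorem loopLinear_lie (X Y : LoopGL N) :
    loopLinear N (X * Y - Y * X) =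
      loopLinear N X * loopLinear N Y - loopLinear N Y * loopLinear N X := by
  induction X using loop_induction with
  | zero => simp
  | add X X' hX hX' =>
    rw [add_mul, mul_add, add_sub_add_comm, map_add, hX, hX', map_add, add_mul, mul_add]
    abel
  | basis c i j a =>
    induction Y using loop_induction with
    | zero => simp
    | add Y Y' hY hY' =>
      rw [mul_add, add_mul, add_sub_add_comm, map_add, hY, hY', map_add, mul_add, add_mul]
      abel
    | basis d k l b =>
      have h := bracketDefect_eBar i j k l a b
      rw [bracketDefect, sub_eq_zero] at h
      have h' : loopLinear N (Eloop i j a * Eloop k l b - Eloop k l b * Eloop i j a) =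
          eBar i j a * eBar k l b - eBar k l b * eBar i j a := by
        rw [h, Eloop_mul_Eloop, Eloop_mul_Eloop, map_sub, add_comm b a]
        simp only [eq_comm (a := l) (b := i)]
        congr 1 <;> split_ifs <;> simp [loopLinear_Eloop]
      rw [map_smul, map_smul, loopLinear_Eloop, loopLinear_Eloop, smul_mul_smul_comm,
        smul_mul_smul_comm, smul_mul_smul_comm, smul_mul_smul_comm, mul_comm d c, ← smul_sub,
        ← smul_sub, map_smul, h']

/-- The homomorphism `U(ĝl_N) → B` extending a linear map that respects commutators. -/
def envelopingLift {B : Type*} [Ring B] [Algebra ℂ B] (φ : LoopGL N →ₗ[ℂ] B)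
    (h : ∀ X Y, φ (X * Y - Y * X) = φ X * φ Y - φ Y * φ X) : ULoopGL N →ₐ[ℂ] B :=
  lift ℂ ({ φ with map_lie' := fun {X Y} => h X Y } : LoopGL N →ₗ⁅ℂ⁆ B)

theorem envelopingLift_ι {B : Type*} [Ring B] [Algebra ℂ B] (φ : LoopGL N →ₗ[ℂ] B)
    (h : ∀ X Y, φ (X * Y - Y * X) = φ X * φ Y - φ Y * φ X) (X : LoopGL N) :
    envelopingLift φ h (ι ℂ X) = φ X :=
  lift_ι_apply ℂ _ X

/-- The homomorphism `U(ĝl_N) → U_𝒜 ⊗ ℂ`. -/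
def loopHom (N : ℕ) : ULoopGL N →ₐ[ℂ] Ubar N := envelopingLift (loopLinear N) loopLinear_lie

theorem loopHom_ι (X : LoopGL N) : loopHom N (ι ℂ X) = loopLinear N X :=
  envelopingLift_ι _ loopLinear_lie X

theorem loopHom_EU (i j : Fin N) (p : ℤ) : loopHom N (EU i j p) = eBar i j p := by
  rw [EU, loopHom_ι, loopLinear_Eloop]

theorem loopHom_tau (r : ℕ) (i j : Fin N) (h : ¬(r = 0 ∧ i < j)) :
    loopHom N (EU i j r) = spec N (tauA r i j) := by
  rw [loopHom_EU, eBar, if_pos, Int.natAbs_natCast]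
  rcases Nat.eq_zero_or_pos r with hr | hr
  · exact Or.inr ⟨by simp [hr], not_lt.1 fun h' => h ⟨hr, h'⟩⟩
  · exact Or.inl (by lia)

theorem loopHom_taubar (r : ℕ) (i j : Fin N) (h : ¬(r = 0 ∧ j < i)) :
    loopHom N (EU i j (-r)) = -spec N (taubarA r i j) := by
  rw [loopHom_EU, eBar]
  rcases Nat.eq_zero_or_pos r with rfl | hr
  · rcases lt_or_eq_of_le (not_lt.1 fun h' => h ⟨rfl, h'⟩ : i ≤ j) with h' | rfl
    · rw [if_neg (by simp [h'])]
      rfl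
    · rw [if_pos (by simp), spec_taubarA_diag, neg_neg]
      rfl
  · rw [if_neg (by lia), Int.natAbs_neg, Int.natAbs_natCast]

theorem spec_mem_range (u : UA N) : spec N u ∈ (loopHom N).range := by
  obtain ⟨u, hu⟩ := u
  have : ∀ v ∈ UA N, ∀ hv : v ∈ UA N, spec N ⟨v, hv⟩ ∈ (loopHom N).range := by
    intro v hv
    refine Algebra.adjoin_induction (p := fun v _ => ∀ hv : v ∈ UA N,
      spec N ⟨v, hv⟩ ∈ (loopHom N).range) ?_ ?_ ?_ ?_ hv
    · rintro v (⟨r, i, j, rfl⟩ | ⟨r, i, j, rfl⟩) hv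
      · change spec N (tauA r i j) ∈ _
        by_cases h : r = 0 ∧ i < j
        · rw [h.1, tauA_zero_of_lt h.2, map_zero]
          exact zero_mem _
        · exact ⟨_, loopHom_tau r i j h⟩
      · change spec N (taubarA r i j) ∈ _
        by_cases h : r = 0 ∧ j < i
        · rw [h.1, taubarA_zero_of_lt h.2, map_zero]
          exact zero_mem _
        · exact ⟨-EU i j (-r), (map_neg (loopHom N) _).trans (by rw [loopHom_taubar r i j h, neg_neg])⟩
    · intro a hv
      have : spec N ⟨algebraMap A (Uq N) a, hv⟩ = evalOne a • spec N 1 := by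
        rw [← spec_smul]
        congr 1
        apply Subtype.ext
        exact Algebra.algebraMap_eq_smul_one a
      rw [this, map_one]
      exact Subalgebra.smul_mem _ (one_mem _) _
    · intro x y hx hy h1 h2 hv
      have := add_mem (h1 hx) (h2 hy)
      rwa [← map_add] at this
    · intro x y hx hy h1 h2 hv
      have := mul_mem (h1 hx) (h2 hy)
      rwa [← map_mul] at this
  exact this u hu hu

theorem loopHom_surjective : Function.Surjective (loopHom N) := by
  intro v
  change v ∈ (loopHom N).range
  induction v using TensorProduct.induction_on with
  | zero => exact zero_mem _
  | add x y hx hy => exact add_mem hx hy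
  | tmul c u =>
    have : c ⊗ₜ[A] u = c • spec N u := by
      rw [spec, Algebra.TensorProduct.includeRight_apply, TensorProduct.smul_tmul', smul_eq_mul,
        mul_one]
    rw [this]
    exact Subalgebra.smul_mem _ (spec_mem_range u) _

end LoopHom

/-! ### The counit and nontriviality of the specialization -/

section Counit

variable {N : ℕ}

theorem isRTT_one : IsRTT (fun r => if r = 0 then (1 : Matrix (Fin N) (Fin N) K) else 0)
    (fun r => if r = 0 then 1 else 0) := by
  have hn : negSeries (fun r => if r = 0 then (1 : Matrix (Fin N) (Fin N) K) else 0) =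
      fun m => if m = 0 then 1 else 0 := by
    funext m
    simp only [negSeries, Int.natAbs_eq_zero]
    grind
  have hp : posSeries (fun r => if r = 0 then (1 : Matrix (Fin N) (Fin N) K) else 0) =
      fun m => if m = 0 then 1 else 0 := by
    funext m
    simp only [posSeries, Int.natAbs_eq_zero]
    grind
  have h : RTT (fun m => if m = 0 then (1 : Matrix (Fin N) (Fin N) K) else 0)
      (fun m => if m = 0 then 1 else 0) := by
    intro m n
    simp only [apply_ite legOne, apply_ite legTwo, map_one, map_zero]
    split_ifs <;> simp
  constructor
  · intro i j hij
    simp [hij.ne]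
  · intro i j hij
    simp [hij.ne']
  · simp
  · simp
  · rwa [hn]
  · rwa [hp]
  · rwa [hn, hp]

/-- The counit of `U_q(ĝl_N)`. -/
def counit (N : ℕ) : Uq N →ₐ[K] K := UqLift isRTT_one

theorem counit_tau (r : ℕ) (i j : Fin N) : counit N (tau r i j) = 0 := by
  rw [tau]
  split_ifs with h
  · rw [map_smul, map_sub, counit, UqLift_t, map_one, if_pos h.1, h.2, Matrix.one_apply_eq, sub_self,
      smul_zero]
  · rw [map_smul, counit, UqLift_t]
    by_cases hr : r = 0
    · rw [if_pos hr, Matrix.one_apply_ne fun hij => h ⟨hr, hij⟩, smul_zero]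
    · rw [if_neg hr, Matrix.zero_apply, smul_zero]

theorem counit_taubar (r : ℕ) (i j : Fin N) : counit N (taubar r i j) = 0 := by
  rw [taubar]
  split_ifs with h
  · rw [map_smul, map_sub, counit, UqLift_tbar, map_one, if_pos h.1, h.2, Matrix.one_apply_eq,
      sub_self, smul_zero]
  · rw [map_smul, counit, UqLift_tbar]
    by_cases hr : r = 0
    · rw [if_pos hr, Matrix.one_apply_ne fun hij => h ⟨hr, hij⟩, smul_zero]
    · rw [if_neg hr, Matrix.zero_apply, smul_zero]

theorem UA_le_comap_counit :
    UA N ≤ (Algebra.ofId A K).range.comap ((counit N).restrictScalars A) := by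
  refine Algebra.adjoin_le ?_
  rintro _ (⟨r, i, j, rfl⟩ | ⟨r, i, j, rfl⟩)
  · exact ⟨0, (map_zero _).trans (counit_tau r i j).symm⟩
  · exact ⟨0, (map_zero _).trans (counit_taubar r i j).symm⟩

/-- The counit of the integral form. -/
def counitA (N : ℕ) : UA N →ₐ[A] A :=
  (AlgEquiv.ofInjective (Algebra.ofId A K) (IsFractionRing.injective A K)).symm.toAlgHom.comp
    ((((counit N).restrictScalars A).comp (UA N).val).codRestrict (Algebra.ofId A K).range
      fun u => UA_le_comap_counit u.2)

/-- The counit of the specialization at `q = 1`. -/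
def counitBar (N : ℕ) : Ubar N →ₐ[ℂ] ℂ :=
  Algebra.TensorProduct.lift (AlgHom.id ℂ ℂ) ((Algebra.ofId A ℂ).comp (counitA N))
    fun _ _ => Commute.all _ _

/-- The only lower bound on the specialization that the injectivity of `loopHom` needs. -/
instance nontrivial_Ubar : Nontrivial (Ubar N) := (counitBar N).toRingHom.domain_nontrivial

end Counit

/-! ### Injectivity of `loopHom` and of the map from the fixed point enveloping algebra -/

section ClassicalLimit

attribute [local instance] LieRing.ofAssociativeRing

open UniversalEnvelopingAlgebra

variable {N : ℕ}

/-- A homomorphism out of `U(L)` that intertwines the coactions on generators intertwines them. -/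
theorem coaction_comp {L G B : Type*} [LieRing L] [LieAlgebra ℂ L] [Ring G] [Algebra ℂ G] [Ring B]
    [Algebra ℂ B] (f : L →ₗ⁅ℂ⁆ G) (φ : UniversalEnvelopingAlgebra ℂ L →ₐ[ℂ] B)
    (δ : B →ₐ[ℂ] B ⊗[ℂ] G) (h : ∀ X, δ (φ (ι ℂ X)) = φ (ι ℂ X) ⊗ₜ 1 + 1 ⊗ₜ f X)
    (u : UniversalEnvelopingAlgebra ℂ L) :
    δ (φ u) = φ.toLinearMap.rTensor G (coaction f u) := by
  have e : δ.comp φ = (Algebra.TensorProduct.map φ (AlgHom.id ℂ G)).comp (coaction f) := by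
    apply UniversalEnvelopingAlgebra.hom_ext
    ext X
    change δ (φ (ι ℂ X)) = Algebra.TensorProduct.map φ (AlgHom.id ℂ G) (coaction f (ι ℂ X))
    rw [coaction_ι, h, map_add, Algebra.TensorProduct.map_tmul, Algebra.TensorProduct.map_tmul,
      map_one φ]
    rfl
  exact DFunLike.congr_fun e u

theorem LoopTwist.deltaBar_eBar (D : LoopTwist N) (i j : Fin N) (p : ℤ) :
    D.deltaBar (eBar i j p) = eBar i j p ⊗ₜ 1 + 1 ⊗ₜ D.image i j p := by
  rw [eBar]
  split_ifs with h
  · rw [D.deltaBar_tau, if_neg (by grind)]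
    congr 3
    grind
  · refine (map_neg D.deltaBar _).trans ?_
    rw [D.deltaBar_taubar, if_neg (by grind), TensorProduct.neg_tmul]
    refine (neg_sub _ _).trans ((sub_eq_neg_add _ _).trans ?_)
    congr 3
    grind

theorem LoopTwist.deltaBar_loopHom (D : LoopTwist N) (f : LoopGL N →ₗ⁅ℂ⁆ LoopGL N)
    (hf : ∀ i j p, f (Eloop i j p) = D.image i j p) (u : ULoopGL N) :
    D.deltaBar (loopHom N u) = (loopHom N).toLinearMap.rTensor (LoopGL N) (coaction f u) := by
  have key : ∀ X, D.deltaBar (loopLinear N X) = loopLinear N X ⊗ₜ 1 + 1 ⊗ₜ f X := by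
    intro X
    induction X using loop_induction with
    | zero => simp
    | add X Y hX hY => simp only [map_add, hX, hY, TensorProduct.add_tmul, TensorProduct.tmul_add]; abel
    | basis c i j n =>
      rw [map_smul, map_smul, map_smul, loopLinear_Eloop, D.deltaBar_eBar, hf, smul_add,
        TensorProduct.tmul_smul, TensorProduct.smul_tmul']
  exact coaction_comp f (loopHom N) D.deltaBar (fun X => by rw [loopHom_ι, key]) u

/-- The coaction criterion with f the identity: `deltaBar` of the identity twist is the required map
on the target. -/
theorem loopHom_injective : Function.Injective (loopHom N) := by
  refine injective_of_coaction (LieHom.id : LoopGL N →ₗ⁅ℂ⁆ LoopGL N) LinearMap.id (fun _ => rfl)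
    (loopHom N).toLinearMap (idTwist N).deltaBar.toLinearMap
    (fun u => (idTwist N).deltaBar_loopHom LieHom.id (fun i j p => (idTwist_image i j p).symm) u) ?_
  change loopHom N 1 ≠ 0
  rw [map_one]
  exact one_ne_zero

/-- The identification of `U_𝒜 ⊗ ℂ` with `U(ĝl_N)`. -/
def classicalLimit (N : ℕ) : Ubar N ≃ₐ[ℂ] ULoopGL N :=
  (AlgEquiv.ofBijective (loopHom N) ⟨loopHom_injective, loopHom_surjective⟩).symm

theorem classicalLimit_eq_iff (x : Ubar N) (u : ULoopGL N) :
    classicalLimit N x = u ↔ x = loopHom N u :=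
  AlgEquiv.symm_apply_eq _

theorem loopHom_classicalLimit (x : Ubar N) : loopHom N (classicalLimit N x) = x :=
  ((classicalLimit_eq_iff x _).1 rfl).symm

theorem isClassicalLimit_classicalLimit : IsClassicalLimit (classicalLimit N) := by
  constructor
  · intro r i j h
    rw [classicalLimit_eq_iff, loopHom_tau r i j h]
    rfl
  · intro r i j h
    rw [classicalLimit_eq_iff]
    refine Eq.symm ((map_neg (loopHom N) _).trans ?_)
    rw [loopHom_taubar r i j h, neg_neg]
    rfl

theorem theta_theta (X : LoopGL N) : theta N (theta N X) = X := by
  refine Matrix.ext fun i j => ?_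
  change -LaurentPolynomial.invert (-LaurentPolynomial.invert (X i j)) = X i j
  rw [map_neg, neg_neg, LaurentPolynomial.involutive_invert]

theorem fixedEnvelopingMap_ι (X : fixedLoopGL N) :
    fixedEnvelopingMap N (ι ℂ X) = ι ℂ (X : LoopGL N) :=
  lift_ι_apply ℂ _ X

/-- The projection of `ĝl_N` onto the fixed point subalgebra. -/
def fixedProjection (N : ℕ) : LoopGL N →ₗ[ℂ] fixedLoopGL N :=
  ((1 / 2 : ℂ) • (LinearMap.id + (theta N : LoopGL N →ₗ[ℂ] LoopGL N))).codRestrict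
    (fixedLoopGL N).toSubmodule fun X => by
      change theta N ((1 / 2 : ℂ) • (X + theta N X)) = (1 / 2 : ℂ) • (X + theta N X)
      rw [map_smul, map_add, theta_theta, add_comm]

theorem fixedProjection_coe (X : fixedLoopGL N) : fixedProjection N X = X := by
  apply Subtype.ext
  have h : theta N X = X := X.2
  change (1 / 2 : ℂ) • ((X : LoopGL N) + theta N X) = X
  rw [h, ← two_smul ℂ, smul_smul]
  norm_num

/-- The coaction criterion again, now with f the inclusion of the fixed points and κ the averaging
projection. That 1 ≠ 0 in U(ĝl_N) is seen through `loopHom`. -/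
theorem fixedEnvelopingMap_injective : Function.Injective (fixedEnvelopingMap N) := by
  refine injective_of_coaction ((fixedLoopGL N).incl : fixedLoopGL N →ₗ⁅ℂ⁆ LoopGL N)
    (fixedProjection N) fixedProjection_coe (fixedEnvelopingMap N).toLinearMap
    (coaction (LieHom.id : LoopGL N →ₗ⁅ℂ⁆ LoopGL N)).toLinearMap ?_ ?_
  · refine coaction_comp _ (fixedEnvelopingMap N) (coaction LieHom.id) fun X => ?_
    rw [fixedEnvelopingMap_ι, coaction_ι]
    rfl
  · intro h
    have h' := congrArg (loopHom N) h
    change loopHom N (fixedEnvelopingMap N 1) = loopHom N 0 at h'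
    rw [map_one, map_one, map_zero] at h'
    exact one_ne_zero h'

end ClassicalLimit

/-! ### Products of transformed series -/

section SeriesProducts

open PowerSeries

variable {Q : Type*} [Ring Q] {N : ℕ}

theorem one_sub_C_mul_X_cancel {μ : Q} {g h : Q⟦X⟧} (e : (1 - C μ * X) * g = (1 - C μ * X) * h) :
    g = h := by
  ext n
  induction n with
  | zero => simpa [sub_mul, mul_assoc, coeff_zero_eq_constantCoeff] using congrArg (coeff 0) e
  | succ n ih =>
    have := congrArg (coeff (n + 1)) e
    simpa only [sub_mul, one_mul, mul_assoc, map_sub, coeff_C_mul, coeff_succ_X_mul, ih,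
      sub_left_inj] using this

theorem commute_C_mul_X {μ : Q} (hμ : μ ∈ Subring.center Q) (g : Q⟦X⟧) :
    Commute (1 - C μ * X) g := by
  refine (Commute.one_left g).sub_left (Commute.mul_left ?_ (commute_X g).symm)
  ext n
  rw [coeff_C_mul, coeff_mul_C, (Subring.mem_center_iff.1 hμ _)]

theorem one_sub_mul_mk_seqMul {A B : Matrix (Fin N) (Fin N) Q} {μ : Q}
    (hμ : μ ∈ Subring.center Q) (X : ℕ → Matrix (Fin N) (Fin N) Q) (i j : Fin N) :
    (1 - C μ * PowerSeries.X) * mk (fun r => seqMul A B μ X r i j) =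
      ∑ b, mk (fun r => X r i b) * (C (A b j) - PowerSeries.X * C (μ * B b j)) := by
  ext n
  simp only [map_sum, sub_mul, mul_sub, one_mul, mul_assoc, map_sub, coeff_C_mul, coeff_mul_C,
    Finset.sum_sub_distrib]
  simp only [← mul_assoc, coeff_mul_C, coeff_mk]
  cases n with
  | zero => simp [seqMul, Matrix.mul_apply]
  | succ n =>
    simp only [seqMul, coeff_succ_X_mul, coeff_succ_mul_X, coeff_mk, Matrix.add_apply,
      Matrix.smul_apply, Matrix.sub_apply, Matrix.mul_apply, smul_eq_mul, mul_sub, Finset.mul_sum]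
    have : ∀ b, X n i b * μ = μ * X n i b := fun b => Subring.mem_center_iff.1 hμ _
    simp only [← mul_assoc, this]
    abel

/-- The matrix products of two pairs of `L`-transformed series agree. -/
theorem sum_seqMul_mul_seqMul {A B : Matrix (Fin N) (Fin N) Q} {w z : Q}
    (hw : w ∈ Subring.center Q) (hz : z ∈ Subring.center Q) (X Y : ℕ → Matrix (Fin N) (Fin N) Q)
    (hA : ∀ r i j k l, Commute (A i j) (Y r k l)) (hB : ∀ r i j k l, Commute (B i j) (Y r k l))
    (hAB : ∀ b c, ∑ a, A b a * B c a = ∑ a, B a b * A a c)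
    (hBA : ∀ b c, ∑ a, B b a * A c a = ∑ a, A a b * B a c)
    (hAA : ∀ b c, ∑ a, A b a * A c a = ∑ a, A a b * A a c)
    (hBB : ∀ b c, ∑ a, B b a * B c a = ∑ a, B a b * B a c) (r : ℕ) (i j : Fin N) :
    ∑ a, ∑ p ∈ Finset.HasAntidiagonal.antidiagonal r,
        seqMul B.transpose A.transpose z X p.1 i a * seqMul A.transpose B.transpose w Y p.2 j a =
      ∑ a, ∑ p ∈ Finset.HasAntidiagonal.antidiagonal r,
        seqMul A B w X p.1 i a * seqMul B A z Y p.2 j a := by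
  set P : Matrix (Fin N) (Fin N) Q⟦X⟧ :=
    Matrix.of fun b a => C (A b a) - PowerSeries.X * C (w * B b a) with hP
  set P' : Matrix (Fin N) (Fin N) Q⟦X⟧ :=
    Matrix.of fun b a => C (B b a) - PowerSeries.X * C (z * A b a) with hP'
  have cw := Subring.mem_center_iff.1 hw
  have cz := Subring.mem_center_iff.1 hz
  have comm : ∀ (x : Q), (∀ r k l, Commute x (Y r k l)) → ∀ k l,
      Commute (C x) (mk fun r => Y r k l) := by
    intro x hx k l
    ext n
    rw [coeff_C_mul, coeff_mul_C, coeff_mk, (hx n k l).eq]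
  have hPc : ∀ b a k l, Commute (P b a) (mk fun r => Y r k l) := fun b a k l =>
    (comm _ (fun r k l => hA r _ _ k l) k l).sub_left ((commute_X _).symm.mul_left
      (comm _ (fun r k l => Commute.mul_left (cw _).symm (hB r _ _ k l)) k l))
  have hPc' : ∀ b a k l, Commute (P' b a) (mk fun r => Y r k l) := fun b a k l =>
    (comm _ (fun r k l => hB r _ _ k l) k l).sub_left ((commute_X _).symm.mul_left
      (comm _ (fun r k l => Commute.mul_left (cz _).symm (hA r _ _ k l)) k l))
  -- The four coefficientwise commutations combine to one for the linear polynomials P = A - wBX and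
  -- P' = B - zAX.
  have hPP : ∀ b c, ∑ a, P b a * P' c a = ∑ a, P' a b * P a c := by
    have expand : ∀ a₀ a₁ b₀ b₁ : Q, (C a₀ - PowerSeries.X * C a₁) * (C b₀ - PowerSeries.X * C b₁) =
        C (a₀ * b₀) - PowerSeries.X * (C (a₁ * b₀) + C (a₀ * b₁)) +
          PowerSeries.X * (PowerSeries.X * C (a₁ * b₁)) := by
      intro a₀ a₁ b₀ b₁
      have : C a₀ * (PowerSeries.X * C b₁) = PowerSeries.X * (C a₀ * C b₁) := by
        rw [← mul_assoc, (commute_X (C a₀)).eq, mul_assoc]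
      have h' : C a₁ * (PowerSeries.X * C b₁) = PowerSeries.X * (C a₁ * C b₁) := by
        rw [← mul_assoc, (commute_X (C a₁)).eq, mul_assoc]
      simp only [sub_mul, mul_sub, map_mul, mul_assoc, this, h', mul_add]
      abel
    have e1 : ∀ x y : Q, x * (w * y) = w * (x * y) := fun x y => by rw [← mul_assoc, cw, mul_assoc]
    have e2 : ∀ x y : Q, x * (z * y) = z * (x * y) := fun x y => by rw [← mul_assoc, cz, mul_assoc]
    have f1 : ∀ b c a, w * B b a * (z * A c a) = w * z * (B b a * A c a) := fun b c a => by
      rw [e2, mul_assoc, ← mul_assoc z, cw z, mul_assoc w]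
    have f2 : ∀ b c a, z * A a b * (w * B a c) = w * z * (A a b * B a c) := fun b c a => by
      rw [e1, mul_assoc z, ← mul_assoc w]
    intro b c
    simp only [hP, hP', Matrix.of_apply, expand, Finset.sum_add_distrib, Finset.sum_sub_distrib,
      ← Finset.mul_sum, ← map_sum, f1, f2, e1 (B _ _), e2 (A _ _), mul_assoc w (B _ _),
      mul_assoc z (A _ _), hAB, hBA, hAA, hBB]
    rw [add_comm (C (w * _)) (C (z * _))]
  have lift : ∀ {F G H : Matrix (Fin N) (Fin N) Q⟦X⟧} (_ : ∀ b a k l,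
      Commute (F b a) (mk fun r => Y r k l)) (_ : ∀ b c, ∑ a, F b a * G c a = H b c)
      {x y : Fin N → Q⟦X⟧} {f g : Q⟦X⟧} (_ : ∀ x, Commute g x)
      (_ : ∀ a, f * x a = ∑ b, mk (fun r => X r i b) * F b a)
      (_ : ∀ a, g * y a = ∑ c, mk (fun r => Y r j c) * G c a),
      f * (g * ∑ a, x a * y a) =
        ∑ b, ∑ c, mk (fun r => X r i b) * (mk (fun r => Y r j c) * H b c) := by
    intro F G H hF hH x y f g hg hx hy
    have : ∀ a, f * (g * (x a * y a)) =
        ∑ b, ∑ c, mk (fun r => X r i b) * (mk (fun r => Y r j c) * (F b a * G c a)) := by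
      intro a
      rw [← mul_assoc g, (hg (x a)).eq, mul_assoc, hy, ← mul_assoc, hx, Finset.sum_mul_sum]
      refine Finset.sum_congr rfl fun b _ => Finset.sum_congr rfl fun c _ => ?_
      rw [mul_assoc, ← mul_assoc (F b a), (hF b a j c).eq, mul_assoc]
    rw [Finset.mul_sum, Finset.mul_sum, Finset.sum_congr rfl fun a _ => this a, Finset.sum_comm]
    refine Finset.sum_congr rfl fun b _ => ?_
    rw [Finset.sum_comm]
    refine Finset.sum_congr rfl fun c _ => ?_
    rw [← Finset.mul_sum, ← Finset.mul_sum, hH]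
  have h1 := lift (G := P') hPc (fun b c => rfl) (fun x => commute_C_mul_X hz x)
    (fun a => one_sub_mul_mk_seqMul (A := A) (B := B) hw X i a)
    (fun a => one_sub_mul_mk_seqMul (A := B) (B := A) hz Y j a)
  have h2 := lift (F := P'.transpose) (G := P.transpose) (fun b a => hPc' a b)
    (fun b c => (hPP b c).symm) (fun x => commute_C_mul_X hw x)
    (fun a => one_sub_mul_mk_seqMul (A := B.transpose) (B := A.transpose) hz X i a)
    (fun a => one_sub_mul_mk_seqMul (A := A.transpose) (B := B.transpose) hw Y j a)
  -- Both products have the denominator (1 - wX)(1 - zX); by `hPP` the numerators agree, and the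
  -- denominator can be cancelled.
  rw [← mul_assoc, (commute_C_mul_X hz _).eq, mul_assoc] at h2
  have h3 := one_sub_C_mul_X_cancel (one_sub_C_mul_X_cancel (h2.trans h1.symm))
  have h4 := congrArg (coeff r) h3
  simpa only [map_sum, coeff_mul, coeff_mk] using h4

end SeriesProducts

/-! ### Agreement of the two quantum homomorphisms on the twisted q-Yangian -/

section Reflection

variable {N : ℕ}

theorem thetaTwist_lower : (thetaTwist N).lower (Uq N) = (blocks (Ru N)).map (constMatrix N) := by
  have e := lowerL_map ((constMatrix N).restrictScalars A) qinvA
    (Matrix.of fun i j => -Matrix.single j i (1 : K))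
  simp only [AlgHom.coe_restrictScalars'] at e
  rw [blocks_Ru_eq_lowerL, e, LoopTwist.lower]
  change lowerL qinvA _ = _
  congr 1
  refine Matrix.ext fun i j => ?_
  exact (TensorProduct.tmul_neg _ _).trans
    (((map_neg (constMatrix N) _).trans (congrArg _ (constMatrix_single N j i))).symm)

theorem thetaTwist_upper :
    (thetaTwist N).upper (Uq N) = (-blocks (Rv N)).map (constMatrix N) := by
  have e := upperL_map ((constMatrix N).restrictScalars A) 1
    (Matrix.of fun i j => Matrix.single j i (1 : K))
  simp only [AlgHom.coe_restrictScalars'] at e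
  rw [neg_blocks_Rv_eq_upperL, e, LoopTwist.upper]
  change upperL 1 _ = _
  congr 1
  refine Matrix.ext fun i j => ?_
  refine Eq.trans ?_ (constMatrix_single N j i).symm
  exact (congrArg Neg.neg (TensorProduct.tmul_neg _ _)).trans (neg_neg _)

theorem idTwist_lower : (idTwist N).lower (Uq N) = ((thetaTwist N).upper (Uq N)).transpose := by
  rw [LoopTwist.upper, upperL_transpose, LoopTwist.lower]
  change lowerL 1 _ = lowerL 1 _
  congr 1
  refine Matrix.ext fun i j => ?_
  exact ((congrArg Neg.neg (TensorProduct.tmul_neg _ _)).trans (neg_neg _)).symm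

theorem idTwist_upper : (idTwist N).upper (Uq N) = ((thetaTwist N).lower (Uq N)).transpose := by
  rw [LoopTwist.lower, lowerL_transpose, LoopTwist.upper]
  change upperL qinvA _ = upperL qinvA _
  congr 1
  refine Matrix.ext fun i j => ?_
  exact (TensorProduct.tmul_neg _ _).symm

theorem sum_map_mul {S Q : Type*} [Ring S] [Ring Q] (φ : S →+* Q)
    {F G F' G' : Matrix (Fin N) (Fin N) S} {b c : Fin N}
    (h : ∑ a, F b a * G c a = ∑ a, F' a b * G' a c) :
    ∑ a, F.map φ b a * G.map φ c a = ∑ a, F'.map φ a b * G'.map φ a c := by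
  simpa using congrArg φ h

theorem delta_s (D : LoopTwist N) (r : ℕ) (i j : Fin N) : D.delta (s r i j) =
    ∑ a, ∑ p ∈ Finset.HasAntidiagonal.antidiagonal r,
      seqMul (D.lower (Uq N)) (D.upper (Uq N)) (lam (Uq N) N D.ε) tLoop p.1 i a *
        seqMul (D.upper (Uq N)) (D.lower (Uq N)) (lam (Uq N) N (-D.ε)) tbarLoop p.2 j a := by
  simp only [s, map_sum, map_mul, LoopTwist.delta, UqLift_t, UqLift_tbar]

/-- The identity twist multiplies by the transposes of the matrices of the θ twist, with the inverse
power of λ. In T(u) T̄(u⁻¹)ᵗ the two multipliers meet in the middle, where `blocks_Ru_mul_Rv` and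
its companions let one order be replaced by the other. -/
theorem delta_s_eq (r : ℕ) (i j : Fin N) :
    (idTwist N).delta (s r i j) = (thetaTwist N).delta (s r i j) := by
  rw [delta_s, delta_s, idTwist_lower, idTwist_upper]
  refine sum_seqMul_mul_seqMul (lam_mem_center _ _) (lam_mem_center _ _) tLoop tbarLoop
    (fun r i j k l => LoopTwist.lower_commute _ i j _)
    (fun r i j k l => LoopTwist.upper_commute _ i j _) ?_ ?_ ?_ ?_ r i j
  all_goals
    intro b c
    simp only [thetaTwist_lower, thetaTwist_upper]
    refine sum_map_mul (constMatrix N).toRingHom ?_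
    simp only [Matrix.neg_apply, mul_neg, neg_mul, Finset.sum_neg_distrib, neg_neg,
      blocks_Ru_mul_Rv, blocks_Rv_mul_Ru, blocks_Ru_mul_Ru, blocks_Rv_mul_Rv]

theorem delta_eq_of_mem_Ytw {y : Uq N} (hy : y ∈ Ytw N) :
    (idTwist N).delta y = (thetaTwist N).delta y := by
  have h : Ytw N ≤ AlgHom.equalizer (idTwist N).delta (thetaTwist N).delta := by
    refine Algebra.adjoin_le ?_
    rintro _ ⟨r, i, j, rfl⟩
    exact delta_s_eq r i j
  exact h hy

end Reflection

/-! ### Specialization at q = 1 as the quotient by q - 1 -/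

section AtOne

theorem qA_sub_one_dvd_T (n : ℤ) : qA - 1 ∣ LaurentPolynomial.T n - 1 := by
  have h : ∀ n : ℕ, qA - 1 ∣ LaurentPolynomial.T (n : ℤ) - 1 := fun n => by
    have := sub_dvd_pow_sub_pow qA 1 n
    rwa [one_pow, qA, LaurentPolynomial.T_pow, mul_one] at this
  rcases Int.eq_nat_or_neg n with ⟨m, rfl | rfl⟩
  · exact h m
  · have e : (LaurentPolynomial.T (-m : ℤ) - 1 : A) =
        -(LaurentPolynomial.T (m : ℤ) - 1) * LaurentPolynomial.T (-m : ℤ) := by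
      rw [neg_mul, sub_mul, ← LaurentPolynomial.T_add, add_neg_cancel, LaurentPolynomial.T_zero]
      ring
    rw [e]
    exact (h m).neg_right.mul_right _

theorem evalOne_C (c : ℂ) : evalOne (LaurentPolynomial.C c) = c := by
  simp [evalOne]

theorem qA_sub_one_dvd (a : A) : qA - 1 ∣ LaurentPolynomial.C (evalOne a) - a := by
  induction a using LaurentPolynomial.induction_on' with
  | add x y hx hy =>
    rw [map_add, map_add, add_sub_add_comm]
    exact dvd_add hx hy
  | C_mul_T n c =>
    rw [map_mul, evalOne_T, mul_one, evalOne_C]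
    have e : (LaurentPolynomial.C c - LaurentPolynomial.C c * LaurentPolynomial.T n : A) =
      -(LaurentPolynomial.T n - 1) * LaurentPolynomial.C c := by ring
    rw [e]
    exact (qA_sub_one_dvd_T n).neg_right.mul_right _

variable {M : Type*} [AddCommGroup M] [Module A M]

theorem atOne_eq_one_tmul (z : ℂ ⊗[A] M) : ∃ m : M, z = 1 ⊗ₜ m := by
  induction z with
  | zero => exact ⟨0, (TensorProduct.tmul_zero _ _).symm⟩
  | add x y hx hy =>
    obtain ⟨m, rfl⟩ := hx
    obtain ⟨m', rfl⟩ := hy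
    exact ⟨m + m', (TensorProduct.tmul_add _ _ _).symm⟩
  | tmul c m =>
    refine ⟨LaurentPolynomial.C c • m, ?_⟩
    rw [TensorProduct.tmul_smul, TensorProduct.smul_tmul']
    congr 1
    change c = evalOne (LaurentPolynomial.C c) * 1
    rw [evalOne_C, mul_one]

theorem one_tmul_smul (m : M) : (1 : ℂ) ⊗ₜ[A] ((qA - 1) • m) = 0 := by
  rw [TensorProduct.tmul_smul, TensorProduct.smul_tmul']
  change (evalOne (qA - 1) * 1) ⊗ₜ[A] m = 0
  rw [evalOne_sub_one, zero_mul, TensorProduct.zero_tmul]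

theorem exists_smul_of_one_tmul_eq_zero {m : M} (h : (1 : ℂ) ⊗ₜ[A] m = 0) :
    ∃ m' : M, m = (qA - 1) • m' := by
  set W : Submodule A M := LinearMap.range (LinearMap.lsmul A M (qA - 1)) with hW
  have mem : ∀ (a b : A) (x : M), qA - 1 ∣ a - b → W.mkQ (a • x) = W.mkQ (b • x) := by
    rintro a b x ⟨c, hc⟩
    refine (Submodule.Quotient.eq W).2 ⟨c • x, ?_⟩
    rw [LinearMap.lsmul_apply, smul_smul, ← hc, sub_smul]
  -- The map c ⊗ x ↦ c x from ℂ ⊗ M to M/(q - 1)M is well defined because a Laurent polynomial is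
  -- congruent to its value at 1 modulo q - 1.
  let f : ℂ →ₗ[A] M →ₗ[A] M ⧸ W := LinearMap.mk₂ A (fun c x => W.mkQ (LaurentPolynomial.C c • x))
    (fun c c' x => by rw [map_add, add_smul, map_add])
    (fun a c x => by
      rw [← map_smul, smul_smul]
      refine mem _ _ _ ?_
      change qA - 1 ∣ LaurentPolynomial.C (evalOne a * c) - _
      rw [map_mul, ← sub_mul]
      exact (qA_sub_one_dvd a).mul_right _)
    (fun c x y => by rw [smul_add, map_add])
    (fun a c x => by rw [smul_comm, map_smul])
  have h' := congrArg (TensorProduct.lift f) h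
  rw [TensorProduct.lift.tmul, map_zero] at h'
  change W.mkQ (LaurentPolynomial.C (1 : ℂ) • m) = 0 at h'
  rw [map_one, one_smul] at h'
  obtain ⟨m', hm'⟩ := (Submodule.Quotient.mk_eq_zero W).1 h'
  exact ⟨m', hm'.symm⟩

end AtOne

/-! ### The limit of the twisted q-Yangian -/

section TwistedYangian

attribute [local instance] LieRing.ofAssociativeRing

open UniversalEnvelopingAlgebra

variable {N : ℕ}
-- The integral part is saturated: if (q - 1)m lies in V and m in `UA`, then m lies in V, since V is
-- a ℂ(q)-subspace. This holds for every V.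
theorem specializedInclusion_injective (V : Subalgebra K (Uq N)) :
    Function.Injective (specializedInclusion V) := by
  rw [injective_iff_map_eq_zero]
  intro x hx
  obtain ⟨y, rfl⟩ := atOne_eq_one_tmul x
  obtain ⟨m, hm⟩ := exists_smul_of_one_tmul_eq_zero (M := UA N) hx
  have hm' : (y : Uq N) = (qA - 1) • (m : Uq N) := congrArg Subtype.val hm
  have hV : (m : Uq N) ∈ V := by
    have := V.smul_mem y.2.1 ((algebraMap A K (qA - 1))⁻¹)
    rwa [hm', ← algebraMap_smul K (qA - 1), inv_smul_smul₀] at this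
    exact (map_ne_zero_iff _ (IsFractionRing.injective A K)).2 qA_sub_one_ne_zero
  have e : y = (qA - 1) • (⟨m, hV, m.2⟩ : integralPart V) := Subtype.ext hm'
  rw [e]
  exact one_tmul_smul _

/-- The upper bound: agreement of the two quantum homomorphisms on y becomes agreement of the
coactions along the identity and θ on its limit, where `mem_adjoin_of_coaction_eq` applies. -/
theorem classicalLimit_mem_range {y : Uq N} (hy : y ∈ integralPart (Ytw N)) :
    classicalLimit N (spec N ⟨y, hy.2⟩) ∈ (fixedEnvelopingMap N).range := by
  set v := classicalLimit N (spec N ⟨y, hy.2⟩) with hv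
  have h1 : (idTwist N).deltaA ⟨y, hy.2⟩ = (thetaTwist N).deltaA ⟨y, hy.2⟩ := by
    apply inclLoop_injective
    rw [LoopTwist.inclLoop_deltaA, LoopTwist.inclLoop_deltaA]
    exact delta_eq_of_mem_Ytw hy.1
  have h2 : (idTwist N).deltaBar (loopHom N v) = (thetaTwist N).deltaBar (loopHom N v) := by
    rw [hv, loopHom_classicalLimit, LoopTwist.deltaBar_spec, LoopTwist.deltaBar_spec, h1]
  rw [(idTwist N).deltaBar_loopHom LieHom.id (fun i j p => (idTwist_image i j p).symm),
    (thetaTwist N).deltaBar_loopHom (theta N) (fun i j p => (thetaTwist_image i j p).symm)] at h2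
  have h3 := Module.Flat.rTensor_preserves_injective_linearMap (M := LoopGL N)
    (loopHom N).toLinearMap loopHom_injective h2
  have h4 := mem_adjoin_of_coaction_eq (theta N) theta_theta h3
  refine Algebra.adjoin_le (S := (fixedEnvelopingMap N).range) ?_ h4
  rintro _ ⟨X, hX, rfl⟩
  exact ⟨ι ℂ (⟨X, hX⟩ : fixedLoopGL N), fixedEnvelopingMap_ι _⟩

theorem sum_antidiagonal_one_add_mul {R : Type*} [Ring R] (a b : ℕ → R) (r : ℕ) :
    ∑ p ∈ Finset.HasAntidiagonal.antidiagonal r,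
        ((if p.1 = 0 then 1 else 0) + a p.1) * ((if p.2 = 0 then 1 else 0) + b p.2) =
      (if r = 0 then 1 else 0) + (a r + b r +
        ∑ p ∈ Finset.HasAntidiagonal.antidiagonal r, a p.1 * b p.2) := by
  have h : (1 + PowerSeries.mk a) * (1 + PowerSeries.mk b) =
      1 + (PowerSeries.mk a + PowerSeries.mk b + PowerSeries.mk a * PowerSeries.mk b) := by
    noncomm_ring
  have h' := congrArg (PowerSeries.coeff r) h
  simpa only [PowerSeries.coeff_mul, map_add, PowerSeries.coeff_one, PowerSeries.coeff_mk] using h'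

/-- The element `s_{ij}^{(r)} / (q - 1)`, for `(r, i, j)` not of the form `(0, i, i)`. -/
def sigma (r : ℕ) (i j : Fin N) : UA N :=
  xA r i j + xbarA r j i + (qA - 1) • ∑ p ∈ Finset.HasAntidiagonal.antidiagonal r,
    ∑ a, xA p.1 i a * xbarA p.2 j a

theorem s_eq_sigma {r : ℕ} {i j : Fin N} (h : ¬(r = 0 ∧ i = j)) :
    s r i j = (qA - 1) • (sigma r i j : Uq N) := by
  have e : ∀ p : ℕ, ((if p = 0 then (1 : ℤ) else 0) • 1 : Matrix (Fin N) (Fin N) (Uq N)) =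
      if p = 0 then 1 else 0 := fun p => by split_ifs <;> simp
  have h1 : s r i j = (∑ p ∈ Finset.HasAntidiagonal.antidiagonal r,
      (Matrix.of fun i j => t p.1 i j) * (Matrix.of fun i j => tbar p.2 i j).transpose :
        Matrix (Fin N) (Fin N) (Uq N)) i j := by
    rw [s, Finset.sum_comm, Matrix.sum_apply]
    rfl
  have h2 := sum_antidiagonal_one_add_mul (R := Matrix (Fin N) (Fin N) (Uq N))
    (fun r => (qA - 1) • (xA r).map (UA N).val)
    (fun r => (qA - 1) • ((xbarA r).map (UA N).val).transpose) r
  simp only [tbar_eq_xbarA, t_eq_xA, e, Matrix.transpose_add, apply_ite Matrix.transpose,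
    Matrix.transpose_one, Matrix.transpose_zero, Matrix.transpose_smul] at h1
  rw [h1, h2]
  have h3 : (if r = 0 then (1 : Matrix (Fin N) (Fin N) (Uq N)) else 0) i j = 0 := by
    split_ifs with hr
    · exact Matrix.one_apply_ne fun hij => h ⟨hr, hij⟩
    · rfl
  rw [Matrix.add_apply, h3, zero_add]
  simp only [smul_mul_smul_comm, ← Finset.smul_sum, ← smul_add, mul_smul]
  rw [Matrix.smul_apply]
  congr 1
  rw [Matrix.add_apply, Matrix.add_apply, Matrix.smul_apply, Matrix.sum_apply]
  change _ = (UA N).val (sigma r i j)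
  rw [sigma, map_add, map_add, map_smul, map_sum]
  simp only [map_sum, map_mul]
  rfl

theorem spec_sigma (r : ℕ) (i j : Fin N) :
    spec N (sigma r i j) = spec N (xA r i j) + spec N (xbarA r j i) := by
  rw [sigma, map_add, map_add, map_smul, Ubar_smul, add_zero]

theorem sigma_mem {r : ℕ} {i j : Fin N} (h : ¬(r = 0 ∧ i = j)) :
    (sigma r i j : Uq N) ∈ integralPart (Ytw N) := by
  refine ⟨?_, (sigma r i j).2⟩
  have := (Ytw N).smul_mem (Algebra.subset_adjoin ⟨r, i, j, rfl⟩ : s r i j ∈ Ytw N)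
    ((algebraMap A K (qA - 1))⁻¹)
  rwa [s_eq_sigma h, ← algebraMap_smul K (qA - 1), inv_smul_smul₀] at this
  exact (map_ne_zero_iff _ (IsFractionRing.injective A K)).2 qA_sub_one_ne_zero

/-- The hypothesis excludes r = 0, i ≤ j, so neither τ_{ij} nor τ̄_{ji} is an exceptional or
diagonal degree-zero generator, and both carry the factor 1 + q⁻¹, which tends to 2. -/
theorem spec_sigma_eq {r : ℕ} {i j : Fin N} (h : 0 < r ∨ j < i) :
    spec N (sigma r i j) = (2 : ℤ) • loopHom N (EU i j r - EU j i (-r)) := by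
  have e1 : ¬(r = 0 ∧ i = j) := by grind
  have e2 : ¬(r = 0 ∧ j = i) := by grind
  have e3 : ¬(r = 0 ∧ i < j) := by grind
  have hs := loopHom_taubar r j i e3
  rw [spec_sigma, xA, xbarA, Matrix.of_apply, Matrix.of_apply, if_neg e1, if_neg e2, spec_smul_two,
    spec_smul_two, ← smul_add]
  congr 1
  refine Eq.symm ((map_sub (loopHom N) _ _).trans ?_)
  rw [loopHom_tau r i j e3, hs, sub_neg_eq_add]

/-- The subalgebra of `U(ĝl_N)` to which `V` specializes. -/
def limitRange (V : Subalgebra K (Uq N)) : Subalgebra ℂ (ULoopGL N) :=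
  ((classicalLimit N).toAlgHom.comp (specializedInclusion V)).range

theorem mem_limitRange {V : Subalgebra K (Uq N)} {y : Uq N} (hy : y ∈ integralPart V) :
    classicalLimit N (spec N ⟨y, hy.2⟩) ∈ limitRange V :=
  ⟨1 ⊗ₜ ⟨y, hy⟩, rfl⟩

theorem EU_sub_mem_of_pos {r : ℕ} {i j : Fin N} (h : 0 < r ∨ j < i) :
    EU i j r - EU j i (-r) ∈ limitRange (Ytw N) := by
  have h1 := mem_limitRange (sigma_mem (i := i) (j := j) (r := r) (by grind))
  have h2 : classicalLimit N (spec N (sigma r i j)) = (2 : ℤ) • (EU i j r - EU j i (-r)) := by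
    rw [classicalLimit_eq_iff, spec_sigma_eq h, map_zsmul]
  have h3 := Subalgebra.smul_mem _ (h2 ▸ h1 : (2 : ℤ) • (EU i j r - EU j i (-r)) ∈ _) (1 / 2 : ℂ)
  rwa [← Int.cast_smul_eq_zsmul ℂ, smul_smul, show (1 / 2 : ℂ) * ((2 : ℤ) : ℂ) = 1 by norm_num,
    one_smul] at h3

/-- The element changes sign under (i, j, p) ↦ (j, i, -p) and vanishes for p = 0, i = j, which
reduces everything to the range of `EU_sub_mem_of_pos`. -/
theorem EU_sub_mem (i j : Fin N) (p : ℤ) : EU i j p - EU j i (-p) ∈ limitRange (Ytw N) := by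
  by_cases h : 0 < p ∨ (p = 0 ∧ j < i)
  · have := EU_sub_mem_of_pos (i := i) (j := j) (r := p.natAbs) (by grind)
    rwa [show ((p.natAbs : ℕ) : ℤ) = p by grind] at this
  · by_cases h' : p = 0 ∧ i = j
    · rw [h'.1, h'.2, neg_zero, sub_self]
      exact zero_mem _
    · have := neg_mem (EU_sub_mem_of_pos (i := j) (j := i) (r := p.natAbs) (by grind))
      rwa [show ((p.natAbs : ℕ) : ℤ) = -p by grind, neg_neg, neg_sub] at this

theorem ι_add_theta_mem (X : LoopGL N) : ι ℂ (X + theta N X) ∈ limitRange (Ytw N) := by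
  induction X using loop_induction with
  | zero => rw [map_zero, add_zero, map_zero]; exact zero_mem _
  | add X Y hX hY =>
    rw [map_add (theta N), add_add_add_comm, map_add]
    exact add_mem hX hY
  | basis c i j n =>
    rw [map_smul, ← smul_add, map_smul, theta_Eloop, map_add, map_neg, ← sub_eq_add_neg]
    exact Subalgebra.smul_mem _ (EU_sub_mem i j n) c

theorem limitRange_Ytw : limitRange (Ytw N) = (fixedEnvelopingMap N).range := by
  apply le_antisymm
  · rintro _ ⟨x, rfl⟩
    obtain ⟨y, rfl⟩ := atOne_eq_one_tmul x
    exact classicalLimit_mem_range y.2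
  · rw [← Algebra.map_top, ← adjoin_range_ι, AlgHom.map_adjoin]
    refine Algebra.adjoin_le ?_
    rintro _ ⟨_, ⟨X, rfl⟩, rfl⟩
    have h : theta N X = X := X.2
    -- A fixed element X equals (X + θ(X))/2, so the elements already obtained generate.
    have := Subalgebra.smul_mem _ (ι_add_theta_mem (X : LoopGL N)) (1 / 2 : ℂ)
    rw [h, ← two_smul ℂ, map_smul, smul_smul, show (1 / 2 : ℂ) * 2 = 1 by norm_num, one_smul] at this
    exact (fixedEnvelopingMap_ι X).symm ▸ this

theorem specializes_Ytw :
    Specializes (classicalLimit N) (Ytw N) (fixedEnvelopingMap N).range :=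
  ⟨(AlgEquiv.ofInjective ((classicalLimit N).toAlgHom.comp (specializedInclusion (Ytw N)))
      ((classicalLimit N).injective.comp (specializedInclusion_injective _))).trans
    (Subalgebra.equivOfEq _ _ limitRange_Ytw), fun _ => rfl⟩

end TwistedYangian

end TwistedQYangian

end

theorem corollary3p5 (N : ℕ) :
    ∃ Φ : TensorProduct TwistedQYangian.A ℂ (TwistedQYangian.UA N) ≃ₐ[ℂ]
        TwistedQYangian.ULoopGL N,
      TwistedQYangian.IsClassicalLimit Φ ∧
      Function.Injective (TwistedQYangian.fixedEnvelopingMap N) ∧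
      TwistedQYangian.Specializes Φ (TwistedQYangian.Ytw N)
        (TwistedQYangian.fixedEnvelopingMap N).range :=
  ⟨TwistedQYangian.classicalLimit N, TwistedQYangian.isClassicalLimit_classicalLimit,
    TwistedQYangian.fixedEnvelopingMap_injective, TwistedQYangian.specializes_Ytw⟩
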